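/- Identify the unit circle $\mathbb S$ with $\mathbb R/\mathbb Z$ and let $\sigma_3(x)=3x$. A chord $\overline{ab}$ of the unit disk may be degenerate ($a=b$); put $\sigma_3(\overline{ab})=\overline{\sigma_3(a)\sigma_3(b)}$, let $-\ell$ be the image of a chord $\ell$ under the half-turn $x\mapsto x+\frac12$, and let $\|\overline{ab}\|\in[0,\frac12]$ be the length of the shorter arc between $a$ and $b$. A chord is short if $0<\|\ell\|<\frac16$. Distinct chords cross if they meet inside the open disk. A lamination is a set $\mathcal L$ of pairwise non-crossing chords (leaves) with closed union, containing all points of $\mathbb S$ as degenerate leaves. It is a symmetric (cubic) lamination if: for every $\ell\in\mathcal L$, $\sigma_3(\ell)$ is a leaf or a point; every $\ell\in\mathcal L$ equals $\sigma_3(\ell')$ for some $\ell'\in\mathcal L$; every $\ell\in\mathcal L$ with non-degenerate image belongs to a triple of pairwise disjoint leaves with the same image; and $\ell\in\mathcal L$ implies $-\ell\in\mathcal L$. A major of $\mathcal L$ is a leaf whose length is closest to $\frac13$ among all leaves. A comajor is a leaf $d$ with $\|d\|\le\frac16$ that is disjoint from some major $M$ with $\|M\|>\frac16$ and satisfies $\sigma_3(d)=\sigma_3(M)$.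 The pair $\{c,-c\}$ is the comajor pair of $\mathcal L$ if the set of comajors of $\mathcal L$ is exactly $\{c,-c\}$. For $c=\overline{x\,(x+t)}$ with $0\le t\le\frac16$, let $M_c=\overline{(x+\frac13)\,(x+t+\frac23)}$ and $M_c'=\overline{(x+t+\frac13)\,(x+\frac23)}$ (these coincide and are critical if $t=0$), let $Q_c$ be the convex hull of $M_c\cup M_c'$, and, for $t>0$, let $C(M_c)$ be the closed strip of the disk between $M_c$ and $M'_c$. The pair $\{c,-c\}$ is legal if $c$ is degenerate, or $0<\|c\|\le\frac16$ and (a) no two iterated forward images of $\pm c$ (including $\pm c$) cross, and (b) no iterated forward image of $c$ meets the interior of $C(M_c)$ or of $-C(M_c)$. For a legal pair $\{c,-c\}$ define a family $\mathcal C_c$ of chords as follows. A pullback of a chord $\ell$ generated by a family $\mathcal A$ is a chord $\ell'$ with $\sigma_3(\ell')=\ell$ that crosses no chord of $\mathcal A$. (i) If $c=x$ is degenerate, $\mathcal C_c$ consists of $\pm M_c$ and all their iterated pullbacks generated by $\{M_c,-M_c\}$, where, whenever a chord to be pulled back has an endpoint $3x$ or $3x+\frac12$, only its short pullbacks are taken.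 (ii) If $0<\|c\|<\frac16$, $\mathcal C_c$ consists of the edges of $\pm Q_c$, the iterated forward images of $\pm c$, and all their iterated pullbacks generated by the edges of $\pm Q_c$. (iii) If $\|c\|=\frac16$, so that $M_c$ is an invariant diameter, $\mathcal C_c$ consists of $M_c$, $\pm c$ and all iterated short pullbacks (short chords $\ell'$ with $\sigma_3(\ell')=\ell$). The pullback lamination $\mathcal L(c)$ is the closure of $\mathcal C_c$ in the space of chords together with all points of $\mathbb S$. **Lemma.** (1) For every legal pair $\{c,-c\}$, $\mathcal L(c)$ is a symmetric lamination whose comajor pair is $\{c,-c\}$. (2) A symmetric pair of chords $\{c,-c\}$ is the comajor pair of some symmetric lamination if and only if it is legal. -/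

import Mathlib

noncomputable section

namespace CubicLam

/-- The circle `ℝ/ℤ`. -/
abbrev S : Type := UnitAddCircle

/-- A chord of the unit disk is the unordered pair of its endpoints; a degenerate chord (a point of
the circle) is a pair on the diagonal. -/
abbrev Chord : Type := Sym2 S

/-- The chord whose endpoints are the classes of the real numbers `x` and `y`. -/
def chord (x y : ℝ) : Chord := s((x : S), (y : S))

/-- The tripling map acting on chords. -/
def sigma : Chord → Chord := Sym2.map (fun p => 3 • p)

/-- The half-turn about the centre acting on chords: `ℓ ↦ -ℓ`. -/
def antipode : Chord → Chord := Sym2.map (fun p => p + ((1 / 2 : ℝ) : S))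

/-- The length of a chord: the length of the shorter of the two arcs between its endpoints
(the circle has total length `1`). -/
def length : Chord → ℝ := Sym2.lift ⟨fun p q => dist p q, fun p q => dist_comm p q⟩

/-- A short chord. -/
def IsShort (ℓ : Chord) : Prop := 0 < length ℓ ∧ length ℓ < 1 / 6

/-- The chord as a subset of the closed unit disk. -/
def hull (ℓ : Chord) : Set ℂ := convexHull ℝ ((fun p : S => (AddCircle.toCircle p : ℂ)) '' {p | p ∈ ℓ})

/-- Two chords cross (are linked): their endpoints are four distinct points that alternate on the
circle; equivalently, the chords are distinct and meet inside the open disk. -/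
def Crosses (ℓ ℓ' : Chord) : Prop :=
  ∃ x u v w : ℝ, 0 < u ∧ u < v ∧ v < w ∧ w < 1 ∧
    ℓ = chord x (x + v) ∧ ℓ' = chord (x + u) (x + w)

/-- Two chords are disjoint as subsets of the closed disk. -/
def DisjointChords (ℓ ℓ' : Chord) : Prop := (∀ p, p ∈ ℓ → p ∉ ℓ') ∧ ¬ Crosses ℓ ℓ'

/-- Laminations. All points of the circle count as degenerate leaves. -/
structure IsLamination (L : Set Chord) : Prop where
  degenerate_mem : ∀ p : S, s(p, p) ∈ L
  not_crosses : ∀ ℓ ∈ L, ∀ ℓ' ∈ L, ¬ Crosses ℓ ℓ'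
  isClosed : IsClosed (⋃ ℓ ∈ L, hull ℓ)

/-- Laminations that are invariant under the tripling map. -/
structure IsInvariantLamination (L : Set Chord) : Prop extends IsLamination L where
  forward : ∀ ℓ ∈ L, sigma ℓ ∈ L ∨ (sigma ℓ).IsDiag
  backward : ∀ ℓ ∈ L, ∃ ℓ' ∈ L, sigma ℓ' = ℓ
  siblings : ∀ ℓ ∈ L, ¬ (sigma ℓ).IsDiag →
    ∃ f : Fin 3 → Chord, f 0 = ℓ ∧ (∀ i, f i ∈ L ∧ sigma (f i) = sigma ℓ) ∧
      ∀ i j, i ≠ j → DisjointChords (f i) (f j)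

/-- Symmetric (cubic) laminations. -/
structure IsSymmetricLamination (L : Set Chord) : Prop extends IsInvariantLamination L where
  symmetric : ∀ ℓ ∈ L, antipode ℓ ∈ L

/-- A major of `L`: a leaf closest to criticality, that is, with length closest to `1/3`. -/
def IsMajor (L : Set Chord) (M : Chord) : Prop :=
  M ∈ L ∧ ∀ ℓ ∈ L, |length M - 1 / 3| ≤ |length ℓ - 1 / 3|

/-- A comajor of `L`: the short sibling of a major. A sibling is a leaf of `L` with the same image
that is disjoint from the major; it is degenerate if the major is critical, and siblings of length
exactly `1/6` are allowed. In that last case the majors are understood to be the leaves of length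
`1/2` (a leaf of length `1/6` is then equally far from criticality, but it is not a major). -/
def IsComajor (L : Set Chord) (d : Chord) : Prop :=
  d ∈ L ∧ length d ≤ 1 / 6 ∧
    ∃ M, IsMajor L M ∧ 1 / 6 < length M ∧ sigma d = sigma M ∧ DisjointChords d M

/-- `{c, -c}` is the comajor pair of `L`. -/
def IsComajorPair (L : Set Chord) (c : Chord) : Prop :=
  {d | IsComajor L d} = {c, antipode c}

/-! ### Siblings and short strips

In this part `x` and `t` are real numbers with `0 ≤ t ≤ 1/6`, and they stand for the chord
`c = chord x (x + t)`, of length `t`. -/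

/-- The long (critical if `t = 0`, a diameter if `t = 1/6`) sibling `M_c`. -/
def longSib (x t : ℝ) : Chord := chord (x + 1 / 3) (x + t + 2 / 3)

/-- The medium (critical if `t = 0`, of length `1/6` if `t = 1/6`) sibling `M'_c`. -/
def medSib (x t : ℝ) : Chord := chord (x + t + 1 / 3) (x + 2 / 3)

/-- The edges of the quadrilateral `Q_c`, the convex hull of `M_c` and `M'_c`. -/
def quadEdges (x t : ℝ) : Set Chord :=
  {longSib x t, medSib x t, chord (x + 1 / 3) (x + t + 1 / 3), chord (x + 2 / 3) (x + t + 2 / 3)}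

/-- Both endpoints of `ℓ` belong to the closed arc from `a` to `b` (used for `a ≤ b ≤ a + 1`);
equivalently, `ℓ` is contained in the closed part of the disk which the chord `chord a b` cuts off on
the side of this arc. -/
def InCap (a b : ℝ) (ℓ : Chord) : Prop := ∀ p ∈ ℓ, p ∈ (fun r : ℝ => (r : S)) '' Set.Icc a b

/-- For `0 < t`, the nondegenerate chord `ℓ` meets the interior of the strip `C(M_c)` between `M_c`
and `M'_c`. This strip is bounded by `M_c`, `M'_c` and the arcs `[x + 1/3, x + t + 1/3]` and
`[x + 2/3, x + t + 2/3]`, so a chord misses its interior if and only if it is contained in one of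
the two closed parts of the disk that lie beyond `M'_c` and beyond `M_c`. -/
def MeetsStrip (x t : ℝ) (ℓ : Chord) : Prop :=
  ¬ InCap (x + t + 1 / 3) (x + 2 / 3) ℓ ∧ ¬ InCap (x + t + 2 / 3) (x + 4 / 3) ℓ

/-- `ℓ` meets the interior of one of the two short strips `C(M_c)`, `-C(M_c)`. -/
def MeetsShortStrips (x t : ℝ) (ℓ : Chord) : Prop :=
  MeetsStrip x t ℓ ∨ MeetsStrip (x + 1 / 2) t ℓ

/-- The iterated forward images of `c` and `-c` (including `c` and `-c` themselves). -/
def orbitPair (c : Chord) : Set Chord :=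
  {ℓ | ∃ n : ℕ, ℓ = sigma^[n] c ∨ ℓ = sigma^[n] (antipode c)}

/-- `{c, -c}` is a legal pair: either `c` is degenerate, or `c` is a chord of length at most `1/6`
such that no two forward images of `±c` cross, and no forward image of `c` meets the interior of the
short strips of `M_c`. -/
def IsLegal (c : Chord) : Prop :=
  c.IsDiag ∨
    ∃ x t : ℝ, 0 < t ∧ t ≤ 1 / 6 ∧ c = chord x (x + t) ∧
      (∀ ℓ ∈ orbitPair c, ∀ ℓ' ∈ orbitPair c, ¬ Crosses ℓ ℓ') ∧
      (∀ n : ℕ, ¬ MeetsShortStrips x t (sigma^[n] c))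

/-! ### The pullback lamination -/

/-- `ℓ'` is a pullback chord of `ℓ` generated by the family `A`. -/
def IsPullback (A : Set Chord) (ℓ' ℓ : Chord) : Prop :=
  sigma ℓ' = ℓ ∧ ∀ e ∈ A, ¬ Crosses ℓ' e

/-- The family `𝒞_c` for the degenerate chord `c` at the point `x`: iterated pullbacks of the critical
chords `±M_c` generated by `±M_c`. If `ℓ` has an endpoint at `σ₃(M_c) = 3x` or at
`σ₃(-M_c) = 3x + 1/2`, then its pullbacks are ambiguous, and only the short ones are chosen. -/
inductive DegenerateFamily (x : ℝ) : Chord → Prop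
  | pos : DegenerateFamily x (longSib x 0)
  | neg : DegenerateFamily x (antipode (longSib x 0))
  | pullback (ℓ ℓ' : Chord) : DegenerateFamily x ℓ →
      IsPullback {longSib x 0, antipode (longSib x 0)} ℓ' ℓ →
      (((3 * x : ℝ) : S) ∈ ℓ ∨ ((3 * x + 1 / 2 : ℝ) : S) ∈ ℓ → IsShort ℓ') →
      DegenerateFamily x ℓ'

/-- The family `𝒞_c` for `c = chord x (x + t)` with `0 < t < 1/6`: it starts with the edges of `±Q_c`
and the forward images of `±c`, and contains all their iterated pullbacks generated by the edges of
`±Q_c`. -/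
inductive NondegenerateFamily (x t : ℝ) : Chord → Prop
  | orbit (ℓ : Chord) : ℓ ∈ orbitPair (chord x (x + t)) → NondegenerateFamily x t ℓ
  | edge (ℓ : Chord) : ℓ ∈ quadEdges x t ∪ antipode '' quadEdges x t → NondegenerateFamily x t ℓ
  | pullback (ℓ ℓ' : Chord) : NondegenerateFamily x t ℓ →
      IsPullback (quadEdges x t ∪ antipode '' quadEdges x t) ℓ' ℓ →
      NondegenerateFamily x t ℓ'

/-- The family for `c = chord x (x + 1/6)`: the invariant diameter `M_c`, the chords `±c`, and all
their iterated pullbacks by short chords. (The only pullbacks of `M_c` itself that are used are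
`M_c` and `±c`.) Its closure is the lamination with two Fatou gaps which share the edge `M_c`. -/
inductive SixthFamily (x : ℝ) : Chord → Prop
  | diam : SixthFamily x (longSib x (1 / 6))
  | pos : SixthFamily x (chord x (x + 1 / 6))
  | neg : SixthFamily x (antipode (chord x (x + 1 / 6)))
  | pullback (ℓ ℓ' : Chord) : SixthFamily x ℓ → sigma ℓ' = ℓ → IsShort ℓ' → SixthFamily x ℓ'

/-- The prelamination `𝒞_c`, for a chord `c` of length at most `1/6`. -/
def pullbackFamily (c : Chord) : Set Chord :=
  {ℓ | ∃ x t : ℝ, c = chord x (x + t) ∧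
    ((t = 0 ∧ DegenerateFamily x ℓ) ∨
      (0 < t ∧ t < 1 / 6 ∧ NondegenerateFamily x t ℓ) ∨
      (t = 1 / 6 ∧ SixthFamily x ℓ))}

/-- The closure of a family of chords: all limits of chords of the family (convergence of endpoints). -/
def chordClosure (C : Set Chord) : Set Chord :=
  {ℓ | ∃ p ∈ closure {p : S × S | s(p.1, p.2) ∈ C}, ℓ = s(p.1, p.2)}

/-- The pullback lamination `𝓛(c)`: the closure of `𝒞_c`, with all points of the circle as degenerate
leaves. -/
def pullbackLamination (c : Chord) : Set Chord :=
  {ℓ | ℓ.IsDiag} ∪ chordClosure (pullbackFamily c)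

end CubicLam

end

namespace CubicLam

open Set Topology

/-! ### Chords in real coordinates -/

/-! Write `t` for the length of `c`. A comajor pair is legal because its major `M` is as close to
`1/3` as a leaf can be. If `c` is nondegenerate, the sibling triple of `M`, together with the fact
that leaves do not cross, makes both `M_c` and `M'_c` leaves (`longSib_medSib_mem`), and `M` is at
distance exactly `t` from length `1/3`. Hence every leaf is at distance at least `t` from `1/3`, and
tripling sends a leaf of length at least `t` to one of length at least `3t`. All images of `c` are
thus too long to sit over the end arcs of a short strip and too far from `1/3` to join these arcs,
so they miss the strips (`not_meetsStrip`); they do not cross because they are leaves.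

Conversely, for `t < 1/6` the edges of `±Q_c` cut the disk into `±Q_c` and seven complementary
regions (for `t = 0` some of these collapse). Noncritical chords that cross no edge are exactly the
nondegenerate chords inside one region, up to limiting cases when `t = 0`. On the boundary of a
region the tripling map keeps the cyclic order, so crossing chords have crossing images
(`InRegion.crosses_sigma`); absence of crossings therefore passes from the forward orbit, where
legality gives it, to all iterated pullbacks. A chord that does not cross `σ₃(c)` lifts into a
region (`exists_inRegion_sigma_eq`), and a region chord whose image crosses neither of `σ₃(±c)` has
its siblings in regions (`InRegion.hasRegionSiblings`). These are closed conditions on endpoints and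
survive in the closure (`isSymmetricLamination_closure`). The chords in regions with length nearest
`1/3` are `±M_c` and `±M'_c`, whose short siblings are `±c` (`isComajorPair_of_quadEdges_mem`).

In the two extreme cases the endpoints of `±Q_c` interfere. For `t = 0` a chord at `3x` or `3x +
1/2` has several lifts, and the short ones lie over arcs of length `1/6` on which tripling is
injective. For `t = 1/6` the strip condition forces `M_c` to be an invariant diameter, and every
other chord of the family lies over such an arc. -/

lemma coe_eq_coe {a b : ℝ} : (a : S) = b ↔ ∃ n : ℤ, b = a + n := by
  rw [eq_comm, ← sub_eq_zero, ← AddCircle.coe_sub, AddCircle.coe_eq_zero_iff]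
  refine exists_congr fun n => ?_
  rw [zsmul_one]
  constructor <;> intro h <;> linarith

lemma coe_add_int (a : ℝ) (n : ℤ) : ((a + n : ℝ) : S) = a := (coe_eq_coe.2 ⟨n, rfl⟩).symm

lemma chord_comm (a b : ℝ) : chord a b = chord b a := Sym2.eq_swap

lemma chord_shift {a b a' b' : ℝ} (m n : ℤ) (ha : a' = a + m) (hb : b' = b + n) :
    chord a' b' = chord a b := by
  rw [ha, hb, chord, chord, coe_add_int, coe_add_int]

lemma chord_eq_iff {a b a' b' : ℝ} : chord a b = chord a' b' ↔
    (∃ m n : ℤ, a' = a + m ∧ b' = b + n) ∨ (∃ m n : ℤ, b' = a + m ∧ a' = b + n) := by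
  simp only [chord, Sym2.eq_iff, coe_eq_coe]
  constructor
  · rintro (⟨⟨m, hm⟩, n, hn⟩ | ⟨⟨m, hm⟩, n, hn⟩)
    exacts [.inl ⟨m, n, hm, hn⟩, .inr ⟨m, n, hm, hn⟩]
  · rintro (⟨m, n, hm, hn⟩ | ⟨m, n, hm, hn⟩)
    exacts [.inl ⟨⟨m, hm⟩, n, hn⟩, .inr ⟨⟨m, hm⟩, n, hn⟩]

lemma coe_mem_chord {r a b : ℝ} :
    (r : S) ∈ chord a b ↔ (∃ n : ℤ, a = r + n) ∨ ∃ n : ℤ, b = r + n := by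
  simp only [chord, Sym2.mem_iff, coe_eq_coe]

lemma chord_isDiag_iff {a b : ℝ} : (chord a b).IsDiag ↔ ∃ n : ℤ, b = a + n := by
  rw [chord, Sym2.mk_isDiag_iff, coe_eq_coe]

lemma chord_isDiag (a : ℝ) : (chord a a).IsDiag := chord_isDiag_iff.2 ⟨0, by simp⟩

lemma not_isDiag_chord {a b : ℝ} (h : a < b) (h' : b < a + 1) : ¬ (chord a b).IsDiag := by
  rw [chord_isDiag_iff]
  rintro ⟨n, rfl⟩
  have h0 : (0 : ℝ) < n := by linarith
  have h1 : (n : ℝ) < 1 := by linarith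
  norm_cast at h0 h1
  omega

lemma exists_coe_eq (p : S) (b : ℝ) : ∃ u : ℝ, 0 ≤ u ∧ u < 1 ∧ p = ((b + u : ℝ) : S) := by
  induction p using QuotientAddGroup.induction_on with
  | H r =>
    refine ⟨Int.fract (r - b), Int.fract_nonneg _, Int.fract_lt_one _, ?_⟩
    refine coe_eq_coe.2 ⟨-⌊r - b⌋, ?_⟩
    rw [Int.fract]
    push_cast
    ring

/-- Every chord has coordinates in `[0, 1)` relative to any base point. -/
lemma exists_coord (b : ℝ) (ℓ : Chord) :
    ∃ u v : ℝ, 0 ≤ u ∧ u ≤ v ∧ v < 1 ∧ ℓ = chord (b + u) (b + v) := by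
  induction ℓ using Sym2.ind with
  | _ p q =>
    obtain ⟨u, hu, hu', rfl⟩ := exists_coe_eq p b
    obtain ⟨v, hv, hv', rfl⟩ := exists_coe_eq q b
    rcases le_total u v with h | h
    · exact ⟨u, v, hu, h, hv', rfl⟩
    · exact ⟨v, u, hv, h, hu', Sym2.eq_swap⟩

lemma exists_coord_lt (b : ℝ) {ℓ : Chord} (h : ¬ ℓ.IsDiag) :
    ∃ u v : ℝ, 0 ≤ u ∧ u < v ∧ v < 1 ∧ ℓ = chord (b + u) (b + v) := by
  obtain ⟨u, v, hu, huv, hv, rfl⟩ := exists_coord b ℓ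
  refine ⟨u, v, hu, lt_of_le_of_ne huv ?_, hv, rfl⟩
  rintro rfl
  exact h (chord_isDiag _)

lemma sigma_mk (p q : S) : sigma s(p, q) = s(3 • p, 3 • q) := rfl

lemma sigma_chord (a b : ℝ) : sigma (chord a b) = chord (3 * a) (3 * b) := by
  simp only [chord, sigma_mk, ← AddCircle.coe_nsmul, nsmul_eq_mul, Nat.cast_ofNat]

lemma sigma_chord' {a b a' b' : ℝ} (m n : ℤ) (ha : 3 * a = a' + m) (hb : 3 * b = b' + n) :
    sigma (chord a b) = chord a' b' := by
  rw [sigma_chord, chord_shift m n ha hb]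

lemma antipode_mk (p q : S) :
    antipode s(p, q) = s(p + ((1 / 2 : ℝ) : S), q + ((1 / 2 : ℝ) : S)) := rfl

lemma antipode_chord (a b : ℝ) : antipode (chord a b) = chord (a + 1 / 2) (b + 1 / 2) := by
  simp only [chord, antipode_mk, AddCircle.coe_add]

lemma exists_eq_chord (ℓ : Chord) : ∃ a b, ℓ = chord a b := by
  obtain ⟨u, v, -, -, -, h⟩ := exists_coord 0 ℓ
  exact ⟨_, _, h⟩

lemma antipode_antipode (ℓ : Chord) : antipode (antipode ℓ) = ℓ := by
  obtain ⟨a, b, rfl⟩ := exists_eq_chord ℓ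
  rw [antipode_chord, antipode_chord]
  exact chord_shift 1 1 (by push_cast; ring) (by push_cast; ring)

lemma sigma_antipode (ℓ : Chord) : sigma (antipode ℓ) = antipode (sigma ℓ) := by
  obtain ⟨a, b, rfl⟩ := exists_eq_chord ℓ
  rw [antipode_chord, sigma_chord, sigma_chord, antipode_chord]
  exact chord_shift 1 1 (by push_cast; ring) (by push_cast; ring)

lemma iterate_sigma_antipode (n : ℕ) (ℓ : Chord) :
    sigma^[n] (antipode ℓ) = antipode (sigma^[n] ℓ) :=
  (Function.Commute.iterate_left sigma_antipode n) ℓ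

lemma sigma_isDiag {ℓ : Chord} (h : ℓ.IsDiag) : (sigma ℓ).IsDiag := Sym2.IsDiag.map h

lemma antipode_isDiag {ℓ : Chord} (h : ℓ.IsDiag) : (antipode ℓ).IsDiag := Sym2.IsDiag.map h

lemma antipode_isDiag_iff {ℓ : Chord} : (antipode ℓ).IsDiag ↔ ℓ.IsDiag :=
  ⟨fun h => antipode_antipode ℓ ▸ antipode_isDiag h, antipode_isDiag⟩

/-! ### Lengths -/

lemma length_mk (p q : S) : length s(p, q) = dist p q := rfl

lemma length_chord_eq_norm (a b : ℝ) : length (chord a b) = ‖((a - b : ℝ) : S)‖ := by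
  rw [chord, length_mk, dist_eq_norm, AddCircle.coe_sub]

lemma length_chord {a b : ℝ} (h : |a - b| ≤ 1 / 2) : length (chord a b) = |a - b| := by
  rw [length_chord_eq_norm, AddCircle.norm_coe_eq_abs_iff _ one_ne_zero]
  simpa using h

lemma length_chord_of_le {a b : ℝ} (h : a ≤ b) (h' : b ≤ a + 1 / 2) :
    length (chord a b) = b - a := by
  have : |a - b| = b - a := by rw [abs_sub_comm, abs_of_nonneg (by linarith)]
  rw [length_chord (by linarith), this]

lemma length_chord_of_ge {a b : ℝ} (h : a + 1 / 2 ≤ b) (h' : b ≤ a + 1) :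
    length (chord a b) = 1 - (b - a) := by
  rw [← chord_shift (a := a) (b := b) (a' := a + 1) (b' := b) 1 0 (by simp) (by simp), chord_comm,
    length_chord_of_le (by linarith) (by linarith)]
  ring

lemma length_nonneg (ℓ : Chord) : 0 ≤ length ℓ := by
  induction ℓ using Sym2.ind with
  | _ p q => exact dist_nonneg (x := p) (y := q)

lemma length_le_half (ℓ : Chord) : length ℓ ≤ 1 / 2 := by
  obtain ⟨a, b, rfl⟩ := exists_eq_chord ℓ
  rw [length_chord_eq_norm]
  simpa using AddCircle.norm_le_half_period (p := (1 : ℝ)) (x := ((a - b : ℝ) : S)) one_ne_zero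

lemma length_eq_zero_iff {ℓ : Chord} : length ℓ = 0 ↔ ℓ.IsDiag := by
  induction ℓ using Sym2.ind with
  | _ p q => rw [length_mk, dist_eq_zero, Sym2.mk_isDiag_iff]

lemma length_pos_iff {ℓ : Chord} : 0 < length ℓ ↔ ¬ ℓ.IsDiag := by
  rw [← length_eq_zero_iff, (length_nonneg ℓ).lt_iff_ne, ne_comm]

lemma length_antipode (ℓ : Chord) : length (antipode ℓ) = length ℓ := by
  induction ℓ using Sym2.ind with
  | _ p q => rw [antipode_mk, length_mk, length_mk, dist_add_right]

/-- Every chord is of the form `chord y (y + s)`, where `s` is its length. -/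
lemma exists_chord_length (ℓ : Chord) : ∃ y : ℝ, ℓ = chord y (y + length ℓ) := by
  obtain ⟨u, v, hu, huv, hv, rfl⟩ := exists_coord 0 ℓ
  rcases le_total v (u + 1 / 2) with h | h
  · refine ⟨0 + u, ?_⟩
    rw [length_chord_of_le (by linarith) (by linarith)]
    congr 1
    ring
  · refine ⟨0 + v, ?_⟩
    rw [length_chord_of_ge (by linarith) (by linarith), chord_comm]
    exact chord_shift 0 (-1) (by simp) (by push_cast; ring)

/-- The effect of tripling on the length. -/
lemma length_sigma (ℓ : Chord) :
    (length ℓ ≤ 1 / 6 → length (sigma ℓ) = 3 * length ℓ) ∧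
      (1 / 6 ≤ length ℓ → length (sigma ℓ) = |1 - 3 * length ℓ|) := by
  obtain ⟨y, hy⟩ := exists_chord_length ℓ
  have h0 := length_nonneg ℓ
  have h1 := length_le_half ℓ
  generalize length ℓ = s at *
  subst hy
  rw [sigma_chord]
  constructor <;> intro h
  · rw [length_chord_of_le (by linarith) (by linarith)]
    ring
  · have : chord (3 * y) (3 * (y + s)) = chord (3 * y) (3 * y + 3 * s - 1) :=
      (chord_shift 0 (-1) (by simp) (by push_cast; ring)).symm
    have h2 : 3 * y - (3 * y + 3 * s - 1) = 1 - 3 * s := by ring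
    rw [this, length_chord, h2]
    rw [h2, abs_le]
    constructor <;> linarith

/-! ### Crossing chords -/

lemma crosses_of_lt {a b c d : ℝ} (h1 : a < b) (h2 : b < c) (h3 : c < d) (h4 : d < a + 1) :
    Crosses (chord a c) (chord b d) :=
  ⟨a, b - a, c - a, d - a, by linarith, by linarith, by linarith, by linarith,
    by congr 1; ring, by congr 1 <;> ring⟩

lemma Crosses.exists_lt {ℓ ℓ' : Chord} (h : Crosses ℓ ℓ') :
    ∃ a b c d : ℝ, a < b ∧ b < c ∧ c < d ∧ d < a + 1 ∧ ℓ = chord a c ∧ ℓ' = chord b d := by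
  obtain ⟨x, u, v, w, h0, h1, h2, h3, rfl, rfl⟩ := h
  exact ⟨x, x + u, x + v, x + w, by linarith, by linarith, by linarith, by linarith, rfl, rfl⟩

lemma Crosses.symm {ℓ ℓ' : Chord} (h : Crosses ℓ ℓ') : Crosses ℓ' ℓ := by
  obtain ⟨a, b, c, d, h1, h2, h3, h4, rfl, rfl⟩ := h.exists_lt
  rw [← chord_shift (a := a) (b := c) (a' := a + 1) (b' := c) 1 0 (by simp) (by simp),
    chord_comm (a + 1)]
  exact crosses_of_lt h2 h3 h4 (by linarith)

lemma Crosses.not_isDiag_left {ℓ ℓ' : Chord} (h : Crosses ℓ ℓ') : ¬ ℓ.IsDiag := by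
  obtain ⟨a, b, c, d, h1, h2, h3, h4, rfl, rfl⟩ := h.exists_lt
  exact not_isDiag_chord (by linarith) (by linarith)

lemma Crosses.not_isDiag_right {ℓ ℓ' : Chord} (h : Crosses ℓ ℓ') : ¬ ℓ'.IsDiag :=
  h.symm.not_isDiag_left

lemma Crosses.map_antipode {ℓ ℓ' : Chord} (h : Crosses ℓ ℓ') :
    Crosses (antipode ℓ) (antipode ℓ') := by
  obtain ⟨a, b, c, d, h1, h2, h3, h4, rfl, rfl⟩ := h.exists_lt
  rw [antipode_chord, antipode_chord]
  exact crosses_of_lt (by linarith) (by linarith) (by linarith) (by linarith)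

/-- Representatives in `[b, b + 1]` of four points in cyclic order. -/
lemma cyclic_order_of_lift {x₁ x₂ x₃ x₄ r₁ r₂ r₃ r₄ : ℝ} (h1 : x₁ < x₂) (h2 : x₂ < x₃)
    (h3 : x₃ < x₄) (h4 : x₄ < x₁ + 1) (hr₁ : r₁ ∈ Icc (0 : ℝ) 1) (hr₂ : r₂ ∈ Icc (0 : ℝ) 1)
    (hr₃ : r₃ ∈ Icc (0 : ℝ) 1) (hr₄ : r₄ ∈ Icc (0 : ℝ) 1) (n₁ n₂ n₃ n₄ : ℤ)
    (e₁ : r₁ = x₁ + n₁) (e₂ : r₂ = x₂ + n₂) (e₃ : r₃ = x₃ + n₃) (e₄ : r₄ = x₄ + n₄) :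
    (r₁ < r₂ ∧ r₂ < r₃ ∧ r₃ < r₄) ∨ (r₂ < r₃ ∧ r₃ < r₄ ∧ r₄ < r₁) ∨
      (r₃ < r₄ ∧ r₄ < r₁ ∧ r₁ < r₂) ∨ (r₄ < r₁ ∧ r₁ < r₂ ∧ r₂ < r₃) := by
  obtain ⟨l1, u1⟩ := hr₁
  obtain ⟨l2, u2⟩ := hr₂
  obtain ⟨l3, u3⟩ := hr₃
  obtain ⟨l4, u4⟩ := hr₄
  have a1 : n₂ < n₁ + 1 := by
    have : (n₂ : ℝ) < n₁ + 1 := by linarith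
    exact_mod_cast this
  have a2 : n₃ < n₂ + 1 := by
    have : (n₃ : ℝ) < n₂ + 1 := by linarith
    exact_mod_cast this
  have a3 : n₄ < n₃ + 1 := by
    have : (n₄ : ℝ) < n₃ + 1 := by linarith
    exact_mod_cast this
  have a4 : n₁ < n₄ + 2 := by
    have : (n₁ : ℝ) < n₄ + 2 := by linarith
    exact_mod_cast this
  have : (n₂ = n₁ ∧ n₃ = n₁ ∧ n₄ = n₁) ∨ (n₂ = n₁ - 1 ∧ n₃ = n₁ - 1 ∧ n₄ = n₁ - 1) ∨
      (n₂ = n₁ ∧ n₃ = n₁ - 1 ∧ n₄ = n₁ - 1) ∨ (n₂ = n₁ ∧ n₃ = n₁ ∧ n₄ = n₁ - 1) := by omega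
  rcases this with ⟨rfl, rfl, rfl⟩ | ⟨rfl, rfl, rfl⟩ | ⟨rfl, rfl, rfl⟩ | ⟨rfl, rfl, rfl⟩ <;>
    push_cast at *
  · exact .inl ⟨by linarith, by linarith, by linarith⟩
  · exact .inr <| .inl ⟨by linarith, by linarith, by linarith⟩
  · exact .inr <| .inr <| .inl ⟨by linarith, by linarith, by linarith⟩
  · exact .inr <| .inr <| .inr ⟨by linarith, by linarith, by linarith⟩

/-- The endpoints of crossing chords, given by coordinates in `[0, 1]`, alternate. -/
lemma Crosses.alternate {b p q p' q' : ℝ} (h : Crosses (chord (b + p) (b + q))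
    (chord (b + p') (b + q'))) (hp : 0 ≤ p) (hpq : p ≤ q) (hq : q ≤ 1) (hp' : 0 ≤ p')
    (hpq' : p' ≤ q') (hq' : q' ≤ 1) :
    (p < p' ∧ p' < q ∧ q < q') ∨ (p' < p ∧ p < q' ∧ q' < q) := by
  obtain ⟨x₁, x₂, x₃, x₄, h1, h2, h3, h4, e, e'⟩ := h.exists_lt
  have ip : p ∈ Icc (0 : ℝ) 1 := ⟨hp, by linarith⟩
  have iq : q ∈ Icc (0 : ℝ) 1 := ⟨by linarith, hq⟩
  have ip' : p' ∈ Icc (0 : ℝ) 1 := ⟨hp', by linarith⟩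
  have iq' : q' ∈ Icc (0 : ℝ) 1 := ⟨by linarith, hq'⟩
  rw [eq_comm, chord_eq_iff] at e e'
  have key {r₁ r₂ r₃ r₄ : ℝ} := cyclic_order_of_lift (r₁ := r₁) (r₂ := r₂) (r₃ := r₃) (r₄ := r₄)
    (x₁ := x₁ - b) (x₂ := x₂ - b) (x₃ := x₃ - b) (x₄ := x₄ - b) (by linarith) (by linarith)
    (by linarith) (by linarith)
  rcases e with ⟨m, n, hm, hn⟩ | ⟨m, n, hm, hn⟩ <;>
  rcases e' with ⟨m', n', hm', hn'⟩ | ⟨m', n', hm', hn'⟩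
  · rcases key ip ip' iq iq' m m' n n' (by linarith) (by linarith) (by linarith) (by linarith)
      with h | h | h | h <;> grind
  · rcases key ip iq' iq ip' m m' n n' (by linarith) (by linarith) (by linarith) (by linarith)
      with h | h | h | h <;> grind
  · rcases key iq ip' ip iq' m m' n n' (by linarith) (by linarith) (by linarith) (by linarith)
      with h | h | h | h <;> grind
  · rcases key iq iq' ip ip' m m' n n' (by linarith) (by linarith) (by linarith) (by linarith)
      with h | h | h | h <;> grind

/-! ### Closures of families of chords -/

/-- The ordered pairs of endpoints of the chords of a family. -/
def endpointPairs (C : Set Chord) : Set (S × S) := {p | s(p.1, p.2) ∈ C}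

lemma swap_mem_closure_endpointPairs {C : Set Chord} {p : S × S}
    (hp : p ∈ closure (endpointPairs C)) : p.swap ∈ closure (endpointPairs C) :=
  map_mem_closure continuous_swap hp fun q hq => by
    change s(q.2, q.1) ∈ C
    rw [Sym2.eq_swap]
    exact hq

lemma mk_mem_chordClosure {C : Set Chord} {p q : S} :
    s(p, q) ∈ chordClosure C ↔ (p, q) ∈ closure (endpointPairs C) := by
  constructor
  · rintro ⟨⟨p', q'⟩, h, e⟩
    rcases Sym2.eq_iff.1 e with ⟨rfl, rfl⟩ | ⟨rfl, rfl⟩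
    exacts [h, swap_mem_closure_endpointPairs h]
  · exact fun h => ⟨(p, q), h, rfl⟩

lemma subset_chordClosure (C : Set Chord) : C ⊆ chordClosure C := fun ℓ hℓ => by
  induction ℓ using Sym2.ind with
  | _ p q => exact mk_mem_chordClosure.2 (subset_closure hℓ)

/-- A closed condition on endpoints which holds on a family holds on its closure. -/
lemma chordClosure_induction {C : Set Chord} {P : S → S → Prop}
    (hP : IsClosed {p : S × S | P p.1 p.2}) (h : ∀ p q, s(p, q) ∈ C → P p q) {p q : S}
    (hpq : s(p, q) ∈ chordClosure C) : P p q :=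
  closure_minimal (s := endpointPairs C) (fun r hr => h r.1 r.2 hr) hP (mk_mem_chordClosure.1 hpq)

lemma hull_mk (p q : S) : hull s(p, q) =
    (fun r : ℝ => (1 - r) • (AddCircle.toCircle p : ℂ) + r • (AddCircle.toCircle q : ℂ)) ''
      Icc (0 : ℝ) 1 := by
  have : {r | r ∈ s(p, q)} = {p, q} := by
    ext r
    simp
  rw [hull, this, image_pair, convexHull_pair, segment_eq_image]

/-- The union is the image of a compact set of triples (endpoint, endpoint, parameter) under a
continuous map, since a hull is a segment. -/
lemma isClosed_biUnion_hull (C : Set Chord) :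
    IsClosed (⋃ ℓ ∈ {ℓ : Chord | ℓ.IsDiag} ∪ chordClosure C, hull ℓ) := by
  have e : (⋃ ℓ ∈ {ℓ : Chord | ℓ.IsDiag} ∪ chordClosure C, hull ℓ) =
      (fun z : (S × S) × ℝ => (1 - z.2) • (AddCircle.toCircle z.1.1 : ℂ) +
        z.2 • (AddCircle.toCircle z.1.2 : ℂ)) ''
        ((diagonal S ∪ closure (endpointPairs C)) ×ˢ Icc (0 : ℝ) 1) := by
    ext z
    simp only [mem_iUnion, exists_prop]
    constructor
    · rintro ⟨ℓ, hℓ, hz⟩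
      induction ℓ using Sym2.ind with
      | _ p q =>
        rw [hull_mk] at hz
        obtain ⟨r, hr, rfl⟩ := hz
        refine ⟨((p, q), r), ⟨?_, hr⟩, rfl⟩
        rcases hℓ with hℓ | hℓ
        · exact .inl (Sym2.mk_isDiag_iff.1 hℓ)
        · exact .inr (mk_mem_chordClosure.1 hℓ)
    · rintro ⟨⟨⟨p, q⟩, r⟩, ⟨hpq, hr⟩, rfl⟩
      refine ⟨s(p, q), ?_, by rw [hull_mk]; exact ⟨r, hr, rfl⟩⟩
      rcases hpq with hpq | hpq
      · exact .inl (Sym2.mk_isDiag_iff.2 hpq)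
      · exact .inr (mk_mem_chordClosure.2 hpq)
  rw [e]
  refine IsCompact.isClosed (IsCompact.image ?_ ?_)
  · exact (isClosed_diagonal.union isClosed_closure).isCompact.prod isCompact_Icc
  · have h1 : Continuous fun z : (S × S) × ℝ => (AddCircle.toCircle z.1.1 : ℂ) :=
      continuous_subtype_val.comp (AddCircle.continuous_toCircle.comp (by fun_prop))
    have h2 : Continuous fun z : (S × S) × ℝ => (AddCircle.toCircle z.1.2 : ℂ) :=
      continuous_subtype_val.comp (AddCircle.continuous_toCircle.comp (by fun_prop))
    fun_prop

lemma image_coe_Ioo_mem_nhds {a ε : ℝ} (hε : 0 < ε) :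
    ((↑) : ℝ → S) '' Ioo (a - ε) (a + ε) ∈ 𝓝 (a : S) :=
  QuotientAddGroup.isOpenMap_coe.image_mem_nhds (Ioo_mem_nhds (by linarith) (by linarith))

/-- A chord of the closure is approximated by chords of the family. -/
lemma exists_mem_near {C : Set Chord} {a b ε : ℝ} (h : chord a b ∈ chordClosure C) (hε : 0 < ε) :
    ∃ a' ∈ Ioo (a - ε) (a + ε), ∃ b' ∈ Ioo (b - ε) (b + ε), chord a' b' ∈ C := by
  obtain ⟨⟨p, q⟩, ⟨⟨a', ha, hp⟩, b', hb, hq⟩, hpq⟩ := mem_closure_iff_nhds.1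
    (mk_mem_chordClosure.1 h) _ (prod_mem_nhds (image_coe_Ioo_mem_nhds (a := a) hε)
      (image_coe_Ioo_mem_nhds (a := b) hε))
  simp only at hp hq
  subst hp hq
  exact ⟨a', ha, b', hb, hpq⟩

/-- Crossing is an open condition: moving the four endpoints by less than half the smallest gap
keeps them alternating. -/
lemma not_crosses_chordClosure {C : Set Chord} (h : ∀ ℓ ∈ C, ∀ ℓ' ∈ C, ¬ Crosses ℓ ℓ') :
    ∀ ℓ ∈ chordClosure C, ∀ ℓ' ∈ chordClosure C, ¬ Crosses ℓ ℓ' := by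
  intro ℓ hℓ ℓ' hℓ' hc
  obtain ⟨a, b, c, d, h1, h2, h3, h4, rfl, rfl⟩ := hc.exists_lt
  obtain ⟨ε, hε, e1, e2, e3, e4⟩ : ∃ ε : ℝ, 0 < ε ∧ 2 * ε ≤ b - a ∧ 2 * ε ≤ c - b ∧
      2 * ε ≤ d - c ∧ 2 * ε ≤ a + 1 - d := by
    refine ⟨min (min (b - a) (c - b)) (min (d - c) (a + 1 - d)) / 2, ?_, ?_, ?_, ?_, ?_⟩
    · have : 0 < min (min (b - a) (c - b)) (min (d - c) (a + 1 - d)) := by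
        simp only [lt_min_iff]
        exact ⟨⟨by linarith, by linarith⟩, by linarith, by linarith⟩
      linarith
    · linarith [min_le_left (min (b - a) (c - b)) (min (d - c) (a + 1 - d)),
        min_le_left (b - a) (c - b)]
    · linarith [min_le_left (min (b - a) (c - b)) (min (d - c) (a + 1 - d)),
        min_le_right (b - a) (c - b)]
    · linarith [min_le_right (min (b - a) (c - b)) (min (d - c) (a + 1 - d)),
        min_le_left (d - c) (a + 1 - d)]
    · linarith [min_le_right (min (b - a) (c - b)) (min (d - c) (a + 1 - d)),
        min_le_right (d - c) (a + 1 - d)]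
  obtain ⟨a', ha, c', hc', hac⟩ := exists_mem_near hℓ hε
  obtain ⟨b', hb, d', hd, hbd⟩ := exists_mem_near hℓ' hε
  simp only [mem_Ioo] at ha hb hc' hd
  exact h _ hac _ hbd (crosses_of_lt (by linarith) (by linarith) (by linarith) (by linarith))

/-- The point `1/3` of the circle. -/
noncomputable def third : S := ((1 / 3 : ℝ) : S)

lemma three_nsmul_third : (3 : ℕ) • third = 0 := by
  rw [third, ← AddCircle.coe_nsmul, AddCircle.coe_eq_zero_iff]
  exact ⟨1, by norm_num⟩

lemma third_ne_zero : third ≠ 0 := by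
  rw [third, Ne, AddCircle.coe_eq_zero_iff]
  rintro ⟨n, hn⟩
  rw [zsmul_one] at hn
  have h0 : (0 : ℝ) < n := by linarith
  have h1 : (n : ℝ) < 1 := by linarith
  norm_cast at h0 h1
  omega

/-- The two other chords which complete `s(p, q)` to a triple of disjoint siblings. -/
def HasSiblings (C : Set Chord) (p q : S) : Prop :=
  (s(p + third, q + third) ∈ C ∧ s(p + third + third, q + third + third) ∈ C) ∨
    (s(p + third, q + third + third) ∈ C ∧ s(p + third + third, q + third) ∈ C)

/-- A common endpoint would give `u = 0` or `v = 0`, or would identify an endpoint on one side with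
one on the other, whence `3 • p = 3 • q`. So for siblings disjointness reduces to not crossing. -/
lemma disjointChords_of_siblings {p q u v : S} (hpq : 3 • p ≠ 3 • q) (hu : 3 • u = 0)
    (hv : 3 • v = 0) (hu0 : u ≠ 0) (hv0 : v ≠ 0) (h : ¬ Crosses s(p, q) s(p + u, q + v)) :
    DisjointChords s(p, q) s(p + u, q + v) := by
  refine ⟨fun r hr hr' => ?_, h⟩
  rcases Sym2.mem_iff.1 hr with rfl | rfl <;> rcases Sym2.mem_iff.1 hr' with e | e
  · exact hu0 (by simpa using e)
  · apply hpq
    rw [e, smul_add, hv, add_zero]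
  · apply hpq
    rw [e, smul_add, hu, add_zero]
  · exact hv0 (by simpa using e)

/-- Three siblings with no shared endpoint match the three lifts of `3p` with those of `3q`. With
`s(p, q)` fixed only two matchings remain, which are the alternatives of `HasSiblings`; disjointness
then follows from the absence of crossings. -/
lemma exists_disjoint_triple {L : Set Chord} (hL : ∀ ℓ ∈ L, ∀ ℓ' ∈ L, ¬ Crosses ℓ ℓ') {p q : S}
    (hpq : s(p, q) ∈ L) (h3 : 3 • p ≠ 3 • q) (h : HasSiblings L p q) :
    ∃ f : Fin 3 → Chord, f 0 = s(p, q) ∧ (∀ i, f i ∈ L ∧ sigma (f i) = sigma s(p, q)) ∧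
      ∀ i j, i ≠ j → DisjointChords (f i) (f j) := by
  have ht := three_nsmul_third
  have ht0 := third_ne_zero
  have ht2 : 3 • (third + third) = 0 := by rw [smul_add, ht, add_zero]
  have ht20 : third + third ≠ 0 := by
    intro e
    apply ht0
    have : (3 : ℕ) • third = third + third + third := by abel
    rwa [ht, e, zero_add, eq_comm] at this
  have symm {ℓ ℓ' : Chord} (h : DisjointChords ℓ ℓ') : DisjointChords ℓ' ℓ :=
    ⟨fun r hr hr' => h.1 r hr' hr, fun hc => h.2 hc.symm⟩
  obtain ⟨ℓ₁, ℓ₂, m1, m2, s1, s2, d1, d2, d3⟩ : ∃ ℓ₁ ℓ₂ : Chord, ℓ₁ ∈ L ∧ ℓ₂ ∈ L ∧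
      sigma ℓ₁ = sigma s(p, q) ∧ sigma ℓ₂ = sigma s(p, q) ∧ DisjointChords s(p, q) ℓ₁ ∧
      DisjointChords s(p, q) ℓ₂ ∧ DisjointChords ℓ₁ ℓ₂ := by
    have tt : third + third + third = 0 := by rw [← ht]; abel
    have shift (r : S) : 3 • (r + third) = 3 • r := by rw [smul_add, ht, add_zero]
    rcases h with ⟨h1, h2⟩ | ⟨h1, h2⟩
    · refine ⟨_, _, h1, h2, by simp only [sigma_mk, shift], by simp only [sigma_mk, shift],
        disjointChords_of_siblings h3 ht ht ht0 ht0 (hL _ hpq _ h1), ?_,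
        disjointChords_of_siblings (by rwa [shift, shift]) ht ht ht0 ht0 (hL _ h1 _ h2)⟩
      rw [add_assoc, add_assoc] at h2 ⊢
      exact disjointChords_of_siblings h3 ht2 ht2 ht20 ht20 (hL _ hpq _ h2)
    · refine ⟨_, _, h1, h2, by simp only [sigma_mk, shift], by simp only [sigma_mk, shift],
        ?_, ?_, ?_⟩
      · rw [add_assoc] at h1 ⊢
        exact disjointChords_of_siblings h3 ht ht2 ht0 ht20 (hL _ hpq _ h1)
      · rw [add_assoc] at h2 ⊢
        exact disjointChords_of_siblings h3 ht2 ht ht20 ht0 (hL _ hpq _ h2)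
      · have e : q + third = q + third + third + (third + third) := by
          have : q + third + third + (third + third) = q + third + (third + third + third) := by
            abel
          rw [this, tt, add_zero]
        have := disjointChords_of_siblings (p := p + third) (q := q + third + third)
          (by simpa only [shift] using h3) ht ht2 ht0 ht20
        rw [← e] at this
        exact this (hL _ h1 _ h2)
  refine ⟨![s(p, q), ℓ₁, ℓ₂], rfl, ?_, ?_⟩
  · intro i
    fin_cases i
    exacts [⟨hpq, rfl⟩, ⟨m1, s1⟩, ⟨m2, s2⟩]
  · intro i j hij
    fin_cases i <;> fin_cases j
    exacts [absurd rfl hij, d1, d2, symm d1, absurd rfl hij, d3, symm d2, symm d3, absurd rfl hij]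

/-- The closure of a family of non-crossing chords which is invariant under the tripling map and the
half-turn, and closed under taking siblings, is a symmetric lamination. -/
theorem isSymmetricLamination_closure {C : Set Chord}
    (hcross : ∀ ℓ ∈ C, ∀ ℓ' ∈ C, ¬ Crosses ℓ ℓ')
    (hforward : ∀ ℓ ∈ C, sigma ℓ ∈ C ∨ (sigma ℓ).IsDiag)
    (hbackward : ∀ ℓ ∈ C, ∃ ℓ' ∈ C, sigma ℓ' = ℓ)
    (hsibling : ∀ p q : S, s(p, q) ∈ C → 3 • p = 3 • q ∨ HasSiblings C p q)
    (hantipode : ∀ ℓ ∈ C, antipode ℓ ∈ C) :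
    IsSymmetricLamination ({ℓ | ℓ.IsDiag} ∪ chordClosure C) := by
  have nc : ∀ ℓ ∈ {ℓ : Chord | ℓ.IsDiag} ∪ chordClosure C,
      ∀ ℓ' ∈ {ℓ : Chord | ℓ.IsDiag} ∪ chordClosure C, ¬ Crosses ℓ ℓ' := by
    intro ℓ hℓ ℓ' hℓ' hc
    exact not_crosses_chordClosure hcross ℓ (hℓ.resolve_left hc.not_isDiag_left) ℓ'
      (hℓ'.resolve_left hc.not_isDiag_right) hc
  have hK : IsClosed (closure (endpointPairs C)) := isClosed_closure
  refine ⟨⟨⟨fun p => .inl (Sym2.mk_isDiag_iff.2 rfl), nc, isClosed_biUnion_hull C⟩, ?_, ?_, ?_⟩, ?_⟩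
  · intro ℓ hℓ
    rcases hℓ with hℓ | hℓ
    · exact .inr (sigma_isDiag hℓ)
    induction ℓ using Sym2.ind with
    | _ p q =>
      have := chordClosure_induction (P := fun p q => (3 • p, 3 • q) ∈
        closure (endpointPairs C) ∪ diagonal S) ?_ ?_ hℓ
      · rcases this with h | h
        · exact .inl (.inr (mk_mem_chordClosure.2 h))
        · exact .inr (Sym2.mk_isDiag_iff.2 h)
      · exact (hK.union isClosed_diagonal).preimage
          (f := fun r : S × S => (3 • r.1, 3 • r.2)) (by fun_prop)
      · intro p q hpq
        rcases hforward _ hpq with h | h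
        · exact .inl (subset_closure h)
        · exact .inr (Sym2.mk_isDiag_iff.1 h)
  · intro ℓ hℓ
    rcases hℓ with hℓ | hℓ
    · induction ℓ using Sym2.ind with
      | _ p q =>
        obtain rfl : p = q := Sym2.mk_isDiag_iff.1 hℓ
        obtain ⟨u, -, -, rfl⟩ := exists_coe_eq p 0
        refine ⟨chord ((0 + u) / 3) ((0 + u) / 3), .inl (chord_isDiag _), ?_⟩
        rw [sigma_chord]
        simp only [chord, mul_div_cancel₀ _ (three_ne_zero (α := ℝ))]
    induction ℓ using Sym2.ind with
    | _ p q =>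
      have := chordClosure_induction (P := fun p q => (p, q) ∈
        (fun r : S × S => (3 • r.1, 3 • r.2)) '' closure (endpointPairs C)) ?_ ?_ hℓ
      · obtain ⟨⟨p', q'⟩, h, e⟩ := this
        refine ⟨s(p', q'), .inr (mk_mem_chordClosure.2 h), ?_⟩
        rw [sigma_mk]
        exact congrArg (fun r : S × S => s(r.1, r.2)) e
      -- Preimages survive in the limit because the torus is compact: the image of the closed set of
      -- endpoint pairs under tripling is again closed.
      · exact (hK.isCompact.image (by fun_prop)).isClosed
      · intro p q hpq
        obtain ⟨ℓ', h, e⟩ := hbackward _ hpq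
        induction ℓ' using Sym2.ind with
        | _ p' q' =>
          rcases Sym2.eq_iff.1 e with ⟨h1, h2⟩ | ⟨h1, h2⟩
          · exact ⟨(p', q'), subset_closure h, Prod.ext h1 h2⟩
          · exact ⟨(q', p'), swap_mem_closure_endpointPairs (p := (p', q')) (subset_closure h),
              Prod.ext h2 h1⟩
  · intro ℓ hℓ hd
    have hℓ' := hℓ.resolve_left fun h => hd (sigma_isDiag h)
    induction ℓ using Sym2.ind with
    | _ p q =>
      have h3 : 3 • p ≠ 3 • q := fun h => hd (Sym2.mk_isDiag_iff.2 h)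
      -- Critical members of the family may lack siblings, so the alternative `3 • p = 3 • q` is
      -- carried along; it is closed as well, and `h3` excludes it for the limit chord.
      have := chordClosure_induction (P := fun p q => 3 • p = 3 • q ∨
        (((p + third, q + third) ∈ closure (endpointPairs C) ∧
          (p + third + third, q + third + third) ∈ closure (endpointPairs C)) ∨
        ((p + third, q + third + third) ∈ closure (endpointPairs C) ∧
          (p + third + third, q + third) ∈ closure (endpointPairs C)))) ?_ ?_ hℓ'
      · refine exists_disjoint_triple nc hℓ h3 ((this.resolve_left h3).imp ?_ ?_) <;>
        exact fun h => ⟨.inr (mk_mem_chordClosure.2 h.1), .inr (mk_mem_chordClosure.2 h.2)⟩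
      · refine (isClosed_eq (by fun_prop) (by fun_prop)).union (IsClosed.union ?_ ?_)
        · exact (hK.preimage (f := fun r : S × S => (r.1 + third, r.2 + third))
            (by fun_prop)).inter (hK.preimage
              (f := fun r : S × S => (r.1 + third + third, r.2 + third + third)) (by fun_prop))
        · exact (hK.preimage (f := fun r : S × S => (r.1 + third, r.2 + third + third))
            (by fun_prop)).inter (hK.preimage
              (f := fun r : S × S => (r.1 + third + third, r.2 + third)) (by fun_prop))
      · intro p q hpq
        refine (hsibling p q hpq).imp_right fun h => h.imp ?_ ?_ <;>
        exact fun h => ⟨subset_closure h.1, subset_closure h.2⟩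
  · intro ℓ hℓ
    rcases hℓ with hℓ | hℓ
    · exact .inl (antipode_isDiag hℓ)
    induction ℓ using Sym2.ind with
    | _ p q =>
      refine .inr (mk_mem_chordClosure.2 (chordClosure_induction (P := fun p q =>
        (p + ((1 / 2 : ℝ) : S), q + ((1 / 2 : ℝ) : S)) ∈ closure (endpointPairs C)) ?_ ?_ hℓ))
      · exact hK.preimage
          (f := fun r : S × S => (r.1 + ((1 / 2 : ℝ) : S), r.2 + ((1 / 2 : ℝ) : S))) (by fun_prop)
      · exact fun p q hpq => subset_closure (hantipode _ hpq)

/-- A closed condition on lengths is inherited by the closure. -/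
lemma length_mem_of_mem_chordClosure {C : Set Chord} {K : Set ℝ} (hK : IsClosed K)
    (h : ∀ ℓ ∈ C, length ℓ ∈ K) {ℓ : Chord} (hℓ : ℓ ∈ chordClosure C) : length ℓ ∈ K := by
  induction ℓ using Sym2.ind with
  | _ p q =>
    exact chordClosure_induction (P := fun p q => dist p q ∈ K)
      (hK.preimage (f := fun r : S × S => dist r.1 r.2) (by fun_prop)) (fun p q => h s(p, q)) hℓ

/-! ### The regions cut out by the two quadrilaterals -/

/-- The edges of `Q_c` and `-Q_c`. -/
def quadPairEdges (x t : ℝ) : Set Chord := quadEdges x t ∪ antipode '' quadEdges x t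

lemma antipode_mem_quadPairEdges {x t : ℝ} {e : Chord} (h : e ∈ quadPairEdges x t) :
    antipode e ∈ quadPairEdges x t := by
  rcases h with h | ⟨e, h, rfl⟩
  · exact .inr ⟨e, h, rfl⟩
  · rw [antipode_antipode]
    exact .inl h

/-- Traces on the circle of the complementary regions of `±Q_c`, in coordinates relative to
`x + 1/3`. -/
def IsRegion (t : ℝ) (R : Set ℝ) : Prop :=
  R = Icc t (1 / 3) ∨ R = Icc (1 / 2 + t) (5 / 6) ∨ R = Icc 0 t ∨ R = Icc (1 / 3) (1 / 3 + t) ∨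
    R = Icc (1 / 2) (1 / 2 + t) ∨ R = Icc (5 / 6) (5 / 6 + t) ∨
      R = Icc (1 / 3 + t) (1 / 2) ∪ Icc (5 / 6 + t) 1

/-- The chord `ℓ` lies in one of the complementary regions of `±Q_c`. -/
def InRegion (x t : ℝ) (ℓ : Chord) : Prop :=
  ∃ R, IsRegion t R ∧ ∃ p ∈ R, ∃ q ∈ R, ℓ = chord (x + 1 / 3 + p) (x + 1 / 3 + q)

lemma InRegion.exists_le {x t : ℝ} {ℓ : Chord} (h : InRegion x t ℓ) :
    ∃ R, IsRegion t R ∧ ∃ p ∈ R, ∃ q ∈ R, p ≤ q ∧ ℓ = chord (x + 1 / 3 + p) (x + 1 / 3 + q) := by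
  obtain ⟨R, hR, p, hp, q, hq, rfl⟩ := h
  rcases le_total p q with h | h
  · exact ⟨R, hR, p, hp, q, hq, h, rfl⟩
  · exact ⟨R, hR, q, hq, p, hp, h, chord_comm _ _⟩

lemma IsRegion.subset_Icc {t : ℝ} (h0 : 0 ≤ t) (h1 : t ≤ 1 / 6) {R : Set ℝ} (hR : IsRegion t R) :
    R ⊆ Icc 0 1 := by
  intro p hp
  rcases hR with rfl | rfl | rfl | rfl | rfl | rfl | rfl <;> simp only [mem_union, mem_Icc] at hp ⊢
  all_goals first
    | exact ⟨by linarith, by linarith⟩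
    | rcases hp with hp | hp <;> exact ⟨by linarith, by linarith⟩

lemma region_A (t : ℝ) : IsRegion t (Icc t (1 / 3)) := .inl rfl
lemma region_C (t : ℝ) : IsRegion t (Icc (1 / 2 + t) (5 / 6)) := .inr <| .inl rfl
lemma region_P (t : ℝ) : IsRegion t (Icc 0 t) := .inr <| .inr <| .inl rfl
lemma region_P' (t : ℝ) : IsRegion t (Icc (1 / 3) (1 / 3 + t)) := .inr <| .inr <| .inr <| .inl rfl
lemma region_N (t : ℝ) : IsRegion t (Icc (1 / 2) (1 / 2 + t)) :=
  .inr <| .inr <| .inr <| .inr <| .inl rfl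
lemma region_N' (t : ℝ) : IsRegion t (Icc (5 / 6) (5 / 6 + t)) :=
  .inr <| .inr <| .inr <| .inr <| .inr <| .inl rfl
lemma region_mid (t : ℝ) : IsRegion t (Icc (1 / 3 + t) (1 / 2) ∪ Icc (5 / 6 + t) 1) :=
  .inr <| .inr <| .inr <| .inr <| .inr <| .inr rfl

lemma InRegion.intro {x t : ℝ} {R : Set ℝ} (hR : IsRegion t R) {p q a b : ℝ} (m n : ℤ)
    (hp : p ∈ R) (hq : q ∈ R) (ha : a = x + 1 / 3 + p + m) (hb : b = x + 1 / 3 + q + n) :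
    InRegion x t (chord a b) :=
  ⟨R, hR, p, hp, q, hq, chord_shift m n ha hb⟩

lemma not_alternate_of_not_crosses {b u v e f : ℝ} (hu : 0 ≤ u) (hv : v < 1)
    (he : 0 ≤ e) (hf : f < 1) (h : ¬ Crosses (chord (b + u) (b + v)) (chord (b + e) (b + f))) :
    ¬ (u < e ∧ e < v ∧ v < f) ∧ ¬ (e < u ∧ u < f ∧ f < v) :=
  ⟨fun hc => h (crosses_of_lt (by linarith) (by linarith) (by linarith) (by linarith)),
    fun hc => h (crosses_of_lt (by linarith) (by linarith) (by linarith) (by linarith)).symm⟩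

/-- Coordinates relative to `x + 1/3` of the eight edges. -/
lemma mem_quadPairEdges {x t : ℝ} {e : Chord} : e ∈ quadPairEdges x t ↔ ∃ i j : ℝ,
    e = chord (x + 1 / 3 + i) (x + 1 / 3 + j) ∧
      ((i = 0 ∧ j = 1 / 3 + t) ∨ (i = t ∧ j = 1 / 3) ∨ (i = 0 ∧ j = t) ∨
        (i = 1 / 3 ∧ j = 1 / 3 + t) ∨ (i = 1 / 2 ∧ j = 5 / 6 + t) ∨ (i = 1 / 2 + t ∧ j = 5 / 6) ∨
          (i = 1 / 2 ∧ j = 1 / 2 + t) ∨ (i = 5 / 6 ∧ j = 5 / 6 + t)) := by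
  have key (a b i j : ℝ) (ha : a = x + 1 / 3 + i) (hb : b = x + 1 / 3 + j) :
      chord a b = chord (x + 1 / 3 + i) (x + 1 / 3 + j) := by rw [ha, hb]
  simp only [quadPairEdges, quadEdges, longSib, medSib, mem_union, mem_image, mem_insert_iff,
    mem_singleton_iff]
  constructor
  · rintro ((rfl | rfl | rfl | rfl) | ⟨e, (rfl | rfl | rfl | rfl), rfl⟩) <;>
      try rw [antipode_chord]
    · exact ⟨0, 1 / 3 + t, key _ _ _ _ (by ring) (by ring), by simp⟩
    · exact ⟨t, 1 / 3, key _ _ _ _ (by ring) (by ring), by simp⟩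
    · exact ⟨0, t, key _ _ _ _ (by ring) (by ring), by simp⟩
    · exact ⟨1 / 3, 1 / 3 + t, key _ _ _ _ (by ring) (by ring), by simp⟩
    · exact ⟨1 / 2, 5 / 6 + t, key _ _ _ _ (by ring) (by ring), by simp⟩
    · exact ⟨1 / 2 + t, 5 / 6, key _ _ _ _ (by ring) (by ring), by simp⟩
    · exact ⟨1 / 2, 1 / 2 + t, key _ _ _ _ (by ring) (by ring), by simp⟩
    · exact ⟨5 / 6, 5 / 6 + t, key _ _ _ _ (by ring) (by ring), by simp⟩
  · rintro ⟨i, j, rfl, h⟩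
    rcases h with ⟨rfl, rfl⟩ | ⟨rfl, rfl⟩ | ⟨rfl, rfl⟩ | ⟨rfl, rfl⟩ | ⟨rfl, rfl⟩ | ⟨rfl, rfl⟩ |
      ⟨rfl, rfl⟩ | ⟨rfl, rfl⟩
    · exact .inl <| .inl (key _ _ _ _ (by ring) (by ring)).symm
    · exact .inl <| .inr <| .inl (key _ _ _ _ (by ring) (by ring)).symm
    · exact .inl <| .inr <| .inr <| .inl (key _ _ _ _ (by ring) (by ring)).symm
    · exact .inl <| .inr <| .inr <| .inr (key _ _ _ _ (by ring) (by ring)).symm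
    · refine .inr ⟨_, .inl rfl, ?_⟩
      rw [antipode_chord]
      exact key _ _ _ _ (by ring) (by ring)
    · refine .inr ⟨_, .inr <| .inl rfl, ?_⟩
      rw [antipode_chord]
      exact key _ _ _ _ (by ring) (by ring)
    · refine .inr ⟨_, .inr <| .inr <| .inl rfl, ?_⟩
      rw [antipode_chord]
      exact key _ _ _ _ (by ring) (by ring)
    · refine .inr ⟨_, .inr <| .inr <| .inr rfl, ?_⟩
      rw [antipode_chord]
      exact key _ _ _ _ (by ring) (by ring)

/-- Not being linked with any of the eight edges puts `u` and `v` in the closure of one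
complementary arc system, or makes them opposite vertices of `Q_c` or `-Q_c`; such vertices are
`1/3` apart, which is the last alternative. -/
lemma region_cases {t u v : ℝ} (h0 : 0 ≤ t) (hu : 0 ≤ u) (h : ∀ i j : ℝ, ((i = 0 ∧ j = 1 / 3 + t) ∨ (i = t ∧ j = 1 / 3) ∨
      (i = 0 ∧ j = t) ∨ (i = 1 / 3 ∧ j = 1 / 3 + t) ∨ (i = 1 / 2 ∧ j = 5 / 6 + t) ∨
        (i = 1 / 2 + t ∧ j = 5 / 6) ∨ (i = 1 / 2 ∧ j = 1 / 2 + t) ∨ (i = 5 / 6 ∧ j = 5 / 6 + t)) →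
      ¬ (u < i ∧ i < v ∧ v < j) ∧ ¬ (i < u ∧ u < j ∧ j < v)) :
    (t ≤ u ∧ v ≤ 1 / 3) ∨ (1 / 2 + t ≤ u ∧ v ≤ 5 / 6) ∨ v ≤ t ∨ (1 / 3 ≤ u ∧ v ≤ 1 / 3 + t) ∨
      (1 / 2 ≤ u ∧ v ≤ 1 / 2 + t) ∨ (5 / 6 ≤ u ∧ v ≤ 5 / 6 + t) ∨
      ((u = 0 ∨ (1 / 3 + t ≤ u ∧ u ≤ 1 / 2) ∨ 5 / 6 + t ≤ u) ∧
        ((1 / 3 + t ≤ v ∧ v ≤ 1 / 2) ∨ 5 / 6 + t ≤ v)) ∨ (0 < t ∧ v = u + 1 / 3) := by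
  have a1 := h 0 (1 / 3 + t) (by simp)
  have a2 := h t (1 / 3) (by simp)
  have a3 := h 0 t (by simp)
  have a4 := h (1 / 3) (1 / 3 + t) (by simp)
  have a5 := h (1 / 2) (5 / 6 + t) (by simp)
  have a6 := h (1 / 2 + t) (5 / 6) (by simp)
  have a7 := h (1 / 2) (1 / 2 + t) (by simp)
  have a8 := h (5 / 6) (5 / 6 + t) (by simp)
  clear h
  grind

/-- A chord that does not cross the edges of `±Q_c` lies in a complementary region, unless it is a
critical diagonal of one of the quadrilaterals. -/
lemma inRegion_of_not_crosses {x t : ℝ} (h0 : 0 ≤ t) (h1 : t < 1 / 6) {ℓ : Chord}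
    (hd : ¬ ℓ.IsDiag) (h : ∀ e ∈ quadPairEdges x t, ¬ Crosses ℓ e) :
    InRegion x t ℓ ∨ (0 < t ∧ (sigma ℓ).IsDiag) := by
  obtain ⟨u, v, hu, huv, hv, rfl⟩ := exists_coord_lt (x + 1 / 3) hd
  have key := region_cases h0 hu fun i j hij =>
    not_alternate_of_not_crosses hu hv (by grind) (by grind)
      (h _ (mem_quadPairEdges.2 ⟨i, j, rfl, hij⟩))
  have mk {R : Set ℝ} (hR : IsRegion t R) (h1 : u ∈ R) (h2 : v ∈ R) :=
    InRegion.intro (x := x) (a := x + 1 / 3 + u) (b := x + 1 / 3 + v) hR 0 0 h1 h2 (by simp) (by simp)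
  rcases key with h | h | h | h | h | h | ⟨hu', hv'⟩ | h
  · exact .inl <| mk (region_A t) ⟨by linarith, by linarith⟩ ⟨by linarith, by linarith⟩
  · exact .inl <| mk (region_C t) ⟨by linarith, by linarith⟩ ⟨by linarith, by linarith⟩
  · exact .inl <| mk (region_P t) ⟨by linarith, by linarith⟩ ⟨by linarith, by linarith⟩
  · exact .inl <| mk (region_P' t) ⟨by linarith, by linarith⟩ ⟨by linarith, by linarith⟩
  · exact .inl <| mk (region_N t) ⟨by linarith, by linarith⟩ ⟨by linarith, by linarith⟩
  · exact .inl <| mk (region_N' t) ⟨by linarith, by linarith⟩ ⟨by linarith, by linarith⟩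
  · have hv'' : v ∈ Icc (1 / 3 + t) (1 / 2) ∪ Icc (5 / 6 + t) 1 :=
      hv'.imp (fun h => ⟨h.1, h.2⟩) fun h => ⟨h, hv.le⟩
    rcases hu' with rfl | hu' | hu'
    -- The point with coordinate `0` belongs to the middle region through its representative `1`.
    · exact .inl <| InRegion.intro (p := 1) (region_mid t) (-1) 0
        (.inr ⟨by linarith, by linarith⟩) hv'' (by push_cast; ring) (by simp)
    · exact .inl <| mk (region_mid t) (.inl hu') hv''
    · exact .inl <| mk (region_mid t) (.inr ⟨hu', by linarith⟩) hv''
  · refine .inr ⟨h.1, ?_⟩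
    rw [sigma_chord, chord_isDiag_iff, h.2]
    exact ⟨1, by push_cast; ring⟩

/-- A chord contained in a complementary region of `±Q_c` does not cross its edges. -/
lemma InRegion.not_crosses {x t : ℝ} (h0 : 0 ≤ t) (h1 : t < 1 / 6) {ℓ : Chord}
    (h : InRegion x t ℓ) : ∀ e ∈ quadPairEdges x t, ¬ Crosses ℓ e := by
  intro e he hc
  obtain ⟨R, hR, p, hp, q, hq, hpq, rfl⟩ := h.exists_le
  obtain ⟨i, j, rfl, hij⟩ := mem_quadPairEdges.1 he
  have hp' := hR.subset_Icc h0 h1.le hp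
  have hq' := hR.subset_Icc h0 h1.le hq
  have := hc.alternate hp'.1 hpq hq'.2 (by grind) (by grind) (by grind)
  rcases hR with rfl | rfl | rfl | rfl | rfl | rfl | rfl <;>
    simp only [mem_union, mem_Icc] at hp hq <;> grind (splits := 20)

lemma InRegion.map_antipode {x t : ℝ} {ℓ : Chord} (h : InRegion x t ℓ) :
    InRegion x t (antipode ℓ) := by
  obtain ⟨R, hR, p, hp, q, hq, rfl⟩ := h
  rw [antipode_chord]
  have up {R' : Set ℝ} (hR' : IsRegion t R') (h1 : p + 1 / 2 ∈ R') (h2 : q + 1 / 2 ∈ R') :=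
    InRegion.intro (x := x) (a := x + 1 / 3 + p + 1 / 2) (b := x + 1 / 3 + q + 1 / 2) hR' 0 0 h1 h2
      (by push_cast; ring) (by push_cast; ring)
  have down {R' : Set ℝ} (hR' : IsRegion t R') (h1 : p - 1 / 2 ∈ R') (h2 : q - 1 / 2 ∈ R') :=
    InRegion.intro (x := x) (a := x + 1 / 3 + p + 1 / 2) (b := x + 1 / 3 + q + 1 / 2) hR' 1 1 h1 h2
      (by push_cast; ring) (by push_cast; ring)
  rcases hR with rfl | rfl | rfl | rfl | rfl | rfl | rfl
  · exact up (region_C t) ⟨by linarith [hp.1], by linarith [hp.2]⟩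
      ⟨by linarith [hq.1], by linarith [hq.2]⟩
  · exact down (region_A t) ⟨by linarith [hp.1], by linarith [hp.2]⟩
      ⟨by linarith [hq.1], by linarith [hq.2]⟩
  · exact up (region_N t) ⟨by linarith [hp.1], by linarith [hp.2]⟩
      ⟨by linarith [hq.1], by linarith [hq.2]⟩
  · exact up (region_N' t) ⟨by linarith [hp.1], by linarith [hp.2]⟩
      ⟨by linarith [hq.1], by linarith [hq.2]⟩
  · exact down (region_P t) ⟨by linarith [hp.1], by linarith [hp.2]⟩
      ⟨by linarith [hq.1], by linarith [hq.2]⟩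
  · exact down (region_P' t) ⟨by linarith [hp.1], by linarith [hp.2]⟩
      ⟨by linarith [hq.1], by linarith [hq.2]⟩
  · have half (r : ℝ) (hr : r ∈ Icc (1 / 3 + t) (1 / 2) ∪ Icc (5 / 6 + t) 1) :
        ∃ n : ℤ, r + 1 / 2 + n ∈ Icc (1 / 3 + t) (1 / 2) ∪ Icc (5 / 6 + t) 1 := by
      rcases hr with hr | hr
      · exact ⟨0, .inr ⟨by push_cast; linarith [hr.1], by push_cast; linarith [hr.2]⟩⟩
      · exact ⟨-1, .inl ⟨by push_cast; linarith [hr.1], by push_cast; linarith [hr.2]⟩⟩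
    obtain ⟨m, hm⟩ := half p hp
    obtain ⟨n, hn⟩ := half q hq
    exact InRegion.intro (region_mid t) (-m) (-n) hm hn (by push_cast; ring) (by push_cast; ring)

/-- Lengths of the chords in the regions are bounded away from `1/3`. -/
lemma InRegion.length_ge {x t : ℝ} (h0 : 0 ≤ t) (h1 : t < 1 / 6) {ℓ : Chord}
    (h : InRegion x t ℓ) : t ≤ |length ℓ - 1 / 3| := by
  obtain ⟨R, hR, p, hp, q, hq, hpq, rfl⟩ := h.exists_le
  have hp' := hR.subset_Icc h0 h1.le hp
  have hq' := hR.subset_Icc h0 h1.le hq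
  have : length (chord (x + 1 / 3 + p) (x + 1 / 3 + q)) = q - p ∧ q ≤ p + 1 / 2 ∨
      length (chord (x + 1 / 3 + p) (x + 1 / 3 + q)) = 1 - (q - p) ∧ p + 1 / 2 ≤ q := by
    rcases le_total q (p + 1 / 2) with h | h
    · exact .inl ⟨by rw [length_chord_of_le (by linarith) (by linarith)]; ring, h⟩
    · exact .inr ⟨by rw [length_chord_of_ge (by linarith) (by linarith [hp'.1, hq'.2])]; ring, h⟩
  rw [le_abs]
  rcases hR with rfl | rfl | rfl | rfl | rfl | rfl | rfl <;>
    simp only [mem_union, mem_Icc] at hp hq <;> grind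

/-- The only chords in the regions that realize the extremal length are `±M_c` and `±M'_c`. -/
lemma InRegion.eq_of_length_le {x t : ℝ} (h0 : 0 ≤ t) (h1 : t < 1 / 6) {ℓ : Chord}
    (h : InRegion x t ℓ) (hl : |length ℓ - 1 / 3| ≤ t) :
    (ℓ = longSib x t ∨ ℓ = medSib x t) ∨
      (ℓ = antipode (longSib x t) ∨ ℓ = antipode (medSib x t)) := by
  obtain ⟨R, hR, p, hp, q, hq, hpq, rfl⟩ := h.exists_le
  have hp' := hR.subset_Icc h0 h1.le hp
  have hq' := hR.subset_Icc h0 h1.le hq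
  have : length (chord (x + 1 / 3 + p) (x + 1 / 3 + q)) = q - p ∧ q ≤ p + 1 / 2 ∨
      length (chord (x + 1 / 3 + p) (x + 1 / 3 + q)) = 1 - (q - p) ∧ p + 1 / 2 ≤ q := by
    rcases le_total q (p + 1 / 2) with h | h
    · exact .inl ⟨by rw [length_chord_of_le (by linarith) (by linarith)]; ring, h⟩
    · exact .inr ⟨by rw [length_chord_of_ge (by linarith) (by linarith [hp'.1, hq'.2])]; ring, h⟩
  have hc : (p = 1 / 3 + t ∧ q = 1) ∨ (p = t ∧ q = 1 / 3) ∨ (p = 1 / 2 ∧ q = 5 / 6 + t) ∨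
      (p = 1 / 2 + t ∧ q = 5 / 6) := by
    rw [abs_le] at hl
    rcases hR with rfl | rfl | rfl | rfl | rfl | rfl | rfl <;>
      simp only [mem_union, mem_Icc] at hp hq <;> grind
  simp only [longSib, medSib, antipode_chord]
  rcases hc with ⟨rfl, rfl⟩ | ⟨rfl, rfl⟩ | ⟨rfl, rfl⟩ | ⟨rfl, rfl⟩
  · refine .inl <| .inl ?_
    rw [chord_comm]
    exact chord_shift 1 0 (by push_cast; ring) (by push_cast; ring)
  · exact .inl <| .inr <| chord_shift 0 0 (by push_cast; ring) (by push_cast; ring)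
  · exact .inr <| .inl <| chord_shift 0 0 (by push_cast; ring) (by push_cast; ring)
  · exact .inr <| .inr <| chord_shift 0 0 (by push_cast; ring) (by push_cast; ring)

/-! ### Pullbacks and siblings in the regions -/

/-- `ℓ` has an endpoint at `3x` or at `3x + 1/2`, so that in the degenerate case its pullbacks are
ambiguous. -/
def IsAmbiguous (x : ℝ) (ℓ : Chord) : Prop :=
  ((3 * x : ℝ) : S) ∈ ℓ ∨ ((3 * x + 1 / 2 : ℝ) : S) ∈ ℓ

/-- Relative to `x + 1/3`, the preimages of `3x` and `3x + 1/2` are the multiples `k/6`: even `k`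
gives the former, odd `k` the latter. -/
lemma isAmbiguous_sigma {x r r' : ℝ} (k : ℤ) (h : 6 * r = k) :
    IsAmbiguous x (sigma (chord (x + 1 / 3 + r) r')) := by
  rw [sigma_chord, IsAmbiguous, coe_mem_chord, coe_mem_chord]
  rcases Int.even_or_odd' k with ⟨j, rfl | rfl⟩ <;> push_cast at h
  · exact .inl <| .inl ⟨j + 1, by push_cast; linarith⟩
  · exact .inr <| .inl ⟨j + 1, by push_cast; linarith⟩

lemma isAmbiguous_sigma' {x r r' : ℝ} (k : ℤ) (h : 6 * r = k) :
    IsAmbiguous x (sigma (chord r' (x + 1 / 3 + r))) := by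
  rw [chord_comm]
  exact isAmbiguous_sigma k h

/-- The integers choose representatives of the tripled endpoints, so that order on the circle can be
checked on the line even when the endpoints are spread over different arcs. -/
lemma crosses_sigma_of_lt {a b c d : ℝ} (m n k l : ℤ) (h1 : 3 * a + m < 3 * b + n)
    (h2 : 3 * b + n < 3 * c + k) (h3 : 3 * c + k < 3 * d + l) (h4 : 3 * d + l < 3 * a + m + 1) :
    Crosses (sigma (chord a c)) (sigma (chord b d)) := by
  rw [sigma_chord, sigma_chord, ← chord_shift (a := 3 * a) (b := 3 * c) m k rfl rfl,
    ← chord_shift (a := 3 * b) (b := 3 * d) n l rfl rfl]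
  exact crosses_of_lt h1 h2 h3 h4

/-- Linked chords must lie in the same region. If its arc is shorter than `1/3`, tripling is
injective and monotone on it; in the middle region the images of the two arcs do not overlap and
follow one another around the circle. Endpoints can be identified only for `t = 0` at multiples of
`1/6`, and there the shortness hypotheses apply. -/
lemma crosses_sigma_of_alternate {x t : ℝ} (h0 : 0 ≤ t) (h1 : t < 1 / 6) {R R' : Set ℝ}
    (hR : IsRegion t R) (hR' : IsRegion t R') {a b c d : ℝ} (ha : a ∈ R) (hc : c ∈ R)
    (hb : b ∈ R') (hd : d ∈ R') (hab : a < b) (hbc : b < c) (hcd : c < d)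
    (hs : t = 0 → IsAmbiguous x (sigma (chord (x + 1 / 3 + a) (x + 1 / 3 + c))) →
      length (chord (x + 1 / 3 + a) (x + 1 / 3 + c)) < 1 / 6)
    (hs' : t = 0 → IsAmbiguous x (sigma (chord (x + 1 / 3 + b) (x + 1 / 3 + d))) →
      length (chord (x + 1 / 3 + b) (x + 1 / 3 + d)) < 1 / 6) :
    Crosses (sigma (chord (x + 1 / 3 + a) (x + 1 / 3 + c)))
      (sigma (chord (x + 1 / 3 + b) (x + 1 / 3 + d))) := by
  have len {p q : ℝ} (hpq : p < q) (hq : q ≤ p + 1)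
      (h : length (chord (x + 1 / 3 + p) (x + 1 / 3 + q)) < 1 / 6) :
      q - p < 1 / 6 ∨ 5 / 6 < q - p := by
    rcases le_total q (p + 1 / 2) with h' | h'
    · rw [length_chord_of_le (by linarith) (by linarith)] at h
      exact .inl (by linarith)
    · rw [length_chord_of_ge (by linarith) (by linarith)] at h
      exact .inr (by linarith)
  have ia := hR.subset_Icc h0 h1.le ha
  have ib := hR'.subset_Icc h0 h1.le hb
  have ic := hR.subset_Icc h0 h1.le hc
  have id := hR'.subset_Icc h0 h1.le hd
  have sac (h : t = 0) (h' : (∃ k : ℤ, 6 * a = k) ∨ ∃ k : ℤ, 6 * c = k) :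
      c - a < 1 / 6 ∨ 5 / 6 < c - a := by
    refine len (by linarith) (by linarith [ia.1, ic.2]) (hs h ?_)
    rcases h' with ⟨k, hk⟩ | ⟨k, hk⟩
    exacts [isAmbiguous_sigma k hk, isAmbiguous_sigma' k hk]
  have sbd (h : t = 0) (h' : (∃ k : ℤ, 6 * b = k) ∨ ∃ k : ℤ, 6 * d = k) :
      d - b < 1 / 6 ∨ 5 / 6 < d - b := by
    refine len (by linarith) (by linarith [ib.1, id.2]) (hs' h ?_)
    rcases h' with ⟨k, hk⟩ | ⟨k, hk⟩
    exacts [isAmbiguous_sigma k hk, isAmbiguous_sigma' k hk]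
  have key : (d - a < 1 / 3 ∨ (t ≤ 0 ∧ d - a ≤ 1 / 3 ∧ 1 / 3 ≤ d - a ∧
      ((a ≤ 0 ∧ 0 ≤ a) ∨ (a ≤ 1 / 2 ∧ 1 / 2 ≤ a)))) ∨
      (R = Icc (1 / 3 + t) (1 / 2) ∪ Icc (5 / 6 + t) 1 ∧
        R' = Icc (1 / 3 + t) (1 / 2) ∪ Icc (5 / 6 + t) 1) := by
    clear hs hs' sac sbd len
    rcases hR with rfl | rfl | rfl | rfl | rfl | rfl | rfl <;>
    rcases hR' with rfl | rfl | rfl | rfl | rfl | rfl | rfl <;>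
    simp only [mem_union, mem_Icc] at ha hb hc hd <;>
    first
      | exact .inr ⟨rfl, rfl⟩
      | left; grind (splits := 20)
  rcases key with (hlt | ⟨ht, hle, hge, h | h⟩) | ⟨rfl, rfl⟩
  · exact crosses_sigma_of_lt 0 0 0 0 (by linarith) (by linarith) (by linarith) (by linarith)
  -- Both chords now have ambiguous images and must be short; but two linked chords shorter than
  -- `1/6` cannot span an arc of length `1/3`.
  · have h2 := sac (by linarith) (.inl ⟨0, by push_cast; linarith⟩)
    have h3 := sbd (by linarith) (.inr ⟨2, by push_cast; linarith⟩)
    grind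
  · have h2 := sac (by linarith) (.inl ⟨3, by push_cast; linarith⟩)
    have h3 := sbd (by linarith) (.inr ⟨5, by push_cast; linarith⟩)
    grind
  -- In the middle region, tripled coordinates of points of the second arc are lowered by `1`, which
  -- puts them right after those of the first. The facts `e1` to `e6` exclude the coincidences at
  -- the ends of the arcs when `t = 0`.
  · have ea {r : ℝ} (k : ℤ) (hr : r ≤ k / 6) (hr' : k / 6 ≤ r) : 6 * r = k := by linarith
    have e1 (i1 : b ≤ 1 / 2) (i2 : 1 / 2 ≤ b) (h : t ≤ 0) :=
      sbd (by linarith) (.inl ⟨3, ea 3 (by push_cast; linarith) (by push_cast; linarith)⟩)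
    have e2 (i1 : a ≤ 1 / 2) (i2 : 1 / 2 ≤ a) (h : t ≤ 0) :=
      sac (by linarith) (.inl ⟨3, ea 3 (by push_cast; linarith) (by push_cast; linarith)⟩)
    have e3 (i1 : c ≤ 1 / 2) (i2 : 1 / 2 ≤ c) (h : t ≤ 0) :=
      sac (by linarith) (.inr ⟨3, ea 3 (by push_cast; linarith) (by push_cast; linarith)⟩)
    have e6 (i1 : d ≤ 5 / 6) (i2 : 5 / 6 ≤ d) (h : t ≤ 0) :=
      sbd (by linarith) (.inr ⟨5, ea 5 (by push_cast; linarith) (by push_cast; linarith)⟩)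
    have e4 (i1 : d ≤ 1) (i2 : 1 ≤ d) (h : t ≤ 0) :=
      sbd (by linarith) (.inr ⟨6, ea 6 (by push_cast; linarith) (by push_cast; linarith)⟩)
    have e5 (i1 : a ≤ 1 / 3) (i2 : 1 / 3 ≤ a) (h : t ≤ 0) :=
      sac (by linarith) (.inl ⟨2, ea 2 (by push_cast; linarith) (by push_cast; linarith)⟩)
    simp only [mem_union, mem_Icc] at ha hb hc hd
    clear hs hs' sac sbd len hR hR' ea
    rcases ha with ha | ha <;> rcases hb with hb | hb <;> rcases hc with hc | hc <;>
      rcases hd with hd | hd <;> try (exfalso; linarith)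
    · exact crosses_sigma_of_lt 0 0 0 0 (by linarith) (by linarith) (by linarith) (by linarith)
    · exact crosses_sigma_of_lt 0 0 0 (-1) (by push_cast; grind) (by push_cast; grind)
        (by push_cast; grind) (by push_cast; grind)
    · exact crosses_sigma_of_lt 0 0 (-1) (-1) (by push_cast; grind) (by push_cast; grind)
        (by push_cast; grind) (by push_cast; grind)
    · exact crosses_sigma_of_lt 0 (-1) (-1) (-1) (by push_cast; grind) (by push_cast; grind)
        (by push_cast; grind) (by push_cast; grind)
    · exact crosses_sigma_of_lt 0 0 0 0 (by linarith) (by linarith) (by linarith) (by linarith)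

/-- If chords in the regions cross, then so do their images. In the degenerate case this requires
that ambiguous pullbacks are short. -/
lemma InRegion.crosses_sigma {x t : ℝ} (h0 : 0 ≤ t) (h1 : t < 1 / 6) {ℓ ℓ' : Chord}
    (h : InRegion x t ℓ) (h' : InRegion x t ℓ') (hc : Crosses ℓ ℓ')
    (hs : t = 0 → IsAmbiguous x (sigma ℓ) → length ℓ < 1 / 6)
    (hs' : t = 0 → IsAmbiguous x (sigma ℓ') → length ℓ' < 1 / 6) :
    Crosses (sigma ℓ) (sigma ℓ') := by
  obtain ⟨R, hR, p, hp, q, hq, hpq, rfl⟩ := h.exists_le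
  obtain ⟨R', hR', p', hp', q', hq', hpq', rfl⟩ := h'.exists_le
  have ip := hR.subset_Icc h0 h1.le hp
  have iq := hR.subset_Icc h0 h1.le hq
  have ip' := hR'.subset_Icc h0 h1.le hp'
  have iq' := hR'.subset_Icc h0 h1.le hq'
  rcases hc.alternate ip.1 hpq iq.2 ip'.1 hpq' iq'.2 with ⟨l1, l2, l3⟩ | ⟨l1, l2, l3⟩
  · exact crosses_sigma_of_alternate h0 h1 hR hR' hp hq hp' hq' l1 l2 l3 hs hs'
  · exact (crosses_sigma_of_alternate h0 h1 hR' hR hp' hq' hp hq l1 l2 l3 hs' hs).symm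

/-- The two other members of a triple of siblings of `chord a b` lie in the regions. -/
def HasRegionSiblings (x t a b : ℝ) : Prop :=
  (InRegion x t (chord (a + 1 / 3) (b + 1 / 3)) ∧ InRegion x t (chord (a + 2 / 3) (b + 2 / 3))) ∨
    (InRegion x t (chord (a + 1 / 3) (b + 2 / 3)) ∧ InRegion x t (chord (a + 2 / 3) (b + 1 / 3)))

lemma HasRegionSiblings.symm {x t a b : ℝ} (h : HasRegionSiblings x t a b) :
    HasRegionSiblings x t b a := by
  rcases h with ⟨h1, h2⟩ | ⟨h1, h2⟩
  · exact .inl ⟨by rwa [chord_comm], by rwa [chord_comm]⟩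
  · exact .inr ⟨by rwa [chord_comm], by rwa [chord_comm]⟩

lemma HasRegionSiblings.shift {x t a b a' b' : ℝ} (h : HasRegionSiblings x t a b) (m n : ℤ)
    (ha : a' = a + m) (hb : b' = b + n) : HasRegionSiblings x t a' b' := by
  have e (i j : ℝ) : chord (a' + i) (b' + j) = chord (a + i) (b + j) :=
    chord_shift m n (by rw [ha]; ring) (by rw [hb]; ring)
  simpa only [HasRegionSiblings, e] using h

/-- Rotation by `1/3` permutes the arcs of the regions except that `[t, 1/3]` and `[1/2 + t, 5/6]`
break up at the arcs of `-c` and `c`, which are `[1/6, 1/6 + t]` and `[2/3, 2/3 + t]`. A chord on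
one side of such an arc, or inside it, has its two rotations as siblings; a chord passing over it
has the crossed pairing of the lifted endpoints instead. -/
lemma hasRegionSiblings_of_le {x t p q : ℝ} (h0 : 0 ≤ t) (h1 : t < 1 / 6) {R : Set ℝ}
    (hR : IsRegion t R) (hp : p ∈ R) (hq : q ∈ R) (hpq : p ≤ q)
    (hI : ¬ Crosses (sigma (chord (x + 1 / 3 + p) (x + 1 / 3 + q))) (sigma (chord x (x + t))))
    (hI' : ¬ Crosses (sigma (chord (x + 1 / 3 + p) (x + 1 / 3 + q)))
      (sigma (chord (x + 1 / 2) (x + t + 1 / 2)))) :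
    HasRegionSiblings x t (x + 1 / 3 + p) (x + 1 / 3 + q) := by
  have mk {R : Set ℝ} (hR : IsRegion t R) {i j : ℝ} (m n : ℤ) (h1 : p + i - m ∈ R)
      (h2 : q + j - n ∈ R) : InRegion x t (chord (x + 1 / 3 + p + i) (x + 1 / 3 + q + j)) :=
    InRegion.intro hR m n h1 h2 (by ring) (by ring)
  rcases hR with rfl | rfl | rfl | rfl | rfl | rfl | rfl
  · obtain ⟨p1, p2⟩ := hp
    obtain ⟨q1, q2⟩ := hq
    by_cases c1 : q ≤ 1 / 6
    · exact .inl ⟨mk (region_mid t) 0 0 (.inl <| by constructor <;> push_cast <;> linarith)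
        (.inl <| by constructor <;> push_cast <;> linarith), mk (region_C t) 0 0
          (by constructor <;> push_cast <;> linarith) (by constructor <;> push_cast <;> linarith)⟩
    by_cases c2 : 1 / 6 + t ≤ p
    · exact .inl ⟨mk (region_C t) 0 0 (by constructor <;> push_cast <;> linarith)
        (by constructor <;> push_cast <;> linarith), mk (region_mid t) 0 0
          (.inr <| by constructor <;> push_cast <;> linarith)
          (.inr <| by constructor <;> push_cast <;> linarith)⟩
    by_cases c3 : 1 / 6 ≤ p ∧ q ≤ 1 / 6 + t
    · exact .inl ⟨mk (region_N t) 0 0 (by constructor <;> push_cast <;> linarith)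
        (by constructor <;> push_cast <;> linarith), mk (region_N' t) 0 0
          (by constructor <;> push_cast <;> linarith) (by constructor <;> push_cast <;> linarith)⟩
    by_cases c4 : p ≤ 1 / 6 ∧ 1 / 6 + t ≤ q
    · exact .inr ⟨mk (region_mid t) 0 0 (.inl <| by constructor <;> push_cast <;> linarith)
        (.inr <| by constructor <;> push_cast <;> linarith), mk (region_C t) 0 0
          (by constructor <;> push_cast <;> linarith) (by constructor <;> push_cast <;> linarith)⟩
    -- Exactly one endpoint is now strictly inside the arc of `-c` and the other is outside it, so
    -- the chord crosses `-c`; both lie over an arc on which tripling is injective.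
    exfalso
    apply hI'
    by_cases c5 : p < 1 / 6
    · exact crosses_sigma_of_lt 0 0 0 0 (by push_cast; grind) (by push_cast; grind)
        (by push_cast; grind) (by push_cast; grind)
    · exact (crosses_sigma_of_lt 0 0 0 0 (by push_cast; grind) (by push_cast; grind)
        (by push_cast; grind) (by push_cast; grind)).symm
  · obtain ⟨p1, p2⟩ := hp
    obtain ⟨q1, q2⟩ := hq
    by_cases c1 : q ≤ 2 / 3
    · exact .inl ⟨mk (region_mid t) 0 0 (.inr <| by constructor <;> push_cast <;> linarith)
        (.inr <| by constructor <;> push_cast <;> linarith), mk (region_A t) 1 1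
          (by constructor <;> push_cast <;> linarith) (by constructor <;> push_cast <;> linarith)⟩
    by_cases c2 : 2 / 3 + t ≤ p
    · exact .inl ⟨mk (region_A t) 1 1 (by constructor <;> push_cast <;> linarith)
        (by constructor <;> push_cast <;> linarith), mk (region_mid t) 1 1
          (.inl <| by constructor <;> push_cast <;> linarith)
          (.inl <| by constructor <;> push_cast <;> linarith)⟩
    by_cases c3 : 2 / 3 ≤ p ∧ q ≤ 2 / 3 + t
    · exact .inl ⟨mk (region_P t) 1 1 (by constructor <;> push_cast <;> linarith)
        (by constructor <;> push_cast <;> linarith), mk (region_P' t) 1 1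
          (by constructor <;> push_cast <;> linarith) (by constructor <;> push_cast <;> linarith)⟩
    by_cases c4 : p ≤ 2 / 3 ∧ 2 / 3 + t ≤ q
    · exact .inr ⟨mk (region_mid t) 0 1 (.inr <| by constructor <;> push_cast <;> linarith)
        (.inl <| by constructor <;> push_cast <;> linarith), mk (region_A t) 1 1
          (by constructor <;> push_cast <;> linarith) (by constructor <;> push_cast <;> linarith)⟩
    exfalso
    apply hI
    by_cases c5 : p < 2 / 3
    -- The chord `c` is written at `x`, one full turn below the coordinates of `p` and `q`; tripling
    -- turns this into a shift by `3`.
    · exact crosses_sigma_of_lt 0 3 0 3 (by push_cast; grind) (by push_cast; grind)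
        (by push_cast; grind) (by push_cast; grind)
    · exact (crosses_sigma_of_lt 3 0 3 0 (by push_cast; grind) (by push_cast; grind)
        (by push_cast; grind) (by push_cast; grind)).symm
  · obtain ⟨p1, p2⟩ := hp
    obtain ⟨q1, q2⟩ := hq
    exact .inl ⟨mk (region_P' t) 0 0 (by constructor <;> push_cast <;> linarith)
        (by constructor <;> push_cast <;> linarith), mk (region_C t) 0 0
          (by constructor <;> push_cast <;> linarith) (by constructor <;> push_cast <;> linarith)⟩
  · obtain ⟨p1, p2⟩ := hp
    obtain ⟨q1, q2⟩ := hq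
    exact .inl ⟨mk (region_C t) 0 0 (by constructor <;> push_cast <;> linarith)
        (by constructor <;> push_cast <;> linarith), mk (region_P t) 1 1
          (by constructor <;> push_cast <;> linarith) (by constructor <;> push_cast <;> linarith)⟩
  · obtain ⟨p1, p2⟩ := hp
    obtain ⟨q1, q2⟩ := hq
    exact .inl ⟨mk (region_N' t) 0 0 (by constructor <;> push_cast <;> linarith)
        (by constructor <;> push_cast <;> linarith), mk (region_A t) 1 1
          (by constructor <;> push_cast <;> linarith) (by constructor <;> push_cast <;> linarith)⟩
  · obtain ⟨p1, p2⟩ := hp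
    obtain ⟨q1, q2⟩ := hq
    exact .inl ⟨mk (region_A t) 1 1 (by constructor <;> push_cast <;> linarith)
        (by constructor <;> push_cast <;> linarith), mk (region_N t) 1 1
          (by constructor <;> push_cast <;> linarith) (by constructor <;> push_cast <;> linarith)⟩
  · rcases hp with ⟨p1, p2⟩ | ⟨p1, p2⟩ <;> rcases hq with ⟨q1, q2⟩ | ⟨q1, q2⟩
    · exact .inl ⟨mk (region_C t) 0 0 (by constructor <;> push_cast <;> linarith)
        (by constructor <;> push_cast <;> linarith), mk (region_A t) 1 1
          (by constructor <;> push_cast <;> linarith) (by constructor <;> push_cast <;> linarith)⟩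
    · exact .inr ⟨mk (region_C t) 0 1 (by constructor <;> push_cast <;> linarith)
        (by constructor <;> push_cast <;> linarith), mk (region_A t) 1 1
          (by constructor <;> push_cast <;> linarith) (by constructor <;> push_cast <;> linarith)⟩
    · exfalso
      linarith
    · exact .inl ⟨mk (region_A t) 1 1 (by constructor <;> push_cast <;> linarith)
        (by constructor <;> push_cast <;> linarith), mk (region_C t) 1 1
          (by constructor <;> push_cast <;> linarith) (by constructor <;> push_cast <;> linarith)⟩

/-- A chord in the regions whose image does not cross `σ₃(±c)` has a triple of siblings in the
regions. -/
lemma InRegion.hasRegionSiblings {x t a b : ℝ} (h0 : 0 ≤ t) (h1 : t < 1 / 6)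
    (h : InRegion x t (chord a b))
    (hI : ¬ Crosses (sigma (chord a b)) (sigma (chord x (x + t))))
    (hI' : ¬ Crosses (sigma (chord a b)) (sigma (CubicLam.antipode (chord x (x + t))))) :
    HasRegionSiblings x t a b := by
  obtain ⟨R, hR, p, hp, q, hq, hpq, e⟩ := h.exists_le
  rw [e] at hI hI'
  rw [antipode_chord] at hI'
  have key := hasRegionSiblings_of_le h0 h1 hR hp hq hpq hI hI'
  rcases chord_eq_iff.1 e.symm with ⟨m, n, rfl, rfl⟩ | ⟨m, n, rfl, rfl⟩
  · exact key.shift m n rfl rfl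
  · exact key.symm.shift n m rfl rfl

/-- A chord which does not cross `σ₃(c)` has a preimage in one of the regions. -/
lemma exists_inRegion_sigma_eq {x t : ℝ} (h1 : t < 1 / 6) {ℓ : Chord} (hd : ¬ ℓ.IsDiag)
    (hI : ¬ Crosses ℓ (sigma (chord x (x + t)))) :
    ∃ ℓ', InRegion x t ℓ' ∧ sigma ℓ' = ℓ := by
  obtain ⟨y, z, hy, hyz, hz, rfl⟩ := exists_coord_lt (3 * x) hd
  rw [sigma_chord, show 3 * x = 3 * x + 0 by ring, show 3 * (x + t) = 3 * x + 3 * t by ring,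
    add_zero] at hI
  have hI' := not_alternate_of_not_crosses (e := 0) (f := 3 * t) hy hz le_rfl (by linarith)
    (by rwa [add_zero])
  -- Dividing coordinates relative to `3x` by `3` gives the lift that starts at `x + 1/3`: the arc
  -- `[0, 3t]` of `σ₃(c)` lifts to `[0, t]` and its complement to `[t, 1/3]`.
  have mk {R : Set ℝ} (hR : IsRegion t R) (h1 : y / 3 ∈ R) (h2 : z / 3 ∈ R) :
      ∃ ℓ', InRegion x t ℓ' ∧ sigma ℓ' = chord (3 * x + y) (3 * x + z) :=
    ⟨_, ⟨R, hR, _, h1, _, h2, rfl⟩, sigma_chord' 1 1 (by push_cast; ring) (by push_cast; ring)⟩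
  by_cases c1 : z ≤ 3 * t
  · exact mk (region_P t) (by constructor <;> linarith) (by constructor <;> linarith)
  by_cases c2 : 3 * t ≤ y
  · exact mk (region_A t) (by constructor <;> linarith) (by constructor <;> linarith)
  have hy0 : y = 0 := by grind
  subst hy0
  -- An endpoint at `3x` belongs to both arcs; here it must be lifted to the end `1/3` of `[t, 1/3]`
  -- and not to `0`.
  exact ⟨_, ⟨_, region_A t, 1 / 3, by constructor <;> linarith, z / 3,
    by constructor <;> linarith, rfl⟩, sigma_chord' 2 1 (by push_cast; ring) (by push_cast; ring)⟩

/-! ### Caps and strips in coordinates -/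

lemma InCap.exists_eq {a b u v : ℝ} (h : InCap a b (chord u v)) :
    (∃ r ∈ Icc a b, ∃ n : ℤ, u = r + n) ∧ ∃ r ∈ Icc a b, ∃ n : ℤ, v = r + n := by
  obtain ⟨r, hr, e⟩ := h u (Sym2.mem_mk_left _ _)
  obtain ⟨r', hr', e'⟩ := h v (Sym2.mem_mk_right _ _)
  exact ⟨⟨r, hr, coe_eq_coe.1 e⟩, r', hr', coe_eq_coe.1 e'⟩

lemma inCap_chord {a b u v r s : ℝ} (m n : ℤ) (hr : r ∈ Icc a b) (hs : s ∈ Icc a b)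
    (hu : u = r + m) (hv : v = s + n) : InCap a b (chord u v) := by
  intro p hp
  rcases Sym2.mem_iff.1 hp with rfl | rfl
  · exact ⟨r, hr, coe_eq_coe.2 ⟨m, hu⟩⟩
  · exact ⟨s, hs, coe_eq_coe.2 ⟨n, hv⟩⟩

/-- A chord which misses the short strips lies in one of the regions. -/
lemma inRegion_of_not_meetsShortStrips {x t : ℝ} (h0 : 0 ≤ t) {ℓ : Chord}
    (h : ¬ MeetsShortStrips x t ℓ) : InRegion x t ℓ := by
  simp only [MeetsShortStrips, MeetsStrip, not_or, not_and_or, not_not] at h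
  obtain ⟨h2, h3⟩ := h
  obtain ⟨u, v, hu, huv, hv, rfl⟩ := exists_coord (x + 1 / 3) ℓ
  rcases h2 with h2 | h2
  · obtain ⟨⟨r, hr, m, hm⟩, s, hs, n, hn⟩ := h2.exists_eq
    exact InRegion.intro (region_A t) m n (p := r - (x + 1 / 3)) (q := s - (x + 1 / 3))
      ⟨by linarith [hr.1], by linarith [hr.2]⟩ ⟨by linarith [hs.1], by linarith [hs.2]⟩
      (by linarith) (by linarith)
  rcases h3 with h3 | h3
  · obtain ⟨⟨r, hr, m, hm⟩, s, hs, n, hn⟩ := h3.exists_eq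
    exact InRegion.intro (region_C t) m n (p := r - (x + 1 / 3)) (q := s - (x + 1 / 3))
      ⟨by linarith [hr.1], by linarith [hr.2]⟩ ⟨by linarith [hs.1], by linarith [hs.2]⟩
      (by linarith) (by linarith)
  -- The remaining chords lie beyond both `M_c` and `-M_c`; the two large caps intersect in the
  -- middle region.
  have key {w : ℝ} (h2 : ∃ r ∈ Icc (x + t + 2 / 3) (x + 4 / 3), ∃ n : ℤ, x + 1 / 3 + w = r + n)
      (h3 : ∃ r ∈ Icc (x + 1 / 2 + t + 2 / 3) (x + 1 / 2 + 4 / 3), ∃ n : ℤ,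
        x + 1 / 3 + w = r + n) :
      ∃ p ∈ Icc (1 / 3 + t) (1 / 2) ∪ Icc (5 / 6 + t) 1, ∃ n : ℤ,
        x + 1 / 3 + w = x + 1 / 3 + p + n := by
    obtain ⟨r, hr, m, hm⟩ := h2
    obtain ⟨s, hs, n, hn⟩ := h3
    have l1 : n < m + 1 := by
      have : (n : ℝ) < m + 1 := by linarith [hr.1, hr.2, hs.1, hs.2]
      exact_mod_cast this
    have l2 : m < n + 2 := by
      have : (m : ℝ) < n + 2 := by linarith [hr.1, hr.2, hs.1, hs.2]
      exact_mod_cast this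
    obtain rfl | rfl : n = m ∨ n = m - 1 := by omega
    · exact ⟨r - (x + 1 / 3), .inr ⟨by linarith [hs.1], by linarith [hr.2]⟩, n, by linarith⟩
    · push_cast at hn
      exact ⟨r - (x + 1 / 3), .inl ⟨by linarith [hr.1], by linarith [hs.2]⟩, m, by linarith⟩
  obtain ⟨p, hp, m, hm⟩ := key h2.exists_eq.1 h3.exists_eq.1
  obtain ⟨q, hq, n, hn⟩ := key h2.exists_eq.2 h3.exists_eq.2
  exact InRegion.intro (region_mid t) m n hp hq hm hn

/-! ### Comajors -/

lemma exists_shift_mod_three (m : ℤ) : ∃ i : ℝ, (i = 0 ∨ i = 1 ∨ i = 2) ∧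
    ∃ k : ℤ, -(m : ℝ) = i + 3 * k := by
  have h : -m = (-m) % 3 + 3 * ((-m) / 3) := (Int.emod_add_mul_ediv _ _).symm
  have h' : (-m) % 3 = 0 ∨ (-m) % 3 = 1 ∨ (-m) % 3 = 2 := by omega
  refine ⟨((-m) % 3 : ℤ), ?_, (-m) / 3, by exact_mod_cast h⟩
  exact_mod_cast h'

/-- The chords with the same image as `chord y z`. -/
lemma exists_shift_of_sigma_eq {y z : ℝ} {ℓ : Chord} (h : sigma ℓ = sigma (chord y z)) :
    ∃ i j : ℝ, (i = 0 ∨ i = 1 ∨ i = 2) ∧ (j = 0 ∨ j = 1 ∨ j = 2) ∧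
      ℓ = chord (y + i / 3) (z + j / 3) := by
  have key {a b : ℝ} {m n : ℤ} (h1 : 3 * y = 3 * a + m) (h2 : 3 * z = 3 * b + n) :
      ∃ i j : ℝ, (i = 0 ∨ i = 1 ∨ i = 2) ∧ (j = 0 ∨ j = 1 ∨ j = 2) ∧
        chord a b = chord (y + i / 3) (z + j / 3) := by
    obtain ⟨i, hi, k, hk⟩ := exists_shift_mod_three m
    obtain ⟨j, hj, l, hl⟩ := exists_shift_mod_three n
    exact ⟨i, j, hi, hj, chord_shift k l (by linarith) (by linarith)⟩
  obtain ⟨a, b, rfl⟩ := exists_eq_chord ℓ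
  rw [sigma_chord, sigma_chord, chord_eq_iff] at h
  rcases h with ⟨m, n, h1, h2⟩ | ⟨m, n, h1, h2⟩
  · exact key h1 h2
  · rw [chord_comm a b]
    exact key h2 h1

lemma length_chord_eq_abs_or {a b : ℝ} (h : |a - b| ≤ 1) :
    length (chord a b) = |a - b| ∨ length (chord a b) = 1 - |a - b| := by
  rcases le_total |a - b| (1 / 2) with h' | h'
  · exact .inl (length_chord h')
  · right
    rcases le_total a b with hab | hab
    · have e : |a - b| = b - a := by rw [abs_sub_comm, abs_of_nonneg (by linarith)]
      rw [e] at h h' ⊢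
      exact length_chord_of_ge (by linarith) (by linarith)
    · have e : |a - b| = a - b := abs_of_nonneg (by linarith)
      rw [e] at h h' ⊢
      rw [chord_comm]
      exact length_chord_of_ge (by linarith) (by linarith)

lemma sigma_longSib (x t : ℝ) : sigma (longSib x t) = sigma (chord x (x + t)) := by
  rw [longSib, sigma_chord, sigma_chord]
  exact chord_shift 1 2 (by push_cast; ring) (by push_cast; ring)

lemma sigma_medSib (x t : ℝ) : sigma (medSib x t) = sigma (chord x (x + t)) := by
  rw [medSib, sigma_chord, sigma_chord, chord_comm]
  exact chord_shift 2 1 (by push_cast; ring) (by push_cast; ring)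

lemma sigma_of_mem_quadEdges {x t : ℝ} {e : Chord} (h : e ∈ quadEdges x t) :
    sigma e = sigma (chord x (x + t)) := by
  rcases h with rfl | rfl | rfl | rfl
  · exact sigma_longSib x t
  · exact sigma_medSib x t
  · rw [sigma_chord, sigma_chord]
    exact chord_shift 1 1 (by push_cast; ring) (by push_cast; ring)
  · rw [sigma_chord, sigma_chord]
    exact chord_shift 2 2 (by push_cast; ring) (by push_cast; ring)

lemma length_longSib {x t : ℝ} (h0 : 0 ≤ t) (h1 : t ≤ 1 / 6) :
    length (longSib x t) = 1 / 3 + t := by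
  rw [longSib, length_chord_of_le (by linarith) (by linarith)]
  ring

lemma longSib_mem_quadEdges (x t : ℝ) : longSib x t ∈ quadEdges x t := .inl rfl

lemma DisjointChords.map_antipode {ℓ ℓ' : Chord} (h : DisjointChords ℓ ℓ') :
    DisjointChords (antipode ℓ) (antipode ℓ') := by
  refine ⟨fun p hp hp' => ?_, fun hc => h.2 ?_⟩
  · obtain ⟨q, hq, rfl⟩ := Sym2.mem_map.1 hp
    obtain ⟨q', hq', e⟩ := Sym2.mem_map.1 hp'
    rw [add_left_inj] at e
    exact h.1 q hq (e ▸ hq')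
  · rw [← antipode_antipode ℓ, ← antipode_antipode ℓ']
    exact hc.map_antipode

/-- Two chords with a common endpoint are not disjoint. -/
lemma not_disjointChords_of_left {a b c d : ℝ} (n : ℤ) (h : c = a + n) :
    ¬ DisjointChords (chord a b) (chord c d) := by
  intro hd
  refine hd.1 (a : S) (Sym2.mem_mk_left _ _) ?_
  rw [coe_eq_coe.2 ⟨n, h⟩]
  exact Sym2.mem_mk_left _ _

lemma not_disjointChords_of_right {a b c d : ℝ} (n : ℤ) (h : d = b + n) :
    ¬ DisjointChords (chord a b) (chord c d) := by
  rw [chord_comm a, chord_comm c]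
  exact not_disjointChords_of_left n h

/-- Among the nine lifts of `σ₃(c)`, unequal shifts give length at least `1/3 - t`, hence more than
`1/6`. The remaining lifts are `c` and the two short edges of `Q_c`, and each of these edges shares
an endpoint with both `M_c` and `M'_c`. -/
lemma eq_of_short_sibling {x t : ℝ} (h0 : 0 ≤ t) (h1 : t < 1 / 6) {d : Chord}
    (hd : length d ≤ 1 / 6) (hs : sigma d = sigma (chord x (x + t)))
    (hdis : DisjointChords d (longSib x t) ∨ DisjointChords d (medSib x t)) :
    d = chord x (x + t) := by
  obtain ⟨i, j, hi, hj, rfl⟩ := exists_shift_of_sigma_eq hs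
  have e : x + i / 3 - (x + t + j / 3) = (i - j) / 3 - t := by ring
  have habs : |x + i / 3 - (x + t + j / 3)| = (i - j) / 3 - t ∨
      |x + i / 3 - (x + t + j / 3)| = -((i - j) / 3 - t) := by
    rw [e]
    exact abs_choice _
  have hle : |x + i / 3 - (x + t + j / 3)| ≤ 1 := by
    rw [e, abs_le]
    grind
  have hnn := abs_nonneg (x + i / 3 - (x + t + j / 3))
  have hij : i = j := by
    rcases length_chord_eq_abs_or hle with h | h <;> rw [h] at hd <;>
    generalize |x + i / 3 - (x + t + j / 3)| = w at * <;>
    rcases hi with rfl | rfl | rfl <;> rcases hj with rfl | rfl | rfl <;>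
    first
      | rfl
      | exfalso; grind
  subst hij
  rcases hi with rfl | rfl | rfl
  · exact chord_shift 0 0 (by push_cast; ring) (by push_cast; ring)
  · exfalso
    rcases hdis with h | h
    · exact not_disjointChords_of_left 0 (by push_cast; ring) h
    · rw [chord_comm] at h
      exact not_disjointChords_of_left 0 (by push_cast; ring) h
  · exfalso
    rcases hdis with h | h
    · exact not_disjointChords_of_right 0 (by push_cast; ring) h
    · rw [chord_comm] at h
      exact not_disjointChords_of_right 0 (by push_cast; ring) h

lemma disjointChords_longSib {x t : ℝ} (h0 : 0 ≤ t) (h1 : t ≤ 1 / 6) :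
    DisjointChords (chord x (x + t)) (longSib x t) := by
  refine ⟨fun p hp hp' => ?_, fun hc => ?_⟩
  · have ne {a b : ℝ} (h : a < b) (h' : b < a + 1) : (a : S) ≠ b := fun e =>
      not_isDiag_chord h h' (Sym2.mk_isDiag_iff.2 e)
    rcases Sym2.mem_iff.1 hp with rfl | rfl <;> rcases Sym2.mem_iff.1 hp' with e | e <;>
      exact absurd e (ne (by linarith) (by linarith))
  · have e1 : chord x (x + t) = chord (x + 0) (x + t) := by rw [add_zero]
    have e2 : longSib x t = chord (x + 1 / 3) (x + (t + 2 / 3)) := by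
      rw [longSib]; congr 1; ring
    rw [e1, e2] at hc
    have := hc.alternate le_rfl h0 (by linarith) (by linarith) (by linarith) (by linarith)
    grind

/-- A criterion for `{c, -c}` to be the comajor pair. -/
theorem isComajorPair_of_quadEdges_mem {L : Set Chord} (hL : IsSymmetricLamination L) {x t : ℝ}
    (h0 : 0 ≤ t) (h1 : t < 1 / 6) (hE : ∀ e ∈ quadEdges x t, e ∈ L)
    (hc : chord x (x + t) ∈ L) (hlen : ∀ ℓ ∈ L, t ≤ |length ℓ - 1 / 3|) :
    IsComajorPair L (chord x (x + t)) := by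
  have hE' : ∀ e ∈ quadPairEdges x t, e ∈ L := by
    rintro e (he | ⟨e, he, rfl⟩)
    exacts [hE e he, hL.symmetric _ (hE e he)]
  have lM : length (longSib x t) = 1 / 3 + t := length_longSib h0 h1.le
  have hM : IsMajor L (longSib x t) := by
    refine ⟨hE _ (longSib_mem_quadEdges x t), fun ℓ hℓ => ?_⟩
    rw [lM, add_sub_cancel_left, abs_of_nonneg h0]
    exact hlen ℓ hℓ
  have lc : length (chord x (x + t)) = t := by
    rw [length_chord_of_le (by linarith) (by linarith), add_sub_cancel_left]
  have comajor : IsComajor L (chord x (x + t)) :=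
    ⟨hc, by linarith, _, hM, by linarith, (sigma_longSib x t).symm,
      disjointChords_longSib h0 h1.le⟩
  ext d
  change IsComajor L d ↔ d = _ ∨ d = _
  constructor
  · rintro ⟨hd, hdl, M, ⟨hML, hMmax⟩, hMl, hs, hdis⟩
    have hMle : |length M - 1 / 3| ≤ t := by
      have := hMmax _ hM.1
      rwa [lM, add_sub_cancel_left, abs_of_nonneg h0] at this
    have hMd : ¬ M.IsDiag := length_pos_iff.1 (by linarith)
    -- The exception in `inRegion_of_not_crosses` is a critical leaf of length `1/3`, which `hlen`
    -- forbids when `t > 0`.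
    have hreg : InRegion x t M := by
      refine (inRegion_of_not_crosses h0 h1 hMd fun e he =>
        hL.not_crosses _ hML _ (hE' e he)).resolve_right ?_
      rintro ⟨ht, hdiag⟩
      have h2 := (length_sigma M).2 hMl.le
      rw [length_eq_zero_iff.2 hdiag, eq_comm, abs_eq_zero] at h2
      have h3 := hlen _ hML
      rw [show length M - 1 / 3 = 0 by linarith, abs_zero] at h3
      linarith
    rcases hreg.eq_of_length_le h0 h1 hMle with (rfl | rfl) | (rfl | rfl)
    · exact .inl (eq_of_short_sibling h0 h1 hdl (hs.trans (sigma_longSib x t)) (.inl hdis))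
    · exact .inl (eq_of_short_sibling h0 h1 hdl (hs.trans (sigma_medSib x t)) (.inr hdis))
    · right
      rw [← antipode_antipode d, eq_of_short_sibling (d := antipode d) (x := x) h0 h1]
      · rwa [length_antipode]
      · rw [sigma_antipode, hs, ← sigma_antipode, antipode_antipode, sigma_longSib]
      · left
        have := hdis.map_antipode
        rwa [antipode_antipode] at this
    · right
      rw [← antipode_antipode d, eq_of_short_sibling (d := antipode d) (x := x) h0 h1]
      · rwa [length_antipode]
      · rw [sigma_antipode, hs, ← sigma_antipode, antipode_antipode, sigma_medSib]
      · right
        have := hdis.map_antipode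
        rwa [antipode_antipode] at this
  · rintro (rfl | rfl)
    · exact comajor
    · refine ⟨hL.symmetric _ hc, by rw [length_antipode]; linarith, antipode (longSib x t),
        ⟨hL.symmetric _ hM.1, fun ℓ hℓ => ?_⟩, by rw [length_antipode]; linarith, ?_,
        (disjointChords_longSib h0 h1.le).map_antipode⟩
      · rw [length_antipode]
        exact hM.2 ℓ hℓ
      · rw [sigma_antipode, sigma_antipode, sigma_longSib]

/-! ### Comajor pairs are legal -/

/-- A leaf that is long enough and far from critical misses the strip. -/
lemma not_meetsStrip {y t : ℝ} (h0 : 0 < t) (h1 : t ≤ 1 / 6) {ℓ : Chord}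
    (hM : ¬ Crosses ℓ (longSib y t)) (hM' : ¬ Crosses ℓ (medSib y t))
    (hl : 3 * t ≤ length ℓ) (hl' : t ≤ |length ℓ - 1 / 3|) : ¬ MeetsStrip y t ℓ := by
  have hd : ¬ ℓ.IsDiag := length_pos_iff.1 (by linarith)
  obtain ⟨u, v, hu, huv, hv, rfl⟩ := exists_coord_lt (y + 1 / 3) hd
  have a1 := not_alternate_of_not_crosses (e := 0) (f := 1 / 3 + t) hu hv le_rfl (by linarith)
    (by convert hM using 2; rw [longSib]; congr 1 <;> ring)
  have a2 := not_alternate_of_not_crosses (e := t) (f := 1 / 3) hu hv h0.le (by linarith)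
    (by convert hM' using 2; rw [medSib]; congr 1 <;> ring)
  have hlen : length (chord (y + 1 / 3 + u) (y + 1 / 3 + v)) = v - u ∧ v ≤ u + 1 / 2 ∨
      length (chord (y + 1 / 3 + u) (y + 1 / 3 + v)) = 1 - (v - u) ∧ u + 1 / 2 ≤ v := by
    rcases le_total v (u + 1 / 2) with h | h
    · exact .inl ⟨by rw [length_chord_of_le (by linarith) (by linarith)]; ring, h⟩
    · exact .inr ⟨by rw [length_chord_of_ge (by linarith) (by linarith)]; ring, h⟩
  -- Chords over an end arc of the strip have length at most `t`, and chords joining the two end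
  -- arcs have length strictly within `t` of `1/3` unless they are `M_c` or `M'_c`.
  have key : (t ≤ u ∧ v ≤ 1 / 3) ∨ ((u ≤ 0 ∨ 1 / 3 + t ≤ u) ∧ 1 / 3 + t ≤ v) := by
    rw [le_abs] at hl'
    generalize length (chord (y + 1 / 3 + u) (y + 1 / 3 + v)) = s at *
    clear hM hM' hd
    grind
  rintro ⟨m1, m2⟩
  rcases key with h | ⟨h | h, h'⟩
  · exact m1 (inCap_chord 0 0 (r := y + 1 / 3 + u) (s := y + 1 / 3 + v)
      ⟨by linarith, by linarith⟩ ⟨by linarith, by linarith⟩ (by simp) (by simp))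
  · exact m2 (inCap_chord (-1) 0 (r := y + 1 / 3 + u + 1) (s := y + 1 / 3 + v)
      ⟨by linarith, by linarith⟩ ⟨by linarith, by linarith⟩ (by simp) (by simp))
  · exact m2 (inCap_chord 0 0 (r := y + 1 / 3 + u) (s := y + 1 / 3 + v)
      ⟨by linarith, by linarith⟩ ⟨by linarith, by linarith⟩ (by simp) (by simp))

lemma chord_not_meetsShortStrips {x t : ℝ} (h0 : 0 < t) (h1 : t ≤ 1 / 6) :
    ¬ MeetsShortStrips x t (chord x (x + t)) := by
  rintro (⟨-, h⟩ | ⟨h, -⟩)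
  · exact h (inCap_chord (-1) (-1) (r := x + 1) (s := x + t + 1)
      ⟨by linarith, by linarith⟩ ⟨by linarith, by linarith⟩ (by simp) (by simp))
  · exact h (inCap_chord (-1) (-1) (r := x + 1) (s := x + t + 1)
      ⟨by linarith, by linarith⟩ ⟨by linarith, by linarith⟩ (by simp) (by simp))

lemma longSib_add_half (x t : ℝ) : longSib (x + 1 / 2) t = antipode (longSib x t) := by
  rw [longSib, longSib, antipode_chord]
  congr 1 <;> ring

lemma medSib_add_half (x t : ℝ) : medSib (x + 1 / 2) t = antipode (medSib x t) := by
  rw [medSib, medSib, antipode_chord]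
  congr 1 <;> ring

/-- If the leaf `c` and one of `M_c`, `M'_c` are disjoint siblings in a symmetric lamination, then
both `M_c` and `M'_c` are leaves. -/
lemma longSib_medSib_mem {L : Set Chord} (hL : IsSymmetricLamination L) {x t : ℝ} (h0 : 0 < t)
    (h1 : t ≤ 1 / 6) {M : Chord} (hM : M ∈ L) (hl : 1 / 6 < length M)
    (hs : sigma (chord x (x + t)) = sigma M) (hdis : DisjointChords (chord x (x + t)) M) :
    (longSib x t ∈ L ∧ medSib x t ∈ L) ∧ |length M - 1 / 3| = t := by
  have hnd : ¬ (sigma M).IsDiag := by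
    rw [← hs, sigma_chord]
    exact not_isDiag_chord (by linarith) (by linarith)
  obtain ⟨f, f0, f1, f2⟩ := hL.siblings M hM hnd
  have d01 := f2 0 1 (by decide)
  have d02 := f2 0 2 (by decide)
  have d12 := f2 1 2 (by decide)
  obtain ⟨m1, s1⟩ := f1 1
  obtain ⟨m2, s2⟩ := f1 2
  rw [f0] at d01 d02
  obtain ⟨i₁, j₁, hi₁, hj₁, e1⟩ := exists_shift_of_sigma_eq (s1.trans hs.symm)
  obtain ⟨i₂, j₂, hi₂, hj₂, e2⟩ := exists_shift_of_sigma_eq (s2.trans hs.symm)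
  rw [e1] at d01 d12 m1
  rw [e2] at d02 d12 m2
  have n1 : i₁ ≠ i₂ := fun e => not_disjointChords_of_left 0 (by rw [e]; simp) d12
  have n2 : j₁ ≠ j₂ := fun e => not_disjointChords_of_right 0 (by rw [e]; simp) d12
  obtain ⟨i, j, hi, hj, rfl⟩ := exists_shift_of_sigma_eq hs.symm
  have n3 : i ≠ 0 := fun e => not_disjointChords_of_left 0 (by rw [e]; simp) hdis
  have n4 : j ≠ 0 := fun e => not_disjointChords_of_right 0 (by rw [e]; simp) hdis
  have n5 : i ≠ i₁ := fun e => not_disjointChords_of_left 0 (by rw [e]; simp) d01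
  have n6 : j ≠ j₁ := fun e => not_disjointChords_of_right 0 (by rw [e]; simp) d01
  have n7 : i ≠ i₂ := fun e => not_disjointChords_of_left 0 (by rw [e]; simp) d02
  have n8 : j ≠ j₂ := fun e => not_disjointChords_of_right 0 (by rw [e]; simp) d02
  have hij : i ≠ j := by
    rintro rfl
    rw [length_chord_of_le (by linarith) (by linarith)] at hl
    linarith
  have long : longSib x t = chord (x + 1 / 3) (x + t + 2 / 3) := rfl
  have med : medSib x t = chord (x + 2 / 3) (x + t + 1 / 3) := chord_comm _ _
  -- Disjointness from `c` excludes shift `0` and the length bound excludes equal shifts, so `M` is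
  -- `M_c` or `M'_c`.
  obtain ⟨rfl, rfl⟩ | ⟨rfl, rfl⟩ : (i = 1 ∧ j = 2) ∨ (i = 2 ∧ j = 1) := by grind
  · refine ⟨⟨hM, ?_⟩, ?_⟩
    · rw [med]
      have c1 {k : ℝ} (h : DisjointChords (chord (x + 1 / 3) (x + t + 2 / 3))
          (chord (x + 2 / 3) (x + t + k / 3))) : k ≠ 0 := by
        rintro rfl
        refine h.2 ?_
        rw [chord_comm (x + 2 / 3)]
        exact (crosses_of_lt (by linarith) (by linarith) (by linarith) (by linarith)).symm
      rcases (by grind : i₁ = 2 ∨ i₂ = 2) with rfl | rfl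
      · have := c1 d01
        obtain rfl : j₁ = 1 := by grind
        exact m1
      · have := c1 d02
        obtain rfl : j₂ = 1 := by grind
        exact m2
    · rw [length_chord_of_le (by linarith) (by linarith),
        show x + t + 2 / 3 - (x + 1 / 3) - 1 / 3 = t by ring, abs_of_pos h0]
  · have lM : length (chord (x + 2 / 3) (x + t + 1 / 3)) = 1 / 3 - t := by
      rw [chord_comm, length_chord_of_le (by linarith) (by linarith)]
      ring
    rw [lM] at hl
    refine ⟨⟨?_, by rwa [med]⟩, ?_⟩
    · rw [long]
      -- If `M` is `M'_c`, there is also a disjoint triple that contains neither `c` nor `M_c`.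
      -- Symmetry excludes it: its member at `x` would cross `-M'_c`.
      have c1 : chord x (x + t + 2 / 3) ∉ L := by
        intro h
        refine hL.not_crosses _ h _ (hL.symmetric _ hM) ?_
        rw [antipode_chord, chord_comm (x + 2 / 3 + 1 / 2),
          ← chord_shift (a := x) (b := x + t + 2 / 3) (a' := x + 1)
            (b' := x + t + 2 / 3) 1 0 (by simp) (by simp),
          chord_comm (x + 1)]
        exact crosses_of_lt (by linarith) (by linarith) (by linarith) (by linarith)
      have c2 {k : ℝ} (h : chord (x + 0 / 3) (x + t + k / 3) ∈ L) : k ≠ 2 := by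
        rintro rfl
        rw [zero_div, add_zero] at h
        exact c1 h
      rcases (by grind : i₁ = 1 ∨ i₂ = 1) with rfl | rfl
      · obtain rfl : i₂ = 0 := by grind
        have := c2 m2
        obtain rfl : j₁ = 2 := by grind
        exact m1
      · obtain rfl : i₁ = 0 := by grind
        have := c2 m1
        obtain rfl : j₂ = 2 := by grind
        exact m2
    · rw [lM, show 1 / 3 - t - 1 / 3 = -t by ring, abs_neg, abs_of_pos h0]

lemma IsSymmetricLamination.iterate_mem {L : Set Chord} (hL : IsSymmetricLamination L) {ℓ : Chord}
    (h : ℓ ∈ L) (n : ℕ) : sigma^[n] ℓ ∈ L := by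
  induction n with
  | zero => exact h
  | succ n ih =>
    rw [Function.iterate_succ_apply']
    rcases hL.forward _ ih with h | h
    · exact h
    · generalize sigma (sigma^[n] ℓ) = ℓ' at h
      induction ℓ' using Sym2.ind with
      | _ p q =>
        obtain rfl : p = q := Sym2.mk_isDiag_iff.1 h
        exact hL.degenerate_mem p

lemma three_mul_le_length_sigma {ℓ : Chord} {t : ℝ} (h : t ≤ length ℓ)
    (h' : t ≤ |length ℓ - 1 / 3|) : 3 * t ≤ length (sigma ℓ) := by
  rcases le_total (length ℓ) (1 / 6) with hl | hl
  · rw [(length_sigma ℓ).1 hl]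
    linarith
  · rw [(length_sigma ℓ).2 hl, show 1 - 3 * length ℓ = -(3 * (length ℓ - 1 / 3)) by ring, abs_neg,
      abs_mul, abs_of_pos (three_pos (α := ℝ))]
    linarith

/-- The comajor pair of a symmetric lamination is legal. -/
theorem isLegal_of_isComajorPair {L : Set Chord} (hL : IsSymmetricLamination L) {c : Chord}
    (h : IsComajorPair L c) : IsLegal c := by
  have hc : IsComajor L c := by
    have : c ∈ {d | IsComajor L d} := by
      rw [h]
      exact .inl rfl
    exact this
  by_cases hd : c.IsDiag
  · exact .inl hd
  obtain ⟨hcL, hcl, M, ⟨hML, hMmax⟩, hMl, hs, hdis⟩ := hc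
  obtain ⟨x, hx⟩ := exists_chord_length c
  have h0 : 0 < length c := length_pos_iff.2 hd
  generalize ht : length c = t at *
  subst hx
  obtain ⟨⟨hlong, hmed⟩, hlen⟩ := longSib_medSib_mem hL h0 hcl hML hMl hs hdis
  rw [hlen] at hMmax
  refine .inr ⟨x, t, h0, hcl, rfl, ?_, ?_⟩
  · have mem : ∀ ℓ ∈ orbitPair (chord x (x + t)), ℓ ∈ L := by
      rintro ℓ ⟨n, rfl | rfl⟩
      · exact hL.iterate_mem hcL n
      · exact hL.iterate_mem (hL.symmetric _ hcL) n
    exact fun ℓ hℓ ℓ' hℓ' => hL.not_crosses _ (mem ℓ hℓ) _ (mem ℓ' hℓ')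
  -- Lengths at least `t` persist because each step even yields `3t`. The chord `c` is shorter than
  -- `3t`, so only its proper images fall under `not_meetsStrip`.
  · have hlow (n : ℕ) : t ≤ length (sigma^[n] (chord x (x + t))) := by
      induction n with
      | zero => exact ht.ge
      | succ n ih =>
        rw [Function.iterate_succ_apply']
        linarith [three_mul_le_length_sigma ih (hMmax _ (hL.iterate_mem hcL n))]
    intro n
    cases n with
    | zero => exact chord_not_meetsShortStrips h0 hcl
    | succ n =>
      have hmem := hL.iterate_mem hcL (n + 1)
      have hge := three_mul_le_length_sigma (hlow n) (hMmax _ (hL.iterate_mem hcL n))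
      rw [← Function.iterate_succ_apply' (f := sigma)] at hge
      rintro (hm | hm)
      · exact not_meetsStrip h0 hcl (hL.not_crosses _ hmem _ hlong)
          (hL.not_crosses _ hmem _ hmed) hge (hMmax _ hmem) hm
      · refine not_meetsStrip h0 hcl ?_ ?_ hge (hMmax _ hmem) hm
        · rw [longSib_add_half]
          exact hL.not_crosses _ hmem _ (hL.symmetric _ hlong)
        · rw [medSib_add_half]
          exact hL.not_crosses _ hmem _ (hL.symmetric _ hmed)

/-! ### Families of pullbacks -/

lemma HasSiblings.symm {C : Set Chord} {p q : S} (h : HasSiblings C p q) : HasSiblings C q p := by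
  rcases h with ⟨h1, h2⟩ | ⟨h1, h2⟩
  · exact .inl ⟨by rwa [Sym2.eq_swap], by rwa [Sym2.eq_swap]⟩
  · exact .inr ⟨by rwa [Sym2.eq_swap], by rwa [Sym2.eq_swap]⟩

lemma coe_add_third (a : ℝ) : (a : S) + third = ((a + 1 / 3 : ℝ) : S) :=
  (AddCircle.coe_add _ _ _).symm

lemma coe_add_third_add_third (a : ℝ) : (a : S) + third + third = ((a + 2 / 3 : ℝ) : S) := by
  rw [coe_add_third, coe_add_third]
  congr 1
  ring

lemma hasSiblings_of_eq_chord {C : Set Chord} {p q : S} {a b : ℝ} (e : s(p, q) = chord a b)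
    (h : (chord (a + 1 / 3) (b + 1 / 3) ∈ C ∧ chord (a + 2 / 3) (b + 2 / 3) ∈ C) ∨
      (chord (a + 1 / 3) (b + 2 / 3) ∈ C ∧ chord (a + 2 / 3) (b + 1 / 3) ∈ C)) :
    HasSiblings C p q := by
  have key : HasSiblings C (a : S) (b : S) := by
    simp only [HasSiblings, coe_add_third_add_third]
    simp only [coe_add_third]
    exact h
  rcases Sym2.eq_iff.1 e with ⟨rfl, rfl⟩ | ⟨rfl, rfl⟩
  exacts [key, key.symm]

lemma sigma_add_third {a b i j : ℝ} (m n : ℤ) (hi : 3 * i = m) (hj : 3 * j = n) :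
    sigma (chord (a + i) (b + j)) = sigma (chord a b) := by
  rw [sigma_chord, sigma_chord]
  exact chord_shift m n (by rw [← hi]; ring) (by rw [← hj]; ring)

lemma HasRegionSiblings.mem_family {C : Set Chord} {x t a b : ℝ} (h : HasRegionSiblings x t a b)
    (hC : ∀ ℓ, InRegion x t ℓ → sigma ℓ = sigma (chord a b) → ℓ ∈ C) :
    (chord (a + 1 / 3) (b + 1 / 3) ∈ C ∧ chord (a + 2 / 3) (b + 2 / 3) ∈ C) ∨
      (chord (a + 1 / 3) (b + 2 / 3) ∈ C ∧ chord (a + 2 / 3) (b + 1 / 3) ∈ C) :=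
  Or.imp
    (fun h => ⟨hC _ h.1 (sigma_add_third 1 1 (by norm_num) (by norm_num)),
      hC _ h.2 (sigma_add_third 2 2 (by norm_num) (by norm_num))⟩)
    (fun h => ⟨hC _ h.1 (sigma_add_third 1 2 (by norm_num) (by norm_num)),
      hC _ h.2 (sigma_add_third 2 1 (by norm_num) (by norm_num))⟩) h

lemma inRegion_of_mem_quadPairEdges {x t : ℝ} (h0 : 0 ≤ t) (h1 : t ≤ 1 / 6) {e : Chord}
    (h : e ∈ quadPairEdges x t) : InRegion x t e := by
  obtain ⟨i, j, rfl, hij⟩ := mem_quadPairEdges.1 h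
  rcases hij with ⟨hi, hj⟩ | ⟨hi, hj⟩ | ⟨hi, hj⟩ | ⟨hi, hj⟩ | ⟨hi, hj⟩ | ⟨hi, hj⟩ | ⟨hi, hj⟩ |
    ⟨hi, hj⟩ <;> rw [hi, hj]
  · exact InRegion.intro (region_mid t) (p := 1) (q := 1 / 3 + t) (-1) 0
      (.inr ⟨by linarith, le_rfl⟩) (.inl ⟨by linarith, by linarith⟩) (by simp) (by simp)
  · exact ⟨_, region_A t, _, ⟨by linarith, by linarith⟩, _, ⟨by linarith, by linarith⟩, rfl⟩
  · exact ⟨_, region_P t, _, ⟨by linarith, by linarith⟩, _, ⟨by linarith, by linarith⟩, rfl⟩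
  · exact ⟨_, region_P' t, _, ⟨by linarith, by linarith⟩, _, ⟨by linarith, by linarith⟩, rfl⟩
  · exact ⟨_, region_mid t, _, .inl ⟨by linarith, by linarith⟩, _,
      .inr ⟨by linarith, by linarith⟩, rfl⟩
  · exact ⟨_, region_C t, _, ⟨by linarith, by linarith⟩, _, ⟨by linarith, by linarith⟩, rfl⟩
  · exact ⟨_, region_N t, _, ⟨by linarith, by linarith⟩, _, ⟨by linarith, by linarith⟩, rfl⟩
  · exact ⟨_, region_N' t, _, ⟨by linarith, by linarith⟩, _, ⟨by linarith, by linarith⟩, rfl⟩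

lemma not_isDiag_of_sigma_eq {ℓ ℓ' : Chord} (h : sigma ℓ' = ℓ) (hd : ¬ ℓ.IsDiag) :
    ¬ ℓ'.IsDiag := fun hd' => hd (h ▸ sigma_isDiag hd')

lemma self_mem_orbitPair (c : Chord) : c ∈ orbitPair c := ⟨0, .inl rfl⟩

lemma sigma_mem_orbitPair {c ℓ : Chord} (h : ℓ ∈ orbitPair c) : sigma ℓ ∈ orbitPair c := by
  obtain ⟨n, rfl | rfl⟩ := h
  · exact ⟨n + 1, .inl (Function.iterate_succ_apply' _ _ _).symm⟩
  · exact ⟨n + 1, .inr (Function.iterate_succ_apply' _ _ _).symm⟩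

lemma antipode_mem_orbitPair {c ℓ : Chord} (h : ℓ ∈ orbitPair c) :
    antipode ℓ ∈ orbitPair c := by
  obtain ⟨n, rfl | rfl⟩ := h
  · exact ⟨n, .inr (iterate_sigma_antipode n c).symm⟩
  · refine ⟨n, .inl ?_⟩
    rw [iterate_sigma_antipode, antipode_antipode]

/-! ### The nondegenerate case -/

section Nondegenerate

variable {x t : ℝ}

lemma inRegion_of_mem_orbitPair (h0 : 0 ≤ t)
    (hstrip : ∀ n : ℕ, ¬ MeetsShortStrips x t (sigma^[n] (chord x (x + t)))) {ℓ : Chord}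
    (h : ℓ ∈ orbitPair (chord x (x + t))) : InRegion x t ℓ := by
  obtain ⟨n, rfl | rfl⟩ := h
  · exact inRegion_of_not_meetsShortStrips h0 (hstrip n)
  · rw [iterate_sigma_antipode]
    exact (inRegion_of_not_meetsShortStrips h0 (hstrip n)).map_antipode

/-- The orbit never becomes shorter than `t`: chords in regions are at distance at least `t` from
length `1/3`, so their images have length at least `3t`. -/
lemma not_isDiag_of_mem_orbitPair (h0 : 0 < t) (h1 : t < 1 / 6)
    (hstrip : ∀ n : ℕ, ¬ MeetsShortStrips x t (sigma^[n] (chord x (x + t)))) {ℓ : Chord}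
    (h : ℓ ∈ orbitPair (chord x (x + t))) : ¬ ℓ.IsDiag := by
  have hlow (n : ℕ) : t ≤ length (sigma^[n] (chord x (x + t))) := by
    induction n with
    | zero =>
      rw [Function.iterate_zero_apply, length_chord_of_le (by linarith) (by linarith)]
      linarith
    | succ n ih =>
      rw [Function.iterate_succ_apply']
      have := (inRegion_of_not_meetsShortStrips h0.le (hstrip n)).length_ge h0.le h1
      linarith [three_mul_le_length_sigma ih this]
  obtain ⟨n, rfl | rfl⟩ := h
  · exact length_pos_iff.1 (by linarith [hlow n])
  · rw [iterate_sigma_antipode, antipode_isDiag_iff]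
    exact length_pos_iff.1 (by linarith [hlow n])

/-- Nondegeneracy is proved along with the region because it excludes the critical diagonals of
`±Q_c` as pullbacks. -/
lemma NondegenerateFamily.inRegion (h0 : 0 < t) (h1 : t < 1 / 6)
    (hstrip : ∀ n : ℕ, ¬ MeetsShortStrips x t (sigma^[n] (chord x (x + t)))) {ℓ : Chord}
    (h : NondegenerateFamily x t ℓ) : ¬ ℓ.IsDiag ∧ InRegion x t ℓ := by
  induction h with
  | orbit ℓ h =>
    exact ⟨not_isDiag_of_mem_orbitPair h0 h1 hstrip h, inRegion_of_mem_orbitPair h0.le hstrip h⟩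
  | edge ℓ h =>
    refine ⟨?_, inRegion_of_mem_quadPairEdges h0.le h1.le h⟩
    obtain ⟨i, j, rfl, hij⟩ := mem_quadPairEdges.1 h
    exact not_isDiag_chord (by grind) (by grind)
  | pullback ℓ ℓ' _ hp ih =>
    have hd := not_isDiag_of_sigma_eq hp.1 ih.1
    exact ⟨hd, (inRegion_of_not_crosses h0.le h1 hd hp.2).resolve_right fun h =>
      ih.1 (hp.1 ▸ h.2)⟩

lemma NondegenerateFamily.sigma_mem {ℓ : Chord} (h : NondegenerateFamily x t ℓ) :
    NondegenerateFamily x t (sigma ℓ) := by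
  cases h with
  | orbit _ h => exact .orbit _ (sigma_mem_orbitPair h)
  | edge _ h =>
    have hc := sigma_mem_orbitPair (self_mem_orbitPair (chord x (x + t)))
    rcases h with h | ⟨e, h, rfl⟩
    · rw [sigma_of_mem_quadEdges h]
      exact .orbit _ hc
    · rw [sigma_antipode, sigma_of_mem_quadEdges h]
      exact .orbit _ (antipode_mem_orbitPair hc)
  | pullback ℓ _ h hp => rwa [hp.1]

lemma NondegenerateFamily.antipode_mem {ℓ : Chord} (h : NondegenerateFamily x t ℓ) :
    NondegenerateFamily x t (CubicLam.antipode ℓ) := by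
  induction h with
  | orbit _ h => exact .orbit _ (antipode_mem_orbitPair h)
  | edge _ h => exact .edge _ (antipode_mem_quadPairEdges h)
  | pullback ℓ ℓ' _ hp ih =>
    refine .pullback _ _ ih ⟨by rw [sigma_antipode, hp.1], fun e he hc => ?_⟩
    refine hp.2 _ (antipode_mem_quadPairEdges he) ?_
    rw [← antipode_antipode ℓ']
    exact hc.map_antipode

/-- A crossing can be pushed forward by `σ₃`. Doing so until one chord reaches the initial family
leaves a crossing with an edge, impossible in a region, or with an orbit chord; in the latter case
the other chord is pushed forward too, until legality applies. -/
lemma NondegenerateFamily.not_crosses (h0 : 0 < t) (h1 : t < 1 / 6)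
    (hnc : ∀ ℓ ∈ orbitPair (chord x (x + t)), ∀ ℓ' ∈ orbitPair (chord x (x + t)), ¬ Crosses ℓ ℓ')
    (hstrip : ∀ n : ℕ, ¬ MeetsShortStrips x t (sigma^[n] (chord x (x + t)))) {ℓ ℓ' : Chord}
    (h : NondegenerateFamily x t ℓ) (h' : NondegenerateFamily x t ℓ') : ¬ Crosses ℓ ℓ' := by
  have reg {ℓ : Chord} (h : NondegenerateFamily x t ℓ) := (h.inRegion h0 h1 hstrip).2
  have cross {ℓ ℓ' : Chord} (h : NondegenerateFamily x t ℓ) (h' : NondegenerateFamily x t ℓ')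
      (hc : Crosses ℓ ℓ') : Crosses (sigma ℓ) (sigma ℓ') :=
    (reg h).crosses_sigma h0.le h1 (reg h') hc (fun h => absurd h h0.ne') fun h => absurd h h0.ne'
  have orb {ℓ : Chord} (h : NondegenerateFamily x t ℓ) :
      ∀ ℓ' ∈ orbitPair (chord x (x + t)), ¬ Crosses ℓ ℓ' := by
    induction h with
    | orbit _ h => exact hnc _ h
    | edge _ h => exact fun ℓ' hℓ' hc => (reg (.orbit _ hℓ')).not_crosses h0.le h1 _ h hc.symm
    | pullback ℓ ℓ₁ h hp ih =>
      intro ℓ' hℓ' hc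
      have := cross (.pullback _ _ h hp) (.orbit _ hℓ') hc
      rw [hp.1] at this
      exact ih _ (sigma_mem_orbitPair hℓ') this
  induction h generalizing ℓ' with
  | orbit _ h => exact fun hc => orb h' _ h hc.symm
  | edge _ h => exact fun hc => (reg h').not_crosses h0.le h1 _ h hc.symm
  | pullback ℓ ℓ₁ h hp ih =>
    intro hc
    have := cross (.pullback _ _ h hp) h' hc
    rw [hp.1] at this
    exact ih h'.sigma_mem this

theorem nondegenerateFamily_lamination (h0 : 0 < t) (h1 : t < 1 / 6)
    (hnc : ∀ ℓ ∈ orbitPair (chord x (x + t)), ∀ ℓ' ∈ orbitPair (chord x (x + t)), ¬ Crosses ℓ ℓ')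
    (hstrip : ∀ n : ℕ, ¬ MeetsShortStrips x t (sigma^[n] (chord x (x + t)))) :
    IsSymmetricLamination
        ({ℓ | ℓ.IsDiag} ∪ chordClosure {ℓ | NondegenerateFamily x t ℓ}) ∧
      IsComajorPair ({ℓ | ℓ.IsDiag} ∪ chordClosure {ℓ | NondegenerateFamily x t ℓ})
        (chord x (x + t)) := by
  have hc : NondegenerateFamily x t (chord x (x + t)) := .orbit _ (self_mem_orbitPair _)
  have hL : IsSymmetricLamination
      ({ℓ | ℓ.IsDiag} ∪ chordClosure {ℓ | NondegenerateFamily x t ℓ}) := by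
    refine isSymmetricLamination_closure ?_ ?_ ?_ ?_ ?_
    · exact fun ℓ h ℓ' h' => NondegenerateFamily.not_crosses h0 h1 hnc hstrip h h'
    · exact fun ℓ h => .inl (NondegenerateFamily.sigma_mem h)
    · intro ℓ h
      obtain ⟨ℓ', hr, e⟩ := exists_inRegion_sigma_eq h1 (h.inRegion h0 h1 hstrip).1
        (NondegenerateFamily.not_crosses h0 h1 hnc hstrip h hc.sigma_mem)
      exact ⟨ℓ', .pullback _ _ h ⟨e, hr.not_crosses h0.le h1⟩, e⟩
    · intro p q h
      right
      obtain ⟨a, b, e⟩ := exists_eq_chord s(p, q)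
      refine hasSiblings_of_eq_chord e ?_
      rw [e] at h
      have h : NondegenerateFamily x t (chord a b) := h
      refine ((h.inRegion h0 h1 hstrip).2.hasRegionSiblings h0.le h1
        (NondegenerateFamily.not_crosses h0 h1 hnc hstrip h.sigma_mem hc.sigma_mem)
        (NondegenerateFamily.not_crosses h0 h1 hnc hstrip h.sigma_mem
          hc.antipode_mem.sigma_mem)).mem_family fun ℓ hr hs => ?_
      exact .pullback _ _ h.sigma_mem ⟨hs, hr.not_crosses h0.le h1⟩
    · exact fun ℓ h => NondegenerateFamily.antipode_mem h
  refine ⟨hL, isComajorPair_of_quadEdges_mem hL h0.le h1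
    (fun e he => .inr (subset_chordClosure _ (.edge _ (.inl he))))
    (.inr (subset_chordClosure _ hc)) ?_⟩
  rintro ℓ (hℓ | hℓ)
  · rw [length_eq_zero_iff.2 hℓ, zero_sub, abs_neg, abs_of_pos (by norm_num)]
    linarith
  · exact length_mem_of_mem_chordClosure (K := {r | t ≤ |r - 1 / 3|})
      (isClosed_le continuous_const (by fun_prop))
      (fun ℓ h => (NondegenerateFamily.inRegion h0 h1 hstrip h).2.length_ge h0.le h1) hℓ

end Nondegenerate

/-! ### The degenerate case -/

section Degenerate

variable {x : ℝ}

lemma medSib_zero (x : ℝ) : medSib x 0 = longSib x 0 := by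
  rw [medSib, longSib, add_zero]

lemma not_crosses_quadPairEdges_zero {ℓ : Chord}
    (h : ∀ e ∈ ({longSib x 0, antipode (longSib x 0)} : Set Chord), ¬ Crosses ℓ e) :
    ∀ e ∈ quadPairEdges x 0, ¬ Crosses ℓ e := by
  have key {e : Chord} (he : e ∈ quadEdges x 0) : e = longSib x 0 ∨ e.IsDiag := by
    rcases he with rfl | rfl | rfl | rfl
    · exact .inl rfl
    · exact .inl (medSib_zero x)
    · rw [add_zero]
      exact .inr (chord_isDiag _)
    · rw [add_zero]
      exact .inr (chord_isDiag _)
  rintro e (he | ⟨e, he, rfl⟩) hc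
  · rcases key he with rfl | hd
    · exact h _ (.inl rfl) hc
    · exact hc.not_isDiag_right hd
  · rcases key he with rfl | hd
    · exact h _ (.inr rfl) hc
    · exact hc.not_isDiag_right (antipode_isDiag hd)

lemma longSib_zero_mem_quadPairEdges (x : ℝ) :
    ({longSib x 0, antipode (longSib x 0)} : Set Chord) ⊆ quadPairEdges x 0 := by
  rintro e (rfl | rfl)
  · exact .inl (longSib_mem_quadEdges x 0)
  · exact .inr ⟨_, longSib_mem_quadEdges x 0, rfl⟩

lemma isAmbiguous_of_antipode {ℓ : Chord} (h : IsAmbiguous x (antipode ℓ)) : IsAmbiguous x ℓ := by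
  obtain ⟨a, b, rfl⟩ := exists_eq_chord ℓ
  rw [antipode_chord] at h
  simp only [IsAmbiguous, coe_mem_chord] at h ⊢
  rcases h with (⟨n, hn⟩ | ⟨n, hn⟩) | (⟨n, hn⟩ | ⟨n, hn⟩)
  · exact .inr <| .inl ⟨n - 1, by push_cast; linarith⟩
  · exact .inr <| .inr ⟨n - 1, by push_cast; linarith⟩
  · exact .inl <| .inl ⟨n, by linarith⟩
  · exact .inl <| .inr ⟨n, by linarith⟩

lemma isShort_antipode {ℓ : Chord} (h : IsShort ℓ) : IsShort (antipode ℓ) := by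
  rwa [IsShort, length_antipode]

/-- A chord over one of the six arcs of length `1/6` between consecutive preimages of `3x` and
`3x + 1/2`. -/
def InSixth (x : ℝ) (ℓ : Chord) : Prop :=
  ∃ k : ℤ, ∃ p ∈ Icc (k / 6 : ℝ) ((k + 1) / 6), ∃ q ∈ Icc (k / 6 : ℝ) ((k + 1) / 6),
    ℓ = chord (x + 1 / 3 + p) (x + 1 / 3 + q)

lemma InSixth.exists_normalized {ℓ : Chord} (h : InSixth x ℓ) : ∃ k : ℤ, (0 ≤ k ∧ k ≤ 5) ∧
    ∃ p ∈ Icc (k / 6 : ℝ) ((k + 1) / 6), ∃ q ∈ Icc (k / 6 : ℝ) ((k + 1) / 6),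
      p ≤ q ∧ ℓ = chord (x + 1 / 3 + p) (x + 1 / 3 + q) := by
  obtain ⟨k, p, hp, q, hq, rfl⟩ := h
  have hk : (k : ℝ) = (k % 6 : ℤ) + 6 * (k / 6 : ℤ) := by
    exact_mod_cast (Int.emod_add_mul_ediv k 6).symm
  have hb : 0 ≤ k % 6 ∧ k % 6 ≤ 5 := by omega
  generalize k % 6 = j at *
  generalize k / 6 = m at *
  obtain ⟨p1, p2⟩ := hp
  obtain ⟨q1, q2⟩ := hq
  rcases le_total p q with h | h
  · exact ⟨j, hb, p - m, ⟨by linarith, by linarith⟩, q - m, ⟨by linarith, by linarith⟩,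
      by linarith, chord_shift m m (by ring) (by ring)⟩
  · exact ⟨j, hb, q - m, ⟨by linarith, by linarith⟩, p - m, ⟨by linarith, by linarith⟩,
      by linarith, by rw [chord_comm]; exact chord_shift m m (by ring) (by ring)⟩

lemma InSixth.inRegion {ℓ : Chord} (h : InSixth x ℓ) : InRegion x 0 ℓ := by
  obtain ⟨k, hk, p, ⟨p1, p2⟩, q, ⟨q1, q2⟩, -, rfl⟩ := h.exists_normalized
  obtain rfl | rfl | rfl | rfl | rfl | rfl :
      k = 0 ∨ k = 1 ∨ k = 2 ∨ k = 3 ∨ k = 4 ∨ k = 5 := by omega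
  all_goals push_cast at p1 p2 q1 q2
  · exact ⟨_, region_A 0, p, ⟨by linarith, by linarith⟩, q, ⟨by linarith, by linarith⟩, rfl⟩
  · exact ⟨_, region_A 0, p, ⟨by linarith, by linarith⟩, q, ⟨by linarith, by linarith⟩, rfl⟩
  · exact ⟨_, region_mid 0, p, .inl ⟨by linarith, by linarith⟩, q,
      .inl ⟨by linarith, by linarith⟩, rfl⟩
  · exact ⟨_, region_C 0, p, ⟨by linarith, by linarith⟩, q, ⟨by linarith, by linarith⟩, rfl⟩
  · exact ⟨_, region_C 0, p, ⟨by linarith, by linarith⟩, q, ⟨by linarith, by linarith⟩, rfl⟩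
  · exact ⟨_, region_mid 0, p, .inr ⟨by linarith, by linarith⟩, q,
      .inr ⟨by linarith, by linarith⟩, rfl⟩

lemma inSixth_of_le {k : ℤ} {s : ℝ} (hs : |s| ≤ 1 / 6) {a b : ℝ} (ha : a = x + 1 / 3 + k / 6)
    (hb : b = a + s) : InSixth x (chord a b) := by
  rw [abs_le] at hs
  subst ha hb
  rcases le_total 0 s with h | h
  · exact ⟨k, k / 6, ⟨le_rfl, by linarith⟩, k / 6 + s, ⟨by linarith, by linarith⟩,
      by congr 1; ring⟩
  · refine ⟨k - 1, k / 6, ⟨?_, ?_⟩, k / 6 + s, ⟨?_, ?_⟩, by congr 1; ring⟩ <;> push_cast <;>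
      linarith

/-- An ambiguous chord, with the ambiguous endpoint first. -/
lemma IsAmbiguous.exists_eq {ℓ : Chord} (h : IsAmbiguous x ℓ) :
    ∃ (k : ℤ) (s : ℝ), |s| = length ℓ ∧ ℓ = chord (3 * x + 1 + k / 2) (3 * x + 1 + k / 2 + s) := by
  -- The extra turn `1` makes this endpoint the triple of `x + 1/3 + k/6`, an end of one of the six
  -- arcs.
  obtain ⟨k, p, hp⟩ : ∃ (k : ℤ) (p : S), ℓ = s(((3 * x + 1 + k / 2 : ℝ) : S), p) := by
    rcases h with h | h <;> obtain ⟨p, rfl⟩ := Sym2.mem_iff_exists.1 h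
    · refine ⟨0, p, ?_⟩
      congr 1
      rw [coe_eq_coe.2 ⟨1, rfl⟩]
      congr 1
      push_cast
      ring
    · refine ⟨1, p, ?_⟩
      congr 1
      rw [coe_eq_coe.2 ⟨1, rfl⟩]
      congr 1
      push_cast
      ring
  obtain ⟨u, hu, hu', rfl⟩ := exists_coe_eq p (3 * x + 1 + k / 2)
  rw [hp]
  change ∃ (k' : ℤ) (s : ℝ), |s| = length (chord _ _) ∧ chord _ _ = _
  rcases le_total u (1 / 2) with h | h
  · refine ⟨k, u, ?_, rfl⟩
    rw [length_chord_of_le (by linarith) (by linarith), abs_of_nonneg hu, add_sub_cancel_left]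
  · refine ⟨k, u - 1, ?_, (chord_shift 0 (-1) (by simp) (by push_cast; ring)).symm⟩
    rw [length_chord_of_ge (by linarith) (by linarith), add_sub_cancel_left,
      abs_of_nonpos (by linarith)]
    ring

/-- Every ambiguous chord which is not a diameter has a short preimage in one of the six arcs. -/
lemma IsAmbiguous.exists_short_pullback {ℓ : Chord} (h : IsAmbiguous x ℓ) (hd : ¬ ℓ.IsDiag)
    (hl : length ℓ ≠ 1 / 2) : ∃ ℓ', InSixth x ℓ' ∧ IsShort ℓ' ∧ sigma ℓ' = ℓ := by
  have hl' := (length_le_half ℓ).lt_of_ne hl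
  obtain ⟨k, s, hs, e⟩ := h.exists_eq
  have hpos := length_pos_iff.2 hd
  have habs : |s / 3| = length ℓ / 3 := by rw [abs_div, hs, abs_of_pos (three_pos (α := ℝ))]
  refine ⟨chord (x + 1 / 3 + k / 6) (x + 1 / 3 + k / 6 + s / 3),
    inSixth_of_le (by rw [habs]; linarith) rfl rfl, ?_, ?_⟩
  · have hab : |x + 1 / 3 + k / 6 - (x + 1 / 3 + k / 6 + s / 3)| = length ℓ / 3 := by
      rw [sub_add_cancel_left, abs_neg, habs]
    rw [IsShort, length_chord (by rw [hab]; linarith), hab]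
    constructor <;> linarith
  · rw [e, sigma_chord]
    congr 1 <;> ring

/-- Short chords with ambiguous image lie over one of the six arcs. -/
lemma inSixth_of_isShort {ℓ : Chord} (h : IsAmbiguous x (sigma ℓ)) (hl : length ℓ ≤ 1 / 6) :
    InSixth x ℓ := by
  obtain ⟨k, s, hs, e⟩ := h.exists_eq
  have e' : sigma ℓ = sigma (chord (x + 1 / 3 + k / 6) (x + 1 / 3 + k / 6 + s / 3)) := by
    rw [e, sigma_chord]
    congr 1 <;> ring
  obtain ⟨i, j, hi, hj, rfl⟩ := exists_shift_of_sigma_eq e'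
  obtain ⟨m, rfl⟩ : ∃ m : ℤ, i = m := by
    rcases hi with rfl | rfl | rfl
    exacts [⟨0, by simp⟩, ⟨1, by simp⟩, ⟨2, by simp⟩]
  set a := x + 1 / 3 + k / 6 + m / 3 with ha
  set b := x + 1 / 3 + k / 6 + s / 3 + j / 3 with hb
  obtain ⟨u, hu, hu', hub⟩ := exists_coe_eq (b : S) a
  obtain ⟨n, hn⟩ := coe_eq_coe.1 hub
  have eb : chord a b = chord a (a + u) := (chord_shift 0 n (by simp) hn).symm
  rw [eb] at hl ⊢
  rcases le_total u (1 / 2) with h' | h'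
  · rw [length_chord_of_le (by linarith) (by linarith)] at hl
    refine inSixth_of_le (k := k + 2 * m) (s := u) ?_ (by rw [ha]; push_cast; ring) rfl
    rw [abs_of_nonneg hu]
    linarith
  · rw [length_chord_of_ge (by linarith) (by linarith)] at hl
    rw [← chord_shift (a := a) (b := a + u) (a' := a) (b' := a + (u - 1)) 0 (-1) (by simp)
      (by push_cast; ring)]
    refine inSixth_of_le (k := k + 2 * m) (s := u - 1) ?_ (by rw [ha]; push_cast; ring) rfl
    rw [abs_of_nonpos (by linarith)]
    linarith

lemma inSixth_add_third {a b : ℝ} (h : InSixth x (chord a b)) (j : ℤ) :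
    InSixth x (chord (a + j / 3) (b + j / 3)) := by
  obtain ⟨k, p, ⟨p1, p2⟩, q, ⟨q1, q2⟩, e⟩ := h
  have hp : p + j / 3 ∈ Icc ((k + 2 * j : ℤ) / 6 : ℝ) (((k + 2 * j : ℤ) + 1) / 6) := by
    constructor <;> push_cast <;> linarith
  have hq : q + j / 3 ∈ Icc ((k + 2 * j : ℤ) / 6 : ℝ) (((k + 2 * j : ℤ) + 1) / 6) := by
    constructor <;> push_cast <;> linarith
  rcases chord_eq_iff.1 e.symm with ⟨m, n, rfl, rfl⟩ | ⟨m, n, rfl, rfl⟩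
  · exact ⟨_, _, hp, _, hq, chord_shift m n (by ring) (by ring)⟩
  · exact ⟨_, _, hq, _, hp, chord_shift n m (by ring) (by ring)⟩

lemma length_add_both (a b r : ℝ) : length (chord (a + r) (b + r)) = length (chord a b) := by
  rw [length_chord_eq_norm, length_chord_eq_norm, add_sub_add_right_eq_sub]

lemma length_longSib_zero (x : ℝ) : length (longSib x 0) = 1 / 3 := by
  rw [length_longSib le_rfl (by norm_num), add_zero]

/-- A diameter maps to a diameter, so none arises from the critical chords by pullback. Diameters
must be excluded because one with an ambiguous endpoint has no short lift. -/
lemma DegenerateFamily.inRegion {ℓ : Chord} (h : DegenerateFamily x ℓ) :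
    (¬ ℓ.IsDiag ∧ length ℓ ≠ 1 / 2) ∧ InRegion x 0 ℓ := by
  have hM := length_longSib_zero x
  induction h with
  | pos =>
    refine ⟨⟨length_pos_iff.1 (by rw [hM]; norm_num), by rw [hM]; norm_num⟩, ?_⟩
    exact inRegion_of_mem_quadPairEdges le_rfl (by norm_num)
      (longSib_zero_mem_quadPairEdges x (.inl rfl))
  | neg =>
    rw [← length_antipode] at hM
    refine ⟨⟨length_pos_iff.1 (by rw [hM]; norm_num), by rw [hM]; norm_num⟩, ?_⟩
    exact inRegion_of_mem_quadPairEdges le_rfl (by norm_num)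
      (longSib_zero_mem_quadPairEdges x (.inr rfl))
  | pullback ℓ ℓ' _ hp _ ih =>
    have hd := not_isDiag_of_sigma_eq hp.1 ih.1.1
    refine ⟨⟨hd, fun e => ih.1.2 ?_⟩, ?_⟩
    · rw [← hp.1, (length_sigma ℓ').2 (by rw [e]; norm_num), e]
      norm_num [abs_of_neg]
    · exact (inRegion_of_not_crosses le_rfl (by norm_num) hd
        (not_crosses_quadPairEdges_zero hp.2)).resolve_right fun h => lt_irrefl _ h.1

lemma DegenerateFamily.not_crosses_longSib {ℓ : Chord} (h : DegenerateFamily x ℓ) :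
    ∀ e ∈ ({longSib x 0, CubicLam.antipode (longSib x 0)} : Set Chord), ¬ Crosses ℓ e :=
  fun e he => h.inRegion.2.not_crosses le_rfl (by norm_num) e
    (longSib_zero_mem_quadPairEdges x he)

lemma DegenerateFamily.not_crosses {ℓ ℓ' : Chord} (h : DegenerateFamily x ℓ)
    (h' : DegenerateFamily x ℓ') : ¬ Crosses ℓ ℓ' := by
  induction h generalizing ℓ' with
  | pos => exact fun hc => h'.not_crosses_longSib _ (.inl rfl) hc.symm
  | neg => exact fun hc => h'.not_crosses_longSib _ (.inr rfl) hc.symm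
  | pullback ℓ ℓ₁ h hp hs ih =>
    cases h' with
    | pos => exact hp.2 _ (.inl rfl)
    | neg => exact hp.2 _ (.inr rfl)
    | pullback ℓ₂ _ h₂ hp₂ hs₂ =>
      intro hc
      refine ih h₂ ?_
      rw [← hp.1, ← hp₂.1]
      refine (DegenerateFamily.pullback _ _ h hp hs).inRegion.2.crosses_sigma le_rfl (by norm_num)
        (DegenerateFamily.pullback _ _ h₂ hp₂ hs₂).inRegion.2 hc ?_ ?_
      · intro _ ha
        rw [hp.1] at ha
        exact (hs ha).2
      · intro _ ha
        rw [hp₂.1] at ha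
        exact (hs₂ ha).2

lemma DegenerateFamily.antipode_mem {ℓ : Chord} (h : DegenerateFamily x ℓ) :
    DegenerateFamily x (CubicLam.antipode ℓ) := by
  induction h with
  | pos => exact .neg
  | neg =>
    rw [antipode_antipode]
    exact .pos
  | pullback ℓ ℓ' _ hp hs ih =>
    refine .pullback _ _ ih ⟨by rw [sigma_antipode, hp.1], fun e he hc => ?_⟩
      fun ha => isShort_antipode (hs (isAmbiguous_of_antipode ha))
    refine hp.2 (CubicLam.antipode e) ?_ ?_
    · rcases he with rfl | rfl
      · exact .inr rfl
      · rw [antipode_antipode]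
        exact .inl rfl
    · rw [← antipode_antipode ℓ']
      exact hc.map_antipode

lemma DegenerateFamily.mem_of_inRegion {ℓ ℓ' : Chord} (h : DegenerateFamily x ℓ)
    (hr : InRegion x 0 ℓ') (e : sigma ℓ' = ℓ) (hs : IsAmbiguous x ℓ → IsShort ℓ') :
    DegenerateFamily x ℓ' :=
  .pullback _ _ h ⟨e, fun _ he => hr.not_crosses le_rfl (by norm_num) _
    (longSib_zero_mem_quadPairEdges x he)⟩ hs

theorem degenerateFamily_lamination (x : ℝ) :
    IsSymmetricLamination ({ℓ | ℓ.IsDiag} ∪ chordClosure {ℓ | DegenerateFamily x ℓ}) ∧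
      IsComajorPair ({ℓ | ℓ.IsDiag} ∪ chordClosure {ℓ | DegenerateFamily x ℓ})
        (chord x (x + 0)) := by
  have hdiag : (chord x (x + 0)).IsDiag := by
    rw [add_zero]
    exact chord_isDiag x
  have hM : (sigma (longSib x 0)).IsDiag := by
    rw [sigma_longSib]
    exact sigma_isDiag hdiag
  have hI {ℓ : Chord} : ¬ Crosses ℓ (sigma (chord x (x + 0))) :=
    fun hc => hc.not_isDiag_right (sigma_isDiag hdiag)
  have hI' {ℓ : Chord} : ¬ Crosses ℓ (sigma (antipode (chord x (x + 0)))) :=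
    fun hc => hc.not_isDiag_right (sigma_isDiag (antipode_isDiag hdiag))
  have hL : IsSymmetricLamination
      ({ℓ | ℓ.IsDiag} ∪ chordClosure {ℓ | DegenerateFamily x ℓ}) := by
    refine isSymmetricLamination_closure ?_ ?_ ?_ ?_ ?_
    · exact fun ℓ h ℓ' h' => DegenerateFamily.not_crosses h h'
    · intro ℓ h
      cases h with
      | pos => exact .inr hM
      | neg =>
        rw [sigma_antipode]
        exact .inr (antipode_isDiag hM)
      | pullback ℓ _ h hp _ =>
        rw [hp.1]
        exact .inl h
    · intro ℓ h
      obtain ⟨⟨hd, hl⟩, -⟩ := DegenerateFamily.inRegion h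
      -- The lift into a region need not be short, so ambiguous chords are lifted over one of the
      -- six arcs instead.
      by_cases ha : IsAmbiguous x ℓ
      · obtain ⟨ℓ', h6, hs, e⟩ := ha.exists_short_pullback hd hl
        exact ⟨ℓ', DegenerateFamily.mem_of_inRegion h h6.inRegion e fun _ => hs, e⟩
      · obtain ⟨ℓ', hr, e⟩ := exists_inRegion_sigma_eq (x := x) (t := 0) (by norm_num) hd hI
        exact ⟨ℓ', DegenerateFamily.mem_of_inRegion h hr e fun h => absurd h ha, e⟩
    · intro p q h
      rw [or_iff_not_imp_left]
      intro h3
      have hnd : ¬ (sigma s(p, q)).IsDiag := fun h => h3 (Sym2.mk_isDiag_iff.1 h)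
      have hreg := (DegenerateFamily.inRegion h).2
      obtain ⟨a, b, e⟩ := exists_eq_chord s(p, q)
      refine hasSiblings_of_eq_chord e ?_
      rw [e] at h hnd hreg
      have hσ : DegenerateFamily x (sigma (chord a b)) ∧
          (IsAmbiguous x (sigma (chord a b)) → IsShort (chord a b)) := by
        have h : DegenerateFamily x (chord a b) := h
        generalize chord a b = ℓ at h hnd
        cases h with
        | pos => exact absurd hM hnd
        | neg =>
          rw [sigma_antipode] at hnd
          exact absurd (antipode_isDiag hM) hnd
        | pullback ℓ _ h hp hs =>
          rw [hp.1]
          exact ⟨h, hs⟩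
      by_cases ha : IsAmbiguous x (sigma (chord a b))
      · left
        have h6 := inSixth_of_isShort ha (hσ.2 ha).2.le
        have h61 := inSixth_add_third h6 1
        have h62 := inSixth_add_third h6 2
        rw [Int.cast_one] at h61
        rw [Int.cast_ofNat] at h62
        exact ⟨DegenerateFamily.mem_of_inRegion hσ.1 h61.inRegion
          (sigma_add_third 1 1 (by norm_num) (by norm_num))
            fun _ => by rw [IsShort, length_add_both]; exact hσ.2 ha,
          DegenerateFamily.mem_of_inRegion hσ.1 h62.inRegion
          (sigma_add_third 2 2 (by norm_num) (by norm_num))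
            fun _ => by rw [IsShort, length_add_both]; exact hσ.2 ha⟩
      · exact (hreg.hasRegionSiblings le_rfl (by norm_num) hI hI').mem_family fun ℓ hr hs =>
          DegenerateFamily.mem_of_inRegion hσ.1 hr hs fun h => absurd h ha
    · exact fun ℓ h => DegenerateFamily.antipode_mem h
  refine ⟨hL, isComajorPair_of_quadEdges_mem hL le_rfl (by norm_num) ?_ (.inl hdiag)
    fun ℓ _ => abs_nonneg _⟩
  have hlong : longSib x 0 ∈ {ℓ : Chord | ℓ.IsDiag} ∪ chordClosure {ℓ | DegenerateFamily x ℓ} :=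
    .inr (subset_chordClosure _ .pos)
  rintro e (rfl | rfl | rfl | rfl)
  · exact hlong
  · rw [medSib_zero]
    exact hlong
  · rw [add_zero]
    exact .inl (chord_isDiag _)
  · rw [add_zero]
    exact .inl (chord_isDiag _)

end Degenerate

/-! ### The case of an invariant diameter -/

section Sixth

variable {x : ℝ}

/-- If `c` is legal and has length `1/6`, then `M_c` is an invariant diameter. -/
lemma exists_three_mul_eq
    (hstrip : ∀ n : ℕ, ¬ MeetsShortStrips x (1 / 6) (sigma^[n] (chord x (x + 1 / 6)))) :
    ∃ j : ℤ, 3 * x = x + 1 / 3 + j / 2 := by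
  have hr := inRegion_of_not_meetsShortStrips (by norm_num) (hstrip 1)
  rw [Function.iterate_one, sigma_chord] at hr
  obtain ⟨R, hR, p, hp, q, hq, hpq, e⟩ := hr.exists_le
  have hl : length (chord (3 * x) (3 * (x + 1 / 6))) = 1 / 2 := by
    rw [length_chord_of_le (by linarith) (by linarith)]
    ring
  have hp' := hR.subset_Icc (by norm_num) le_rfl hp
  have hq' := hR.subset_Icc (by norm_num) le_rfl hq
  have hh : q - p = 1 / 2 := by
    rw [e] at hl
    rcases le_total q (p + 1 / 2) with h | h
    · rw [length_chord_of_le (by linarith) (by linarith)] at hl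
      linarith
    · rw [length_chord_of_ge (by linarith) (by linarith [hp'.1, hq'.2])] at hl
      linarith
  -- For `t = 1/6` the middle region shrinks to the two endpoints of `M_c` and the other arcs have
  -- length `1/6`; the diameter `σ₃(c)` fits only as `M_c`.
  have hp2 : p = 1 / 2 ∧ q = 1 := by
    rcases hR with rfl | rfl | rfl | rfl | rfl | rfl | rfl <;>
      simp only [mem_union, mem_Icc] at hp hq <;> grind
  obtain ⟨rfl, rfl⟩ := hp2
  rcases chord_eq_iff.1 e.symm with ⟨m, n, h, -⟩ | ⟨m, n, -, h⟩
  · exact ⟨2 * m + 1, by push_cast; linarith⟩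
  · exact ⟨2 * n + 2, by push_cast; linarith⟩

lemma chord_half_eq_longSib (j : ℤ) :
    chord (x + 1 / 3 + j / 2) (x + 1 / 3 + j / 2 + 1 / 2) = longSib x (1 / 6) := by
  rw [longSib]
  rcases Int.even_or_odd' j with ⟨k, rfl | rfl⟩
  · exact chord_shift k k (by push_cast; ring) (by push_cast; ring)
  · rw [chord_comm]
    exact chord_shift (k + 1) k (by push_cast; ring) (by push_cast; ring)

lemma antipode_longSib_sixth (x : ℝ) : antipode (longSib x (1 / 6)) = longSib x (1 / 6) := by
  rw [longSib, antipode_chord, chord_comm]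
  exact chord_shift 1 0 (by push_cast; ring) (by push_cast; ring)

lemma length_longSib_sixth (x : ℝ) : length (longSib x (1 / 6)) = 1 / 2 := by
  rw [length_longSib (by norm_num) le_rfl]
  norm_num

lemma sigma_chord_sixth {j : ℤ} (hj : 3 * x = x + 1 / 3 + j / 2) :
    sigma (chord x (x + 1 / 6)) = longSib x (1 / 6) := by
  rw [← chord_half_eq_longSib j, sigma_chord]
  congr 1
  linarith

lemma InSixth.length_le {ℓ : Chord} (h : InSixth x ℓ) : length ℓ ≤ 1 / 6 := by
  obtain ⟨k, -, p, ⟨p1, p2⟩, q, ⟨q1, q2⟩, hpq, rfl⟩ := h.exists_normalized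
  rw [length_chord_of_le (by linarith) (by linarith)]
  linarith

lemma InSixth.not_crosses_longSib {ℓ : Chord} (h : InSixth x ℓ) :
    ¬ Crosses ℓ (longSib x (1 / 6)) := by
  obtain ⟨k, hk, p, ⟨p1, p2⟩, q, ⟨q1, q2⟩, hpq, rfl⟩ := h.exists_normalized
  intro hc
  have e : longSib x (1 / 6) = chord (x + 1 / 3 + 0) (x + 1 / 3 + 1 / 2) := by
    rw [longSib]
    congr 1 <;> ring
  rw [e] at hc
  obtain rfl | rfl | rfl | rfl | rfl | rfl :
      k = 0 ∨ k = 1 ∨ k = 2 ∨ k = 3 ∨ k = 4 ∨ k = 5 := by omega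
  all_goals
    push_cast at p1 p2 q1 q2
    have := hc.alternate (by linarith) hpq (by linarith) le_rfl (by norm_num) (by norm_num)
    grind

/-- Crossing chords lie over the same arc, and tripling stretches an arc of length `1/6` injectively
onto a half circle. -/
lemma InSixth.crosses_sigma {ℓ ℓ' : Chord} (h : InSixth x ℓ) (h' : InSixth x ℓ')
    (hc : Crosses ℓ ℓ') : Crosses (sigma ℓ) (sigma ℓ') := by
  obtain ⟨k, ⟨k0, k5⟩, p, ⟨p1, p2⟩, q, ⟨q1, q2⟩, hpq, rfl⟩ := h.exists_normalized
  obtain ⟨k', ⟨k0', k5'⟩, p', ⟨p1', p2'⟩, q', ⟨q1', q2'⟩, hpq', rfl⟩ := h'.exists_normalized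
  have r0 : (0 : ℝ) ≤ k := by exact_mod_cast k0
  have r0' : (0 : ℝ) ≤ k' := by exact_mod_cast k0'
  have r5 : (k : ℝ) ≤ 5 := by exact_mod_cast k5
  have r5' : (k' : ℝ) ≤ 5 := by exact_mod_cast k5'
  have hk (h1 : p' < q) (h2 : p < q') : k = k' := by
    have l1 : k' < k + 1 := by
      have : (k' : ℝ) < k + 1 := by linarith
      exact_mod_cast this
    have l2 : k < k' + 1 := by
      have : (k : ℝ) < k' + 1 := by linarith
      exact_mod_cast this
    omega
  rcases hc.alternate (by linarith) hpq (by linarith) (by linarith) hpq' (by linarith) with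
    ⟨a1, a2, a3⟩ | ⟨a1, a2, a3⟩
  · obtain rfl := hk (by linarith) (by linarith)
    exact crosses_sigma_of_lt 0 0 0 0 (by linarith) (by linarith) (by linarith) (by linarith)
  · obtain rfl := hk (by linarith) (by linarith)
    exact (crosses_sigma_of_lt 0 0 0 0 (by linarith) (by linarith) (by linarith)
      (by linarith)).symm

/-- The six division points are the preimages of the endpoints of `M_c`. If a short chord passes
over one of them, its image cuts off less than a half circle around an endpoint of `M_c` and so
crosses this diameter. -/
lemma inSixth_of_sigma_not_crosses {j : ℤ} (hj : 3 * x = x + 1 / 3 + j / 2) {ℓ : Chord}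
    (hs : IsShort ℓ) (hc : ¬ Crosses (sigma ℓ) (longSib x (1 / 6))) : InSixth x ℓ := by
  obtain ⟨h0, h1⟩ := hs
  obtain ⟨y, e⟩ := exists_chord_length ℓ
  generalize length ℓ = s at *
  subst e
  have f1 := Int.floor_le (6 * (y - (x + 1 / 3)))
  have f2 := Int.lt_floor_add_one (6 * (y - (x + 1 / 3)))
  generalize ⌊6 * (y - (x + 1 / 3))⌋ = k at *
  have hle : y - (x + 1 / 3) + s ≤ (k + 1) / 6 := by
    by_contra! hlt
    apply hc
    -- By `hj`, tripling the division point `x + 1/3 + (k + 1)/6` gives `x + 1/3 + (j + k + 3)/2`.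
    rw [sigma_chord, ← chord_half_eq_longSib (j + k + 3)]
    push_cast
    exact crosses_of_lt (by linarith) (by linarith) (by linarith) (by linarith)
  exact ⟨k, y - (x + 1 / 3), ⟨by linarith, by linarith⟩, y - (x + 1 / 3) + s,
    ⟨by linarith, hle⟩, by congr 1 <;> ring⟩

lemma inSixth_chord (x : ℝ) : InSixth x (chord x (x + 1 / 6)) := by
  rw [← chord_shift (a' := x + 1) (b' := x + 1 / 6 + 1) 1 1 (by simp) (by simp)]
  refine ⟨4, 2 / 3, ⟨?_, ?_⟩, 5 / 6, ⟨?_, ?_⟩, by congr 1 <;> ring⟩ <;> norm_num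

lemma inSixth_antipode_chord (x : ℝ) : InSixth x (antipode (chord x (x + 1 / 6))) := by
  rw [antipode_chord]
  refine ⟨1, 1 / 6, ⟨?_, ?_⟩, 1 / 3, ⟨?_, ?_⟩, by congr 1 <;> ring⟩ <;> norm_num

lemma length_chord_sixth (x : ℝ) : length (chord x (x + 1 / 6)) = 1 / 6 := by
  rw [length_chord_of_le (by linarith) (by linarith), add_sub_cancel_left]

/-- The two claims support each other: a chord that does not cross `M_c` has its short pullbacks
over the six arcs, and chords over these arcs do not cross `M_c`. -/
lemma SixthFamily.eq_or_inSixth {j : ℤ} (hj : 3 * x = x + 1 / 3 + j / 2) {ℓ : Chord}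
    (h : SixthFamily x ℓ) :
    (ℓ = longSib x (1 / 6) ∨ ¬ ℓ.IsDiag ∧ InSixth x ℓ) ∧ ¬ Crosses ℓ (longSib x (1 / 6)) := by
  have hM : ¬ Crosses (longSib x (1 / 6)) (longSib x (1 / 6)) := by
    intro hc
    have e : longSib x (1 / 6) = chord (x + 1 / 3 + 0) (x + 1 / 3 + 1 / 2) := by
      rw [longSib]
      congr 1 <;> ring
    rw [e] at hc
    have := hc.alternate le_rfl (by norm_num) (by norm_num) le_rfl (by norm_num) (by norm_num)
    grind
  have key {ℓ : Chord} (h1 : ℓ = longSib x (1 / 6) ∨ ¬ ℓ.IsDiag ∧ InSixth x ℓ) :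
      (ℓ = longSib x (1 / 6) ∨ ¬ ℓ.IsDiag ∧ InSixth x ℓ) ∧ ¬ Crosses ℓ (longSib x (1 / 6)) := by
    refine ⟨h1, ?_⟩
    rcases h1 with rfl | h1
    exacts [hM, h1.2.not_crosses_longSib]
  have hd : ¬ (chord x (x + 1 / 6)).IsDiag := not_isDiag_chord (by linarith) (by linarith)
  induction h with
  | diam => exact key (.inl rfl)
  | pos => exact key (.inr ⟨hd, inSixth_chord x⟩)
  | neg => exact key (.inr ⟨by rwa [antipode_isDiag_iff], inSixth_antipode_chord x⟩)
  | pullback ℓ ℓ' _ e hs ih =>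
    exact key (.inr ⟨length_pos_iff.1 hs.1, inSixth_of_sigma_not_crosses hj hs (e ▸ ih.2)⟩)

lemma SixthFamily.sigma_mem {j : ℤ} (hj : 3 * x = x + 1 / 3 + j / 2) {ℓ : Chord}
    (h : SixthFamily x ℓ) : SixthFamily x (sigma ℓ) := by
  cases h with
  | diam =>
    rw [sigma_longSib, sigma_chord_sixth hj]
    exact .diam
  | pos =>
    rw [sigma_chord_sixth hj]
    exact .diam
  | neg =>
    rw [sigma_antipode, sigma_chord_sixth hj, antipode_longSib_sixth]
    exact .diam
  | pullback ℓ _ h e _ => rwa [e]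

lemma SixthFamily.antipode_mem {ℓ : Chord} (h : SixthFamily x ℓ) :
    SixthFamily x (CubicLam.antipode ℓ) := by
  induction h with
  | diam =>
    rw [antipode_longSib_sixth]
    exact .diam
  | pos => exact .neg
  | neg =>
    rw [antipode_antipode]
    exact .pos
  | pullback ℓ ℓ' _ e hs ih =>
    exact .pullback _ _ ih (by rw [sigma_antipode, e]) (isShort_antipode hs)

lemma SixthFamily.not_crosses {j : ℤ} (hj : 3 * x = x + 1 / 3 + j / 2) {ℓ ℓ' : Chord}
    (h : SixthFamily x ℓ) (h' : SixthFamily x ℓ') : ¬ Crosses ℓ ℓ' := by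
  have cross {ℓ ℓ' : Chord} (h : SixthFamily x ℓ) (h' : SixthFamily x ℓ') (hc : Crosses ℓ ℓ') :
      Crosses (sigma ℓ) (sigma ℓ') := by
    rcases (h.eq_or_inSixth hj).1 with rfl | h6
    · exact absurd hc.symm (h'.eq_or_inSixth hj).2
    rcases (h'.eq_or_inSixth hj).1 with rfl | h6'
    · exact absurd hc (h.eq_or_inSixth hj).2
    exact h6.2.crosses_sigma h6'.2 hc
  -- The initial chords `M_c` and `±c` all map to `M_c`, which no chord of the family crosses.
  have base {ℓ : Chord} (h : SixthFamily x ℓ) (e : sigma ℓ = longSib x (1 / 6)) {ℓ' : Chord}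
      (h' : SixthFamily x ℓ') : ¬ Crosses ℓ ℓ' := by
    intro hc
    have := cross h h' hc
    rw [e] at this
    exact ((h'.sigma_mem hj).eq_or_inSixth hj).2 this.symm
  induction h generalizing ℓ' with
  | diam => exact base .diam (by rw [sigma_longSib, sigma_chord_sixth hj]) h'
  | pos => exact base .pos (sigma_chord_sixth hj) h'
  | neg =>
    exact base .neg (by rw [sigma_antipode, sigma_chord_sixth hj, antipode_longSib_sixth]) h'
  | pullback ℓ ℓ₁ h e hs ih =>
    intro hc
    have := cross (.pullback _ _ h e hs) h' hc
    rw [e] at this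
    exact ih (h'.sigma_mem hj) this

lemma SixthFamily.exists_preimage {j : ℤ} (hj : 3 * x = x + 1 / 3 + j / 2) {ℓ : Chord}
    (h : SixthFamily x ℓ) : ∃ ℓ', SixthFamily x ℓ' ∧ sigma ℓ' = ℓ := by
  rcases (h.eq_or_inSixth hj).1 with rfl | ⟨hd, h6⟩
  · exact ⟨_, .diam, by rw [sigma_longSib, sigma_chord_sixth hj]⟩
  · have hl := h6.length_le
    have h0 := length_pos_iff.2 hd
    obtain ⟨y, e⟩ := exists_chord_length ℓ
    have e' : sigma (chord (y / 3) (y / 3 + length ℓ / 3)) = ℓ := by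
      rw [sigma_chord]
      conv_rhs => rw [e]
      congr 1 <;> ring
    refine ⟨_, .pullback _ _ h e' ?_, e'⟩
    rw [IsShort, length_chord_of_le (by linarith) (by linarith)]
    constructor <;> linarith

/-- The initial chords `M_c`, `c`, `-c` form one triple, since `M'_c = -c` for `t = 1/6`; a short
pullback has its rotations by `1/3` and `2/3` as siblings. -/
lemma SixthFamily.siblings {p q : S} (h : SixthFamily x s(p, q)) : HasSiblings {ℓ | SixthFamily x ℓ} p q := by
  have hpos : SixthFamily x (chord x (x + 1 / 6)) := .pos
  have hneg : SixthFamily x (chord (x + 1 / 2) (x + 1 / 6 + 1 / 2)) := by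
    rw [← antipode_chord]
    exact .neg
  have hdiam : SixthFamily x (chord (x + 1 / 3) (x + 1 / 6 + 2 / 3)) := .diam
  have mem {a b a' b' : ℝ} (h : SixthFamily x (chord a b)) (m n : ℤ) (ha : a' = a + m)
      (hb : b' = b + n) : chord a' b' ∈ {ℓ | SixthFamily x ℓ} := by
    rw [chord_shift m n ha hb]
    exact h
  have mem' {a b a' b' : ℝ} (h : SixthFamily x (chord a b)) (m n : ℤ) (ha : b' = a + m)
      (hb : a' = b + n) : chord a' b' ∈ {ℓ | SixthFamily x ℓ} := by
    rw [chord_comm]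
    exact mem h m n ha hb
  generalize hℓ : s(p, q) = ℓ at h
  cases h with
  | diam =>
    exact hasSiblings_of_eq_chord hℓ <| .inr
      ⟨mem' hneg 1 0 (by push_cast; ring) (by push_cast; ring),
        mem hpos 1 1 (by push_cast; ring) (by push_cast; ring)⟩
  | pos =>
    exact hasSiblings_of_eq_chord hℓ <| .inr
      ⟨mem hdiam 0 0 (by push_cast; ring) (by push_cast; ring),
        mem' hneg 0 0 (by push_cast; ring) (by push_cast; ring)⟩
  | neg =>
    rw [antipode_chord] at hℓ
    exact hasSiblings_of_eq_chord hℓ <| .inr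
      ⟨mem' hdiam 1 0 (by push_cast; ring) (by push_cast; ring),
        mem' hpos 1 1 (by push_cast; ring) (by push_cast; ring)⟩
  | pullback ℓ₁ _ h e hs =>
    obtain ⟨a, b, rfl⟩ := exists_eq_chord ℓ
    refine hasSiblings_of_eq_chord hℓ <| .inl
      ⟨.pullback _ _ h ((sigma_add_third 1 1 (by norm_num) (by norm_num)).trans e) ?_,
        .pullback _ _ h ((sigma_add_third 2 2 (by norm_num) (by norm_num)).trans e) ?_⟩ <;>
      rwa [IsShort, length_add_both]

lemma eq_longSib_of_length_eq_half {M : Chord} (hl : length M = 1 / 2)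
    (hc : ¬ Crosses M (longSib x (1 / 6))) : M = longSib x (1 / 6) := by
  have hd : ¬ M.IsDiag := length_pos_iff.1 (by rw [hl]; norm_num)
  obtain ⟨u, v, hu, huv, hv, rfl⟩ := exists_coord_lt (x + 1 / 3) hd
  have e : longSib x (1 / 6) = chord (x + 1 / 3 + 0) (x + 1 / 3 + 1 / 2) := by
    rw [longSib]
    congr 1 <;> ring
  have hv' : v = u + 1 / 2 := by
    rcases le_total v (u + 1 / 2) with h | h
    · rw [length_chord_of_le (by linarith) (by linarith)] at hl
      linarith
    · rw [length_chord_of_ge (by linarith) (by linarith)] at hl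
      linarith
  rw [e] at hc ⊢
  have hu0 : u = 0 := by
    by_contra h0
    have hpos := lt_of_le_of_ne hu (Ne.symm h0)
    exact hc (crosses_of_lt (by linarith) (by linarith) (by linarith) (by linarith)).symm
  subst hu0
  rw [hv', zero_add]

lemma comajor_sixth {d : Chord} (hl : length d ≤ 1 / 6)
    (hs : sigma d = sigma (chord x (x + 1 / 6))) (hdis : DisjointChords d (longSib x (1 / 6))) :
    d = chord x (x + 1 / 6) ∨ d = antipode (chord x (x + 1 / 6)) := by
  obtain ⟨i, j, hi, hj, rfl⟩ := exists_shift_of_sigma_eq hs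
  have n1 : i ≠ 1 := fun e => not_disjointChords_of_left 0 (by rw [e]; simp) hdis
  have n2 : j ≠ 2 := fun e => not_disjointChords_of_right 0 (by rw [e]; simp) hdis
  rcases hi with rfl | rfl | rfl
  · rcases hj with rfl | rfl | rfl
    · exact .inl (chord_shift 0 0 (by simp) (by simp))
    · rw [length_chord_of_le (by linarith) (by linarith)] at hl
      linarith
    · exact absurd rfl n2
  · exact absurd rfl n1
  · rcases hj with rfl | rfl | rfl
    · rw [chord_comm, length_chord_of_le (by linarith) (by linarith)] at hl
      linarith
    · right
      rw [antipode_chord, chord_comm]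
      congr 1 <;> ring
    · exact absurd rfl n2

theorem sixthFamily_lamination
    (hstrip : ∀ n : ℕ, ¬ MeetsShortStrips x (1 / 6) (sigma^[n] (chord x (x + 1 / 6)))) :
    IsSymmetricLamination ({ℓ | ℓ.IsDiag} ∪ chordClosure {ℓ | SixthFamily x ℓ}) ∧
      IsComajorPair ({ℓ | ℓ.IsDiag} ∪ chordClosure {ℓ | SixthFamily x ℓ})
        (chord x (x + 1 / 6)) := by
  obtain ⟨j, hj⟩ := exists_three_mul_eq hstrip
  have hL : IsSymmetricLamination ({ℓ | ℓ.IsDiag} ∪ chordClosure {ℓ | SixthFamily x ℓ}) :=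
    isSymmetricLamination_closure
      (fun ℓ h ℓ' h' => SixthFamily.not_crosses hj h h')
      (fun ℓ h => .inl (SixthFamily.sigma_mem hj h))
      (fun ℓ h => SixthFamily.exists_preimage hj h)
      (fun p q h => .inr (SixthFamily.siblings h))
      (fun ℓ h => SixthFamily.antipode_mem h)
  refine ⟨hL, ?_⟩
  set L := {ℓ : Chord | ℓ.IsDiag} ∪ chordClosure {ℓ | SixthFamily x ℓ} with hLdef
  have memL {ℓ : Chord} (h : SixthFamily x ℓ) : ℓ ∈ L := .inr (subset_chordClosure _ h)
  -- The allowed lengths form a closed set. Leaves of length `1/6` tie with `M_c` in distance from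
  -- `1/3`, but a comajor needs a major longer than `1/6`, hence a diameter, and two distinct
  -- diameters cross.
  have hlen : ∀ ℓ ∈ L, length ℓ ≤ 1 / 6 ∨ length ℓ = 1 / 2 := by
    rintro ℓ (hℓ | hℓ)
    · rw [length_eq_zero_iff.2 hℓ]
      norm_num
    · refine length_mem_of_mem_chordClosure (K := Iic (1 / 6) ∪ {1 / 2})
        (isClosed_Iic.union isClosed_singleton) (fun ℓ h => ?_) hℓ
      rcases (SixthFamily.eq_or_inSixth hj h).1 with rfl | h6
      · exact .inr (length_longSib_sixth x)
      · exact .inl h6.2.length_le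
  have hM : IsMajor L (longSib x (1 / 6)) := by
    refine ⟨memL .diam, fun ℓ hℓ => ?_⟩
    rw [length_longSib_sixth, le_abs]
    rcases hlen ℓ hℓ with h | h
    · right
      rw [abs_of_pos (by norm_num)]
      linarith
    · left
      rw [h, abs_of_pos (by norm_num)]
  have lM : 1 / 6 < length (longSib x (1 / 6)) := by
    rw [length_longSib_sixth]
    norm_num
  have hdis := disjointChords_longSib (x := x) (t := 1 / 6) (by norm_num) le_rfl
  ext d
  change IsComajor L d ↔ d = _ ∨ d = _
  constructor
  · rintro ⟨-, hdl, M, ⟨hML, -⟩, hMl, hs, hdisj⟩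
    obtain rfl : M = longSib x (1 / 6) :=
      eq_longSib_of_length_eq_half ((hlen M hML).resolve_left (by linarith))
        (hL.not_crosses _ hML _ hM.1)
    exact comajor_sixth hdl (hs.trans (sigma_longSib x _)) hdisj
  · rintro (rfl | rfl)
    · exact ⟨memL .pos, (length_chord_sixth x).le, _, hM, lM, (sigma_longSib x _).symm, hdis⟩
    · refine ⟨memL .neg, ?_, _, hM, lM, ?_, ?_⟩
      · rw [length_antipode]
        exact (length_chord_sixth x).le
      · rw [sigma_antipode, ← sigma_longSib, ← sigma_antipode, antipode_longSib_sixth]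
      · rw [← antipode_longSib_sixth]
        exact hdis.map_antipode

end Sixth

/-! ### The pullback family does not depend on the coordinates -/

lemma longSib_add_int (x t : ℝ) (n : ℤ) : longSib (x + n) t = longSib x t :=
  chord_shift n n (by ring) (by ring)

lemma quadEdges_add_int (x t : ℝ) (n : ℤ) : quadEdges (x + n) t = quadEdges x t := by
  have e1 : medSib (x + n) t = medSib x t := chord_shift n n (by ring) (by ring)
  have e2 : chord (x + n + 1 / 3) (x + n + t + 1 / 3) = chord (x + 1 / 3) (x + t + 1 / 3) :=
    chord_shift n n (by ring) (by ring)
  have e3 : chord (x + n + 2 / 3) (x + n + t + 2 / 3) = chord (x + 2 / 3) (x + t + 2 / 3) :=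
    chord_shift n n (by ring) (by ring)
  rw [quadEdges, quadEdges, longSib_add_int, e1, e2, e3]

lemma chord_add_int (x t : ℝ) (n : ℤ) : chord (x + n) (x + n + t) = chord x (x + t) :=
  chord_shift n n (by ring) (by ring)

lemma DegenerateFamily.of_add_int {x : ℝ} {n : ℤ} {ℓ : Chord}
    (h : DegenerateFamily (x + n) ℓ) : DegenerateFamily x ℓ := by
  induction h with
  | pos =>
    rw [longSib_add_int]
    exact .pos
  | neg =>
    rw [longSib_add_int]
    exact .neg
  | pullback ℓ ℓ' _ hp hs ih =>
    rw [longSib_add_int] at hp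
    have e1 : ((3 * (x + n) : ℝ) : S) = (3 * x : ℝ) :=
      (coe_eq_coe.2 ⟨3 * n, by push_cast; ring⟩).symm
    have e2 : ((3 * (x + n) + 1 / 2 : ℝ) : S) = (3 * x + 1 / 2 : ℝ) :=
      (coe_eq_coe.2 ⟨3 * n, by push_cast; ring⟩).symm
    rw [e1, e2] at hs
    exact .pullback _ _ ih hp hs

lemma NondegenerateFamily.of_add_int {x t : ℝ} {n : ℤ} {ℓ : Chord}
    (h : NondegenerateFamily (x + n) t ℓ) : NondegenerateFamily x t ℓ := by
  induction h with
  | orbit ℓ h =>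
    rw [chord_add_int] at h
    exact .orbit _ h
  | edge ℓ h =>
    rw [quadEdges_add_int] at h
    exact .edge _ h
  | pullback ℓ ℓ' _ hp ih =>
    rw [quadEdges_add_int] at hp
    exact .pullback _ _ ih hp

lemma SixthFamily.of_add_int {x : ℝ} {n : ℤ} {ℓ : Chord} (h : SixthFamily (x + n) ℓ) :
    SixthFamily x ℓ := by
  induction h with
  | diam =>
    rw [longSib_add_int]
    exact .diam
  | pos =>
    rw [chord_add_int]
    exact .pos
  | neg =>
    rw [chord_add_int]
    exact .neg
  | pullback ℓ ℓ' _ e hs ih => exact .pullback _ _ ih e hs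

/-- The coordinates of a chord of length at most `1/6` are unique up to integers. -/
lemma eq_of_chord_eq {x t x' t' : ℝ} (h0 : 0 ≤ t) (h1 : t ≤ 1 / 6) (h0' : 0 ≤ t')
    (h1' : t' ≤ 1 / 6) (h : chord x (x + t) = chord x' (x' + t')) :
    t' = t ∧ ∃ n : ℤ, x' = x + n := by
  have ht : t' = t := by
    have := congrArg length h
    rw [length_chord_of_le (by linarith) (by linarith),
      length_chord_of_le (by linarith) (by linarith)] at this
    linarith
  subst ht
  refine ⟨rfl, ?_⟩
  rcases chord_eq_iff.1 h with ⟨m, n, hm, -⟩ | ⟨m, n, hm, hn⟩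
  · exact ⟨m, hm⟩
  -- With the endpoints swapped, the integer `m - n` equals `2t`, so it vanishes.
  · have l1 : m - n < 1 := by
      have : (m : ℝ) - n < 1 := by linarith
      exact_mod_cast this
    have l2 : -1 < n - m := by omega
    have l3 : n - m < 1 := by
      have : (n : ℝ) - m < 1 := by linarith
      exact_mod_cast this
    obtain rfl : n = m := by omega
    exact ⟨n, by linarith⟩

theorem pullbackFamily_chord {x t : ℝ} (h0 : 0 ≤ t) (h1 : t ≤ 1 / 6) :
    pullbackFamily (chord x (x + t)) = {ℓ | (t = 0 ∧ DegenerateFamily x ℓ) ∨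
      (0 < t ∧ t < 1 / 6 ∧ NondegenerateFamily x t ℓ) ∨ (t = 1 / 6 ∧ SixthFamily x ℓ)} := by
  ext ℓ
  constructor
  · rintro ⟨x', t', e, h⟩
    have hb : 0 ≤ t' ∧ t' ≤ 1 / 6 := by
      rcases h with ⟨h, -⟩ | ⟨h, h', -⟩ | ⟨h, -⟩ <;> constructor <;> linarith
    obtain ⟨rfl, n, rfl⟩ := eq_of_chord_eq h0 h1 hb.1 hb.2 e
    rcases h with ⟨h, h'⟩ | ⟨h, h', h''⟩ | ⟨h, h'⟩
    · exact .inl ⟨h, h'.of_add_int⟩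
    · exact .inr <| .inl ⟨h, h', h''.of_add_int⟩
    · exact .inr <| .inr ⟨h, h'.of_add_int⟩
  · exact fun h => ⟨x, t, rfl, h⟩

/-- The pullback lamination of a legal pair. -/
theorem pullbackLamination_of_isLegal {c : Chord} (h : IsLegal c) :
    IsSymmetricLamination (pullbackLamination c) ∧ IsComajorPair (pullbackLamination c) c := by
  rcases h with h | ⟨x, t, h0, h1, rfl, hnc, hstrip⟩
  · obtain ⟨x, e⟩ := exists_chord_length c
    rw [length_eq_zero_iff.2 h] at e
    subst e
    have : pullbackFamily (chord x (x + 0)) = {ℓ | DegenerateFamily x ℓ} := by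
      rw [pullbackFamily_chord le_rfl (by norm_num)]
      ext ℓ
      change (0 = 0 ∧ DegenerateFamily x ℓ) ∨ ((0 : ℝ) < 0 ∧ _) ∨ ((0 : ℝ) = 1 / 6 ∧ _) ↔ _
      norm_num
    rw [pullbackLamination, this]
    exact degenerateFamily_lamination x
  · rcases h1.lt_or_eq with h1 | rfl
    · have : pullbackFamily (chord x (x + t)) = {ℓ | NondegenerateFamily x t ℓ} := by
        rw [pullbackFamily_chord h0.le h1.le]
        ext ℓ
        change (t = 0 ∧ _) ∨ (0 < t ∧ t < 1 / 6 ∧ NondegenerateFamily x t ℓ) ∨ (t = 1 / 6 ∧ _) ↔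
          NondegenerateFamily x t ℓ
        simp only [h0.ne', h0, h1, h1.ne, false_and, true_and, or_false, false_or]
      rw [pullbackLamination, this]
      exact nondegenerateFamily_lamination h0 h1 hnc hstrip
    · have : pullbackFamily (chord x (x + 1 / 6)) = {ℓ | SixthFamily x ℓ} := by
        rw [pullbackFamily_chord h0.le le_rfl]
        ext ℓ
        change ((1 / 6 : ℝ) = 0 ∧ _) ∨ (_ ∧ (1 / 6 : ℝ) < 1 / 6 ∧ _) ∨
          ((1 / 6 : ℝ) = 1 / 6 ∧ SixthFamily x ℓ) ↔ SixthFamily x ℓ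
        norm_num
      rw [pullbackLamination, this]
      exact sixthFamily_lamination hstrip

end CubicLam

theorem mainTheorem5 :
    (∀ c : CubicLam.Chord, CubicLam.IsLegal c →
      CubicLam.IsSymmetricLamination (CubicLam.pullbackLamination c) ∧
        CubicLam.IsComajorPair (CubicLam.pullbackLamination c) c) ∧
    (∀ c : CubicLam.Chord,
      (∃ L : Set CubicLam.Chord,
        CubicLam.IsSymmetricLamination L ∧ CubicLam.IsComajorPair L c) ↔
      CubicLam.IsLegal c) :=
  ⟨fun _ h => CubicLam.pullbackLamination_of_isLegal h, fun _ =>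
    ⟨fun ⟨_, hL, h⟩ => CubicLam.isLegal_of_isComajorPair hL h, fun h =>
      ⟨_, CubicLam.pullbackLamination_of_isLegal h⟩⟩⟩
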